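/- Let $n$ be a natural number, $\tilde k>0$, and let $\Phi(\xi,\mathbf p)\ge 0$, $(\xi,\mathbf p)\in\mathbb R\times\mathbb R^2$, be a measurable spectral density with $$\Phi(\xi,\mathbf p)\le K\,(\eta^2+\xi^2+|\mathbf p|^2)^{-H-3/2}\qquad ((\xi,\mathbf p)\neq 0)$$ for some constant $K<\infty$. Consider, in $L^2(\mathbb R^{2n})$, the $n$-point moment equation $$\partial_z F_z=(\mathcal C_1+\mathcal C_2)F_z,\qquad \mathcal C_1=\frac{i}{2\tilde k}\sum_{j=1}^n\Delta_{\mathbf x_j},\qquad \mathcal C_2=-\tilde k^2\sum_{j,l=1}^n\Gamma(\mathbf x_j,\mathbf x_l),$$ where $\mathcal C_1$ and the multiplication operator $\mathcal C_2$ have their maximal domains, with initial data $F_0\in L^2(\mathbb R^{2n})$. This includes $F_0(\mathbf x_1,\dots,\mathbf x_n)=\mathbb E[\Psi_0(\mathbf x_1)\cdots\Psi_0(\mathbf x_n)]$ for every jointly measurable random field $\Psi_0$ with $\mathbb E\|\Psi_0\|_{L^2(\mathbb R^2)}^n<\infty$: this function lies in $L^2(\mathbb R^{2n})$. A weak solution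 on $[0,Z]$ (or $[0,\infty)$) is a weakly continuous $L^2(\mathbb R^{2n})$-valued function $F$ with initial value $F_0$ such that $\int F_z\theta-\int F_0\theta=\int_0^z\int F_s(\mathcal C_1+\mathcal C_2)\theta\,d\mathbf x\,ds$ for all $\theta\in C_c^\infty(\mathbb R^{2n})$ and all $z$. Well-posed means: for every $F_0\in L^2(\mathbb R^{2n})$ there is a norm-continuous solution on $[0,\infty)$; solutions on each $[0,Z]$ are unique; and they depend on $F_0$ in a Lipschitz way, uniformly on $[0,Z]$. 1. Let $\eta>0$, $H\in(0,1)$ and $\Gamma(\mathbf x,\mathbf y)=\bar\Gamma(\mathbf x,\mathbf y)=\pi\int\cos((\mathbf x-\mathbf y)\cdot\mathbf p)\,\Phi(0,\mathbf p)\,d\mathbf p$. This integral converges absolutely, $\mathcal C_2$ is bounded, and $\mathcal C_1$ generates a strongly continuous contraction semigroup $e^{z\mathcal C_1}$. The mild equation $$F_z=e^{z\mathcal C_1}F_0+\int_0^z e^{(z-s)\mathcal C_1}\mathcal C_2F_s\,ds$$ is well posed for norm-continuous $F$; on each $[0,Z]$ its solutions are exactly the weak solutions of the moment equation, which is therefore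 well posed as well. 2. Let $\eta=0$, $H\in(0,1/2)$ and $\Gamma(\mathbf x,\mathbf y)=\bar\Gamma'(\mathbf x,\mathbf y)=\pi\int(e^{i\mathbf x\cdot\mathbf p}-1)(e^{-i\mathbf y\cdot\mathbf p}-1)\,\Phi(0,\mathbf p)\,d\mathbf p$. This integral converges absolutely, and $\mathcal C_2$ is real and non-positive everywhere. Each of $\mathcal C_1$, $\mathcal C_2$ and the closure of $\mathcal C_1+\mathcal C_2$ (defined on $D(\mathcal C_1)\cap D(\mathcal C_2)$) generates a strongly continuous contraction semigroup on $L^2(\mathbb R^{2n})$, and $$\lim_{m\to\infty}\Big[e^{\frac zm\mathcal C_1}e^{\frac zm\mathcal C_2}\Big]^mF=e^{z(\mathcal C_1+\mathcal C_2)}F\qquad (z\ge0,\ F\in L^2(\mathbb R^{2n})).$$ The semigroup $e^{z(\mathcal C_1+\mathcal C_2)}$ is the only strongly continuous semigroup whose generator extends $\mathcal C_1+\mathcal C_2$. The function $z\mapsto e^{z(\mathcal C_1+\mathcal C_2)}F_0$ is a weak solution on $[0,\infty)$, and the moment equation is well posed in the weak sense. -/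

import Mathlib

open MeasureTheory Filter Topology Set

noncomputable section

namespace BeamWave

/-- The transverse plane. -/
abbrev Plane : Type := EuclideanSpace ℝ (Fin 2)

/-- The space `ℝ^{2n}` of `n`-tuples `(x 0, …, x (n-1))` of points of the plane, with its Euclidean
norm and Lebesgue measure. -/
abbrev Config (n : ℕ) : Type := PiLp 2 (fun _ : Fin n => Plane)

/-- `L²(ℝ^{2n})`, complex valued. -/
abbrev L2 (n : ℕ) : Type := Lp ℂ 2 (volume : Measure (Config n))

/-! ### Spectra and covariances -/

/-- `Φ ξ p` is a spectral density on `ℝ × ℝ²` (`ξ` longitudinal, `p` transverse) with zero inner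
scale and inverse outer scale `η`, subject to the power-law upper bound with exponent `H` and
constant `K`. The bound is not required at `(ξ, p) = 0`, where it is singular if `η = 0`. -/
structure IsSpectralDensity (H η K : ℝ) (Φ : ℝ → Plane → ℝ) : Prop where
  measurable : Measurable (Function.uncurry Φ)
  nonneg : ∀ ξ p, 0 ≤ Φ ξ p
  bound : ∀ ξ p, (ξ, p) ≠ (0, 0) →
    Φ ξ p ≤ K * (η ^ 2 + (ξ ^ 2 + ‖p‖ ^ 2)) ^ (-H - 3 / 2)

/-- The integrand of the covariance `Γ̄`. -/
def covKernel (Φ : ℝ → Plane → ℝ) (x y p : Plane) : ℝ :=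
  Real.cos (inner ℝ (x - y) p) * Φ 0 p

/-- The homogeneous covariance
`Γ̄(x, y) = π ∫ cos((x - y)·p) Φ(0, p) dp`. -/
def cov (Φ : ℝ → Plane → ℝ) (x y : Plane) : ℂ :=
  ((Real.pi * ∫ p : Plane, covKernel Φ x y p : ℝ) : ℂ)

/-- The integrand of the covariance `Γ̄'`. -/
def structCovKernel (Φ : ℝ → Plane → ℝ) (x y p : Plane) : ℂ :=
  (Complex.exp (Complex.I * (inner ℝ x p : ℝ)) - 1) *
    (Complex.exp (-Complex.I * (inner ℝ y p : ℝ)) - 1) * (Φ 0 p : ℂ)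

/-- The covariance of the increments from the origin,
`Γ̄'(x, y) = π ∫ (exp(i x·p) - 1) (exp(-i y·p) - 1) Φ(0, p) dp`. -/
def structCov (Φ : ℝ → Plane → ℝ) (x y : Plane) : ℂ :=
  (Real.pi : ℂ) * ∫ p : Plane, structCovKernel Φ x y p

/-- The function `C₂(x₁, …, x_n) = -k² ∑_{j,l} Γ(x_j, x_l)`. -/
def potential {n : ℕ} (k : ℝ) (Γ : Plane → Plane → ℂ) (x : Config n) : ℂ :=
  -((k : ℂ) ^ 2) * ∑ j : Fin n, ∑ l : Fin n, Γ (x j) (x l)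

/-! ### The operators `C₁` and `C₂` -/

/-- Test functions: complex-valued, smooth, compactly supported. -/
def IsTest {n : ℕ} (θ : Config n → ℂ) : Prop :=
  ContDiff ℝ ((⊤ : ℕ∞) : WithTop ℕ∞) θ ∧ HasCompactSupport θ

/-- `(i / 2k) ∑_j Δ_{x_j} θ` for a smooth function `θ`; the sum of the Laplacians in the planar
variables is the Laplacian of `ℝ^{2n}`. -/
def kineticTest {n : ℕ} (k : ℝ) (θ : Config n → ℂ) (x : Config n) : ℂ :=
  Complex.I / (2 * (k : ℂ)) * Laplacian.laplacian θ x

/-- The graph of `C₁ = (i / 2k) ∑_j Δ_{x_j}` as an unbounded operator on `L²(ℝ^{2n})`, with its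
maximal domain: `C₁ f = g` in the sense of distributions. -/
def kineticGraph (n : ℕ) (k : ℝ) : Set (L2 n × L2 n) :=
  {q | ∀ θ : Config n → ℂ, IsTest θ →
    ∫ x, q.2 x * θ x = ∫ x, q.1 x * kineticTest k θ x}

/-- The graph of the operator of multiplication by `V` on `L²(ℝ^{2n})`, with its maximal
domain. -/
def multGraph {n : ℕ} (V : Config n → ℂ) : Set (L2 n × L2 n) :=
  {q | ∀ᵐ x, q.2 x = V x * q.1 x}

/-- The graph of the sum of two operators given by their graphs, on the intersection of the two
domains. -/
def sumGraph {E : Type*} [AddCommGroup E] (A B : Set (E × E)) : Set (E × E) :=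
  {q | ∃ g₁ g₂ : E, (q.1, g₁) ∈ A ∧ (q.1, g₂) ∈ B ∧ q.2 = g₁ + g₂}

/-! ### Semigroups; only the values at times `t ≥ 0` matter -/

section Semigroup

variable {E : Type*} [NormedAddCommGroup E] [NormedSpace ℂ E]

/-- Strongly continuous one-parameter semigroups of bounded operators. -/
structure IsC0Semigroup (T : ℝ → E →L[ℂ] E) : Prop where
  zero : T 0 = 1
  add : ∀ s t : ℝ, 0 ≤ s → 0 ≤ t → T (s + t) = T s * T t
  cont : ∀ f : E, ContinuousOn (fun t => T t f) (Ici 0)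

/-- Strongly continuous one-parameter semigroups of contractions. -/
structure IsContractionSemigroup (T : ℝ → E →L[ℂ] E) : Prop extends IsC0Semigroup T where
  contraction : ∀ t : ℝ, 0 ≤ t → ‖T t‖ ≤ 1

/-- The graph of the infinitesimal generator of `T`. -/
def generatorGraph (T : ℝ → E →L[ℂ] E) : Set (E × E) :=
  {q | Tendsto (fun h : ℝ => ((h⁻¹ : ℝ) : ℂ) • (T h q.1 - q.1)) (𝓝[>] 0) (𝓝 q.2)}

end Semigroup

/-! ### Solutions of `∂_z F = (C₁ + C₂) F`, `F 0 = F₀`, on an interval `I` starting at `0` -/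

/-- Weak solutions on `I`, where `C₂` is multiplication by `V`: `F` is weakly continuous with
values in `L²` and satisfies the equation, integrated in `z` and tested against smooth compactly
supported functions. -/
structure IsWeakSolution {n : ℕ} (k : ℝ) (V : Config n → ℂ) (I : Set ℝ) (F₀ : L2 n)
    (F : ℝ → L2 n) : Prop where
  weakCont : ∀ g : L2 n, ContinuousOn (fun z => inner ℂ g (F z)) I
  init : F 0 = F₀
  eqn : ∀ θ : Config n → ℂ, IsTest θ → ∀ z ∈ I,
    (∫ x, F z x * θ x) - ∫ x, F₀ x * θ x =
      ∫ s in (0 : ℝ)..z, ∫ x, F s x * (kineticTest k θ x + V x * θ x)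

/-- Mild solutions on `I`, where `S z` stands for `exp(z C₁)` and `B` for the bounded operator
`C₂`: continuous `F` with `F z = exp(z C₁) F₀ + ∫_0^z exp((z - s) C₁) C₂ F_s ds`. -/
structure IsMildSolution {n : ℕ} (S : ℝ → L2 n →L[ℂ] L2 n) (B : L2 n →L[ℂ] L2 n) (I : Set ℝ)
    (F₀ : L2 n) (F : ℝ → L2 n) : Prop where
  cont : ContinuousOn F I
  eqn : ∀ z ∈ I, F z = S z F₀ + ∫ s in (0 : ℝ)..z, S (z - s) (B (F s))

/-- Well-posedness on `L²(ℝ^{2n})` for a notion `Sol I F₀ F` of "`F` is a solution on `I` with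
initial value `F₀`": global existence of a norm-continuous solution, uniqueness on every interval
`[0, Z]`, and Lipschitz dependence on the initial value, uniformly on `[0, Z]`. -/
structure WellPosed {n : ℕ} (Sol : Set ℝ → L2 n → (ℝ → L2 n) → Prop) : Prop where
  exist : ∀ F₀ : L2 n, ∃ F : ℝ → L2 n, ContinuousOn F (Ici 0) ∧ Sol (Ici 0) F₀ F
  unique : ∀ Z : ℝ, 0 < Z → ∀ (F₀ : L2 n) (F G : ℝ → L2 n),
    Sol (Icc 0 Z) F₀ F → Sol (Icc 0 Z) F₀ G → EqOn F G (Icc 0 Z)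
  stable : ∀ Z : ℝ, 0 < Z → ∃ M : ℝ, ∀ (F₀ G₀ : L2 n) (F G : ℝ → L2 n),
    Sol (Icc 0 Z) F₀ F → Sol (Icc 0 Z) G₀ G → ∀ z ∈ Icc 0 Z, ‖F z - G z‖ ≤ M * ‖F₀ - G₀‖

/-- The `n`-point function `E[Ψ₀(x₁) ⋯ Ψ₀(x_n)]` of a random field `Ψ₀`. -/
def initialCorrelation {Ω : Type*} [MeasurableSpace Ω] (P : Measure Ω) (Ψ₀ : Ω → Plane → ℂ)
    (n : ℕ) (x : Config n) : ℂ :=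
  ∫ ω, ∏ j : Fin n, Ψ₀ ω (x j) ∂P

end BeamWave

end

open BeamWave

open MeasureTheory Filter Topology Set
open BeamWave
open scoped SchwartzMap LineDeriv Laplacian FourierTransform

namespace BeamWave

section Abstract

variable {H : Type*} [NormedAddCommGroup H] [InnerProductSpace ℂ H]

/-! ### Strong convergence of bounded families -/

/-! Write `a = 1 / (2k)` and `V` for the potential. Expanding the covariance turns the double sum
over `j, l` into the integral against `Φ 0` of a squared modulus: that of `∑ exp(i x_j·p)` in the
first case, of `∑ (exp(i x_j·p) - 1)` in the second. Hence `V` is continuous, real and non-positive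
in both cases, and bounded in the first; the rest uses nothing else about the spectrum.

The heart is that `i a Δ + V` on compactly supported smooth functions is essentially m-dissipative,
however fast `V` grows, and that its closure is the maximal distributional operator
(`weakGraph_eq_closure`). This reduces to the density of the range of `r - i a Δ - V` on test
functions (`exists_test_near`). For `V = 0` the Fourier transform gives it, and a bounded
dissipative potential is added in small steps (`denseRange_sub_of_dissipative`). For general `V`,
truncate it, solve approximately for a Schwartz function `θ`, and multiply by a cutoff `χ` of scale
`R` living where the truncation is invisible. The error is the commutator `i a (2 ∇χ·∇θ + θ Δχ)`. It
is `O(1/R)`, because `V` is real, so that the imaginary part of the energy identity bounds `a ‖∇θ‖²`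
independently of the truncation. Since `i a Δ + V` is symmetric for the bilinear pairing `∫ f g`,
the same density excludes non-zero weak solutions of `(i a Δ + V) w = r w`.

Hille–Yosida (`IsMDissipative.exists_semigroup`) then yields the semigroup `T`, and Chernoff's
theorem on the core of test functions yields the product formula. A competing `C₀` semigroup has a
closed generator, which therefore contains the closure of the sum. For a weak solution `F`, the
functionals `f ↦ ∫ F_s f` solve the equation dual to `T`, so `s ↦ ∫ F_s (T (z - s) f)` is constant
and `F` is determined by `F₀`. Mild solutions are treated by Duhamel and Gronwall, and the initial
correlation by a weighted Cauchy–Schwarz inequality (`memLp_initialCorrelation`). -/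

theorem tendsto_apply_of_dense {ι : Type*} {l : Filter ι} {L : ι → H →L[ℂ] H} {L₀ : H →L[ℂ] H}
    {C : ℝ} (hL : ∀ᶠ i in l, ‖L i‖ ≤ C) {D : Set H} (hD : Dense D)
    (h : ∀ f ∈ D, Tendsto (fun i => L i f) l (𝓝 (L₀ f))) (f : H) :
    Tendsto (fun i => L i f) l (𝓝 (L₀ f)) := by
  rw [Metric.tendsto_nhds]
  intro ε hε
  set K : ℝ := |C| + ‖L₀‖ + 1 with hK
  have hKpos : 0 < K := by positivity
  obtain ⟨g, hgD, hg⟩ := Metric.dense_iff.1 hD f (ε / (2 * K)) (by positivity)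
  rw [Metric.mem_ball, dist_eq_norm] at hgD
  filter_upwards [hL, Metric.tendsto_nhds.1 (h g hg) (ε / 2) (by positivity)] with i hi hig
  rw [dist_eq_norm] at hig ⊢
  have h1 : L i f - L₀ f = (L i g - L₀ g) + (L₀ (g - f) - L i (g - f)) := by
    simp only [map_sub]; abel
  have h2 : ‖L₀ (g - f) - L i (g - f)‖ ≤ (‖L₀‖ + |C|) * ‖g - f‖ := by
    refine (norm_sub_le _ _).trans ?_
    rw [add_mul]
    gcongr
    · exact L₀.le_opNorm _
    · exact ((L i).le_opNorm _).trans (by gcongr; exact hi.trans (le_abs_self C))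
  have h3 : (‖L₀‖ + |C|) * ‖g - f‖ ≤ K * (ε / (2 * K)) := by
    gcongr
    rw [hK]; linarith
  have h4 : K * (ε / (2 * K)) = ε / 2 := by field_simp
  rw [h1]
  calc _ ≤ _ := norm_add_le _ _
    _ < ε := by linarith

theorem cauchySeq_apply_of_dense {L : ℕ → H →L[ℂ] H} {C : ℝ} (hL : ∀ i, ‖L i‖ ≤ C)
    {D : Set H} (hD : Dense D) (h : ∀ f ∈ D, CauchySeq (fun i => L i f)) (f : H) :
    CauchySeq (fun i => L i f) := by
  rw [Metric.cauchySeq_iff']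
  intro ε hε
  have hC : 0 ≤ C := (norm_nonneg _).trans (hL 0)
  obtain ⟨g, hgD, hg⟩ := Metric.dense_iff.1 hD f (ε / (4 * (C + 1))) (by positivity)
  rw [Metric.mem_ball, dist_eq_norm] at hgD
  obtain ⟨N, hN⟩ := Metric.cauchySeq_iff'.1 (h g hg) (ε / 2) (by positivity)
  refine ⟨N, fun n hn => ?_⟩
  have hig := hN n hn
  rw [dist_eq_norm] at hig ⊢
  have h1 : L n f - L N f = (L n g - L N g) + (L N (g - f) - L n (g - f)) := by
    simp only [map_sub]; abel
  have h2 : ‖L N (g - f) - L n (g - f)‖ ≤ (C + C) * ‖g - f‖ := by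
    refine (norm_sub_le _ _).trans ?_
    rw [add_mul]
    gcongr <;> exact ((L _).le_opNorm _).trans (by gcongr; exact hL _)
  have h3 : (C + C) * ‖g - f‖ ≤ (2 * (C + 1)) * (ε / (4 * (C + 1))) := by
    gcongr
    linarith
  have h4 : (2 * (C + 1)) * (ε / (4 * (C + 1))) = ε / 2 := by field_simp; norm_num
  rw [h1]
  calc _ ≤ _ := norm_add_le _ _
    _ < ε := by linarith

/-! ### Exponentials of bounded dissipative operators -/

variable [CompleteSpace H]

theorem hasDerivAt_exp_smul_apply (A : H →L[ℂ] H) (f : H) (t : ℝ) :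
    HasDerivAt (fun s : ℝ => NormedSpace.exp (s • A) f) (A (NormedSpace.exp (t • A) f)) t := by
  have h := hasDerivAt_exp_smul_const' (𝕂 := ℝ) A t
  have h2 := (ContinuousLinearMap.apply ℂ H f).hasFDerivAt.restrictScalars ℝ |>.comp_hasDerivAt t h
  exact h2.congr_deriv (by simp)

theorem exp_smul_apply_comm (A : H →L[ℂ] H) (f : H) (t : ℝ) :
    A (NormedSpace.exp (t • A) f) = NormedSpace.exp (t • A) (A f) := by
  have h : Commute A (NormedSpace.exp (t • A)) :=
    ((Commute.refl A).smul_right t).exp_right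
  exact congrArg (fun L : H →L[ℂ] H => L f) h.eq

/-- The derivative of `‖exp(sA) f‖²` is twice the real part of `⟨u, A u⟩` at `u = exp(sA) f`, hence
non-positive. -/
theorem norm_exp_smul_apply_le {A : H →L[ℂ] H} (hA : ∀ f, (inner ℂ f (A f)).re ≤ 0) {t : ℝ}
    (ht : 0 ≤ t) (f : H) : ‖NormedSpace.exp (t • A) f‖ ≤ ‖f‖ := by
  let φ : ℝ → ℝ := fun s => RCLike.re (inner ℂ (NormedSpace.exp (s • A) f) (NormedSpace.exp (s • A) f))
  have hφ : ∀ s, HasDerivAt φ (2 * (inner ℂ (NormedSpace.exp (s • A) f)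
      (A (NormedSpace.exp (s • A) f))).re) s := by
    intro s
    have h := (hasDerivAt_exp_smul_apply A f s).inner ℂ (hasDerivAt_exp_smul_apply A f s)
    have h2 := (Complex.reCLM.hasFDerivAt).comp_hasDerivAt s h
    refine h2.congr_deriv ?_
    have := inner_re_symm (𝕜 := ℂ) (A (NormedSpace.exp (s • A) f)) (NormedSpace.exp (s • A) f)
    simp only [RCLike.re_to_complex] at this
    simp only [Complex.reCLM_apply, Complex.add_re, this]
    ring
  have hanti : Antitone φ := antitone_of_deriv_nonpos (fun s => (hφ s).differentiableAt)
    (fun s => by rw [(hφ s).deriv]; linarith [hA (NormedSpace.exp (s • A) f)])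
  have h := hanti ht
  simp only [φ, inner_self_eq_norm_sq, zero_smul, NormedSpace.exp_zero,
    one_apply_eq_self] at h
  exact (sq_le_sq₀ (norm_nonneg _) (norm_nonneg _)).1 h

theorem norm_exp_smul_le {A : H →L[ℂ] H} (hA : ∀ f, (inner ℂ f (A f)).re ≤ 0) {t : ℝ}
    (ht : 0 ≤ t) : ‖NormedSpace.exp (t • A)‖ ≤ 1 :=
  ContinuousLinearMap.opNorm_le_bound _ zero_le_one fun f => by
    simpa using norm_exp_smul_apply_le hA ht f

theorem exp_add_smul_apply (A : H →L[ℂ] H) (s t : ℝ) :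
    NormedSpace.exp ((s + t) • A) = NormedSpace.exp (s • A) * NormedSpace.exp (t • A) := by
  let _ : NormedAlgebra ℚ (H →L[ℂ] H) := NormedAlgebra.restrictScalars ℚ ℂ _
  rw [add_smul, NormedSpace.exp_add_of_commute]
  exact ((Commute.refl A).smul_left s).smul_right t

/-- The path `s ↦ exp(sA) exp((t - s)B) f` joins the two vectors. By commutation its derivative is
two contractions applied to `A f - B f`. This makes the Yosida exponentials Cauchy. -/
theorem norm_exp_smul_sub_le {A B : H →L[ℂ] H} (hA : ∀ f, (inner ℂ f (A f)).re ≤ 0)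
    (hB : ∀ f, (inner ℂ f (B f)).re ≤ 0) (hAB : Commute A B) {t : ℝ} (ht : 0 ≤ t) (f : H) :
    ‖NormedSpace.exp (t • A) f - NormedSpace.exp (t • B) f‖ ≤ t * ‖A f - B f‖ := by
  let φ : ℝ → H := fun s => NormedSpace.exp (s • A) (NormedSpace.exp ((t - s) • B) f)
  have hcomm : ∀ s r : ℝ, Commute (NormedSpace.exp (s • A)) (NormedSpace.exp (r • B)) :=
    fun s r => ((hAB.smul_left s).smul_right r).exp
  have hφ' : ∀ s, HasDerivAt φ (NormedSpace.exp (s • A) (NormedSpace.exp ((t - s) • B)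
      (A f - B f))) s := by
    intro s
    have h1 := hasDerivAt_exp_smul_const (𝕂 := ℝ) A s
    have h2 := (hasDerivAt_exp_smul_const (𝕂 := ℝ) B (t - s)).scomp s
      ((hasDerivAt_id s).const_sub t)
    have h3 := h1.mul h2
    have h4 := (ContinuousLinearMap.apply ℂ H f).hasFDerivAt.restrictScalars ℝ
      |>.comp_hasDerivAt s h3
    refine h4.congr_deriv ?_
    have h5 : A (NormedSpace.exp ((t - s) • B) f) = NormedSpace.exp ((t - s) • B) (A f) := by
      have h : Commute A (NormedSpace.exp ((t - s) • B)) := (hAB.smul_right _).exp_right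
      exact congrArg (fun L : H →L[ℂ] H => L f) h.eq
    simp [h5]
    abel
  have hb : ∀ s ∈ Ico (0 : ℝ) t, ‖NormedSpace.exp (s • A) (NormedSpace.exp ((t - s) • B)
      (A f - B f))‖ ≤ ‖A f - B f‖ := fun s hs =>
    (norm_exp_smul_apply_le hA hs.1 _).trans
      (norm_exp_smul_apply_le hB (sub_nonneg.2 hs.2.le) _)
  have h := norm_image_sub_le_of_norm_deriv_le_segment'
    (fun x _ => (hφ' x).hasDerivWithinAt) hb t ⟨ht, le_rfl⟩
  simpa [φ, mul_comm] using h

end Abstract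

end BeamWave

namespace BeamWave

section Abstract

variable {H : Type*} [NormedAddCommGroup H] [InnerProductSpace ℂ H]

/-! ### The Hille–Yosida theorem for m-dissipative operators on a Hilbert space -/

/-- The operator with graph `M` is densely defined and m-dissipative. -/
structure IsMDissipative (M : Submodule ℂ (H × H)) : Prop where
  dissipative : ∀ q ∈ M, (inner ℂ q.1 q.2).re ≤ 0
  surj : ∀ r : ℝ, 0 < r → ∀ h : H, ∃ q ∈ M, (r : ℂ) • q.1 - q.2 = h
  dense : Dense (Prod.fst '' (M : Set (H × H)))

/-- Pair `r f - g` with `f` and use Cauchy–Schwarz. This is the resolvent bound, and at the same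
time the quantitative injectivity behind every uniqueness and closed-range argument below. -/
theorem mul_norm_le_of_dissipative {f g : H} (h : (inner ℂ f g).re ≤ 0) (r : ℝ) :
    r * ‖f‖ ≤ ‖(r : ℂ) • f - g‖ := by
  rcases eq_or_ne f 0 with rfl | hf
  · simp
  have h1 : (inner ℂ f ((r : ℂ) • f - g)).re = r * ‖f‖ ^ 2 - (inner ℂ f g).re := by
    rw [inner_sub_right, inner_smul_right, inner_self_eq_norm_sq_to_K]
    simp [← Complex.ofReal_pow]
  have h2 : (inner ℂ f ((r : ℂ) • f - g)).re ≤ ‖f‖ * ‖(r : ℂ) • f - g‖ :=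
    (Complex.re_le_norm _).trans (norm_inner_le_norm _ _)
  have h3 : 0 < ‖f‖ := norm_pos_iff.2 hf
  refine le_of_mul_le_mul_left ?_ h3
  nlinarith

namespace IsMDissipative

variable {M : Submodule ℂ (H × H)}

theorem fst_unique (hM : IsMDissipative M) {r : ℝ} (hr : 0 < r) {p q : H × H} (hp : p ∈ M)
    (hq : q ∈ M) (h : (r : ℂ) • p.1 - p.2 = (r : ℂ) • q.1 - q.2) : p.1 = q.1 := by
  have h1 := mul_norm_le_of_dissipative (hM.dissipative _ (M.sub_mem hp hq)) r
  have h2 : (r : ℂ) • (p - q).1 - (p - q).2 = 0 := by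
    rw [Prod.fst_sub, Prod.snd_sub, smul_sub, sub_sub_sub_comm, h, sub_self]
  rw [h2, norm_zero] at h1
  have h3 : ‖(p - q).1‖ = 0 := le_antisymm (by nlinarith) (norm_nonneg _)
  exact sub_eq_zero.1 (norm_eq_zero.1 h3)

/-- Membership of `(R h, r R h - h)` in the graph says `(r - A) R h = h` without choosing an
operator `A`. Linearity of `R` comes from uniqueness of the first component. -/
theorem exists_resolvent (hM : IsMDissipative M) {r : ℝ} (hr : 0 < r) :
    ∃ R : H →L[ℂ] H, (∀ h, (R h, (r : ℂ) • R h - h) ∈ M) ∧ ∀ h, r * ‖R h‖ ≤ ‖h‖ := by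
  choose q hqM hq using hM.surj r hr
  have hq2 : ∀ h, (q h).2 = (r : ℂ) • (q h).1 - h := fun h => by
    rw [eq_sub_iff_add_eq, add_comm, ← eq_sub_iff_add_eq, hq h]
  let R : H →ₗ[ℂ] H :=
    { toFun := fun h => (q h).1
      map_add' := fun f g => by
        refine hM.fst_unique hr (hqM _) (M.add_mem (hqM f) (hqM g)) ?_
        rw [hq, Prod.fst_add, Prod.snd_add, smul_add, add_sub_add_comm, hq, hq]
      map_smul' := fun c f => by
        refine hM.fst_unique hr (hqM _) (M.smul_mem c (hqM f)) ?_
        rw [hq, Prod.smul_fst, Prod.smul_snd, smul_comm, ← smul_sub, hq] }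
  have hb : ∀ h, r * ‖R h‖ ≤ ‖h‖ := fun h => by
    have := mul_norm_le_of_dissipative (hM.dissipative _ (hqM h)) r
    rwa [hq] at this
  refine ⟨R.mkContinuous r⁻¹ fun h => ?_, fun h => ?_, hb⟩
  · rw [inv_mul_eq_div, le_div_iff₀ hr, mul_comm]
    exact hb h
  · have : (R h, (r : ℂ) • R h - h) = q h := Prod.ext rfl (hq2 h).symm
    change (R h, (r : ℂ) • R h - h) ∈ M
    rw [this]
    exact hqM h

theorem resolvent_comm (hM : IsMDissipative M) {r s : ℝ} (hr : 0 < r) (hs : 0 < s)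
    {R S : H →L[ℂ] H} (hR : ∀ h, (R h, (r : ℂ) • R h - h) ∈ M)
    (hS : ∀ h, (S h, (s : ℂ) • S h - h) ∈ M) : Commute R S := by
  ext h
  -- The resolvent identity `(s - r) R S h + S h = R h`, read off in the graph.
  have h1 := M.add_mem (M.smul_mem ((s : ℂ) - r) (hR (S h))) (hS h)
  have h2 := hM.fst_unique hr h1 (hR h) (by simp; module)
  have h3 := hM.fst_unique hs (hR (S h)) (hS (R h)) (by
    simp only [Prod.fst_add, Prod.smul_fst] at h2
    simp only
    rw [sub_sub_cancel, ← h2]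
    module)
  simpa using h3

/-- The data of the Yosida approximations `A m` of the operator with graph `M`. -/
theorem exists_yosida (hM : IsMDissipative M) :
    ∃ A : ℕ → H →L[ℂ] H, (∀ m f, (inner ℂ f (A m f)).re ≤ 0) ∧ (∀ m l, Commute (A m) (A l)) ∧
      (∀ q ∈ M, ∀ m, ‖A m q.1‖ ≤ ‖q.2‖) ∧
      ∀ q ∈ M, Tendsto (fun m => A m q.1) atTop (𝓝 q.2) := by
  have hpos : ∀ m : ℕ, (0 : ℝ) < (m : ℝ) + 1 := fun m => by positivity
  choose R hRM hRb using fun m : ℕ => hM.exists_resolvent (hpos m)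
  -- `P m = r (r - A)⁻¹` with `r = m + 1`, the shift keeping `r` positive at `m = 0`. The `P m` are
  -- contractions tending strongly to `1`, and the Yosida approximation `r (P m - 1)` equals `P m A`
  -- on the domain of `A`.
  let P : ℕ → H →L[ℂ] H := fun m => ((((m : ℝ) + 1 : ℝ)) : ℂ) • R m
  have hP : ∀ m f, ‖P m f‖ ≤ ‖f‖ := fun m f => by
    simp only [P, smul_apply, norm_smul, Complex.norm_real, Real.norm_eq_abs,
      abs_of_pos (hpos m)]
    exact hRb m f
  have hPop : ∀ m, ‖P m‖ ≤ 1 := fun m =>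
    ContinuousLinearMap.opNorm_le_bound _ zero_le_one fun f => by simpa using hP m f
  have hPM : ∀ q ∈ M, ∀ m, P m q.1 - q.1 = R m q.2 := fun q hq m => by
    have h1 := hRM m (((((m : ℝ) + 1 : ℝ)) : ℂ) • q.1 - q.2)
    have h2 := hM.fst_unique (hpos m) h1 hq (by simp)
    simp only [map_sub, map_smul] at h2
    simp only [P, smul_apply]
    rw [sub_eq_iff_eq_add] at h2 ⊢
    rw [h2, add_comm]
  have hPtend : ∀ f, Tendsto (fun m => P m f) atTop (𝓝 f) := by
    intro f
    refine tendsto_apply_of_dense (L₀ := 1) (Eventually.of_forall hPop) hM.dense ?_ f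
    rintro _ ⟨q, hq, rfl⟩
    rw [one_apply_eq_self, tendsto_iff_norm_sub_tendsto_zero]
    refine squeeze_zero (fun _ => norm_nonneg _) (g := fun m : ℕ => ‖q.2‖ * (1 / ((m : ℝ) + 1)))
      (fun m => ?_) ?_
    · rw [hPM q hq, mul_one_div, le_div_iff₀ (hpos m), mul_comm]
      exact hRb m _
    · simpa using (tendsto_one_div_add_atTop_nhds_zero_nat (𝕜 := ℝ)).const_mul ‖q.2‖
  have hAP : ∀ q ∈ M, ∀ m : ℕ, (((((m : ℝ) + 1 : ℝ)) : ℂ) • (P m - 1)) q.1 = P m q.2 := by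
    intro q hq m
    simp only [smul_apply, _root_.sub_apply, one_apply_eq_self, hPM q hq]
    simp [P]
  refine ⟨fun m => ((((m : ℝ) + 1 : ℝ)) : ℂ) • (P m - 1), fun m f => ?_, fun m l => ?_,
    fun q hq m => ?_, fun q hq => ?_⟩
  · simp only [smul_apply, _root_.sub_apply, one_apply_eq_self,
      inner_smul_right, inner_sub_right, Complex.re_ofReal_mul, Complex.sub_re]
    refine mul_nonpos_of_nonneg_of_nonpos (hpos m).le ?_
    have h1 : (inner ℂ f (P m f)).re ≤ ‖f‖ * ‖f‖ :=
      (Complex.re_le_norm _).trans ((norm_inner_le_norm _ _).trans (by gcongr; exact hP m f))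
    have h2 : (inner ℂ f f).re = ‖f‖ * ‖f‖ := by
      have := inner_self_eq_norm_mul_norm (𝕜 := ℂ) f
      simpa using this
    linarith
  · refine Commute.smul_left (Commute.smul_right ?_ _) _
    refine (Commute.sub_left ?_ (Commute.one_left _))
    refine (Commute.sub_right ?_ (Commute.one_right _))
    exact ((hM.resolvent_comm (hpos m) (hpos l) (hRM m) (hRM l)).smul_left _).smul_right _
  · rw [hAP q hq]; exact hP m _
  · simp only [hAP q hq]; exact hPtend _

end IsMDissipative

theorem dissipative_of_generator {T : ℝ → H →L[ℂ] H} (hT : IsContractionSemigroup T) {q : H × H}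
    (hq : q ∈ generatorGraph T) : (inner ℂ q.1 q.2).re ≤ 0 := by
  have h1 : Tendsto (fun h : ℝ => (inner ℂ q.1 (((h⁻¹ : ℝ) : ℂ) • (T h q.1 - q.1))).re) (𝓝[>] 0)
      (𝓝 (inner ℂ q.1 q.2).re) :=
    (Complex.continuous_re.tendsto _).comp (tendsto_const_nhds.inner hq)
  refine le_of_tendsto h1 ?_
  filter_upwards [self_mem_nhdsWithin] with h (hh : 0 < h)
  rw [inner_smul_right, Complex.re_ofReal_mul, inner_sub_right, Complex.sub_re]
  refine mul_nonpos_of_nonneg_of_nonpos (by positivity) ?_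
  have h3 : ‖T h q.1‖ ≤ ‖q.1‖ := by
    simpa using (T h).le_of_opNorm_le (hT.contraction h hh.le) q.1
  have h1 : (inner ℂ q.1 (T h q.1)).re ≤ ‖q.1‖ * ‖q.1‖ :=
    (Complex.re_le_norm _).trans ((norm_inner_le_norm _ _).trans (by gcongr))
  have h2 : (inner ℂ q.1 q.1).re = ‖q.1‖ * ‖q.1‖ := by
    have := inner_self_eq_norm_mul_norm (𝕜 := ℂ) q.1
    simpa using this
  linarith

variable [CompleteSpace H]

/-- Mean value inequality for `s ↦ exp(sA) f - s g`. With `g = 0` it gives Lipschitz bounds in time;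
with `g` the limit of the Yosida approximations it controls the difference quotient. -/
theorem norm_exp_smul_sub_sub_le (A : H →L[ℂ] H) {t C : ℝ}
    (ht : 0 ≤ t) (f g : H) (hC : ∀ s ∈ Ico 0 t, ‖NormedSpace.exp (s • A) (A f) - g‖ ≤ C) :
    ‖NormedSpace.exp (t • A) f - f - (t : ℂ) • g‖ ≤ C * t := by
  have hd : ∀ s : ℝ, HasDerivAt (fun s : ℝ => NormedSpace.exp (s • A) f - s • g)
      (NormedSpace.exp (s • A) (A f) - g) s := fun s => by
    have h := (hasDerivAt_exp_smul_apply A f s).sub ((hasDerivAt_id s).smul_const g)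
    rw [exp_smul_apply_comm, one_smul] at h
    exact h
  have h := norm_image_sub_le_of_norm_deriv_le_segment'
    (fun x _ => (hd x).hasDerivWithinAt) hC t ⟨ht, le_rfl⟩
  rw [sub_zero] at h
  convert! h using 2
  simp
  abel

/-- **Hille–Yosida theorem** for m-dissipative operators. -/
theorem IsMDissipative.exists_semigroup {M : Submodule ℂ (H × H)} (hM : IsMDissipative M) :
    ∃ T : ℝ → H →L[ℂ] H, IsContractionSemigroup T ∧ generatorGraph T = M := by
  obtain ⟨A, hA, hcomm, hAb, hAt⟩ := hM.exists_yosida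
  let E : ℕ → ℝ → H →L[ℂ] H := fun m t => NormedSpace.exp (t • A m)
  have hE : ∀ m t, 0 ≤ t → ‖E m t‖ ≤ 1 := fun m t ht => norm_exp_smul_le (hA m) ht
  have hcau : ∀ t, 0 ≤ t → ∀ f, CauchySeq fun m => E m t f := by
    intro t ht f
    refine cauchySeq_apply_of_dense (fun m => hE m t ht) hM.dense ?_ f
    rintro _ ⟨q, hq, rfl⟩
    have h1 := (hAt q hq).cauchySeq
    rw [Metric.cauchySeq_iff] at h1 ⊢
    intro ε hε
    obtain ⟨N, hN⟩ := h1 (ε / (t + 1)) (by positivity)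
    refine ⟨N, fun m hm l hl => ?_⟩
    have h2 := hN m hm l hl
    rw [dist_eq_norm] at h2 ⊢
    calc _ ≤ t * ‖A m q.1 - A l q.1‖ :=
          norm_exp_smul_sub_le (hA m) (hA l) (hcomm m l) ht q.1
      _ ≤ t * (ε / (t + 1)) := by gcongr
      _ < (t + 1) * (ε / (t + 1)) := by gcongr; linarith
      _ = ε := by field_simp
  have hex : ∀ t : ℝ, ∃ L : H →L[ℂ] H, 0 ≤ t → ∀ f, Tendsto (fun m => E m t f) atTop (𝓝 (L f)) := by
    intro t
    by_cases ht : 0 ≤ t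
    · choose F hF using fun f => cauchySeq_tendsto_of_complete (hcau t ht f)
      have h := tendsto_pi_nhds.2 hF
      exact ⟨continuousLinearMapOfTendsto (fun m => E m t) h, fun _ f => hF f⟩
    · exact ⟨0, fun h => absurd h ht⟩
  choose T hT using hex
  have hTb : ∀ t, 0 ≤ t → ∀ f, ‖T t f‖ ≤ ‖f‖ := fun t ht f =>
    le_of_tendsto (hT t ht f).norm (Eventually.of_forall fun m =>
      norm_exp_smul_apply_le (hA m) ht f)
  have hTop : ∀ t, 0 ≤ t → ‖T t‖ ≤ 1 := fun t ht =>
    ContinuousLinearMap.opNorm_le_bound _ zero_le_one fun f => by simpa using hTb t ht f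
  have hT0 : T 0 = 1 := by
    ext f
    refine tendsto_nhds_unique (hT 0 le_rfl f) ?_
    simp [E]
  have hTadd : ∀ s t, 0 ≤ s → 0 ≤ t → T (s + t) = T s * T t := by
    intro s t hs ht
    ext f
    refine tendsto_nhds_unique (hT (s + t) (by positivity) f) ?_
    have h1 : ∀ m, E m (s + t) f = E m s (E m t f - T t f) + E m s (T t f) := fun m => by
      simp only [E, exp_add_smul_apply, map_sub]
      simp
    simp only [h1]
    have h2 : Tendsto (fun m => E m s (E m t f - T t f)) atTop (𝓝 0) := by
      refine squeeze_zero_norm (fun m => norm_exp_smul_apply_le (hA m) hs _) ?_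
      exact tendsto_iff_norm_sub_tendsto_zero.1 (hT t ht f)
    simpa using h2.add (hT s hs (T t f))
  have hlip : ∀ q ∈ M, ∀ t, 0 ≤ t → ‖T t q.1 - q.1‖ ≤ t * ‖q.2‖ := by
    intro q hq t ht
    refine le_of_tendsto ((hT t ht q.1).sub_const q.1).norm (Eventually.of_forall fun m => ?_)
    have h := norm_exp_smul_sub_sub_le (A m) ht q.1 0 (C := ‖q.2‖) (fun s hs => by
      rw [sub_zero]
      exact (norm_exp_smul_apply_le (hA m) hs.1 _).trans (hAb q hq m))
    simpa [mul_comm] using h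
  have hcont : ∀ f, ContinuousOn (fun t => T t f) (Ici 0) := by
    intro f t ht
    refine tendsto_apply_of_dense (l := 𝓝[Ici 0] t) (C := 1) ?_ hM.dense ?_ f
    · filter_upwards [self_mem_nhdsWithin] with s hs using hTop s hs
    · rintro _ ⟨q, hq, rfl⟩
      rw [tendsto_iff_norm_sub_tendsto_zero]
      refine squeeze_zero' (g := fun s => |s - t| * ‖q.2‖) (Eventually.of_forall fun _ =>
        norm_nonneg _) ?_ ?_
      · filter_upwards [self_mem_nhdsWithin] with s (hs : 0 ≤ s)
        have key : ∀ a b : ℝ, 0 ≤ a → a ≤ b → ‖T b q.1 - T a q.1‖ ≤ (b - a) * ‖q.2‖ := by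
          intro a b ha hab
          have h1 : T b q.1 - T a q.1 = T a (T (b - a) q.1 - q.1) := by
            rw [map_sub, ← mul_apply_eq_comp, ← hTadd a (b - a) ha (sub_nonneg.2 hab)]
            simp
          rw [h1]
          exact (hTb a ha _).trans (hlip q hq _ (sub_nonneg.2 hab))
        rcases le_total s t with hst | hst
        · rw [norm_sub_rev, abs_sub_comm, abs_of_nonneg (sub_nonneg.2 hst)]
          exact key s t hs hst
        · rw [abs_of_nonneg (sub_nonneg.2 hst)]
          exact key t s ht hst
      · have : Continuous fun s : ℝ => |s - t| * ‖q.2‖ := by fun_prop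
        have h := (this.tendsto t).mono_left (nhdsWithin_le_nhds (s := Ici 0))
        simpa using h
  have hsg : IsContractionSemigroup T := ⟨⟨hT0, hTadd, hcont⟩, hTop⟩
  have hMsub : ∀ q ∈ M, q ∈ generatorGraph T := by
    intro q hq
    change Tendsto _ _ _
    rw [Metric.tendsto_nhds]
    intro ε hε
    -- The vector `q.2` need not lie in the domain. It is replaced by a nearby `p.1` that does, on
    -- which the approximating semigroups move by at most `s ‖p.2‖`, uniformly in `m`.
    obtain ⟨_, hp, p, hpM, rfl⟩ := Metric.dense_iff.1 hM.dense q.2 (ε / 4) (by positivity)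
    rw [Metric.mem_ball, dist_eq_norm] at hp
    have hbd : ∀ t, 0 ≤ t → ‖T t q.1 - q.1 - (t : ℂ) • q.2‖ ≤ (t * ‖p.2‖ + 2 * ‖q.2 - p.1‖) * t := by
      intro t ht
      have hlim : Tendsto (fun m => (‖A m q.1 - q.2‖ + (t * ‖p.2‖ + 2 * ‖q.2 - p.1‖)) * t) atTop
          (𝓝 ((0 + (t * ‖p.2‖ + 2 * ‖q.2 - p.1‖)) * t)) :=
        ((tendsto_iff_norm_sub_tendsto_zero.1 (hAt q hq)).add_const _).mul_const _
      rw [zero_add] at hlim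
      refine le_of_tendsto_of_tendsto (((hT t ht q.1).sub_const q.1).sub_const ((t : ℂ) • q.2)).norm
        hlim (Eventually.of_forall fun m => ?_)
      refine norm_exp_smul_sub_sub_le (A m) ht q.1 q.2 fun s hs => ?_
      have h1 : NormedSpace.exp (s • A m) (A m q.1) - q.2 =
          NormedSpace.exp (s • A m) (A m q.1 - q.2) + ((NormedSpace.exp (s • A m) p.1 - p.1) +
            (NormedSpace.exp (s • A m) (q.2 - p.1) - (q.2 - p.1))) := by
        simp only [map_sub]; abel
      have h2 := norm_exp_smul_sub_sub_le (A m) hs.1 p.1 0 (C := ‖p.2‖) (fun s hs => by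
        rw [sub_zero]
        exact (norm_exp_smul_apply_le (hA m) hs.1 _).trans (hAb p hpM m))
      rw [smul_zero, sub_zero] at h2
      have h3 : ‖NormedSpace.exp (s • A m) (q.2 - p.1) - (q.2 - p.1)‖ ≤ 2 * ‖q.2 - p.1‖ := by
        refine (norm_sub_le _ _).trans ?_
        linarith [norm_exp_smul_apply_le (hA m) hs.1 (q.2 - p.1)]
      rw [h1]
      refine (norm_add_le _ _).trans (add_le_add (norm_exp_smul_apply_le (hA m) hs.1 _)
        ((norm_add_le _ _).trans (add_le_add (h2.trans ?_) h3)))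
      rw [mul_comm]
      gcongr
      exact hs.2.le
    have hsm : ∀ᶠ t : ℝ in 𝓝[>] 0, t * ‖p.2‖ < ε / 4 := by
      have : Continuous fun t : ℝ => t * ‖p.2‖ := by fun_prop
      refine nhdsWithin_le_nhds ((this.tendsto 0).eventually_lt_const ?_)
      simpa using by positivity
    filter_upwards [self_mem_nhdsWithin, hsm] with t (ht : 0 < t) htε
    have h1 : ((t⁻¹ : ℝ) : ℂ) • (T t q.1 - q.1) - q.2 =
        ((t⁻¹ : ℝ) : ℂ) • (T t q.1 - q.1 - (t : ℂ) • q.2) := by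
      rw [smul_sub _ (T t q.1 - q.1), smul_smul, ← Complex.ofReal_mul, inv_mul_cancel₀ ht.ne']
      simp
    rw [dist_eq_norm, h1, norm_smul, Complex.norm_real, Real.norm_of_nonneg (by positivity),
      inv_mul_lt_iff₀ ht]
    rw [norm_sub_rev] at hp
    calc _ ≤ _ := hbd t ht.le
      _ < ε * t := by gcongr; linarith
      _ = t * ε := mul_comm _ _
  refine ⟨T, hsg, Subset.antisymm (fun q hq => ?_) hMsub⟩
  -- Maximality: an element of the generator and one of `M` with the same image under `1 - A` differ
  -- by a dissipative pair in the kernel of `1 - A`, which is zero.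
  obtain ⟨p, hpM, hp⟩ := hM.surj 1 one_pos (q.1 - q.2)
  have hpq : q - p ∈ generatorGraph T := by
    have h1 := Tendsto.sub hq (hMsub p hpM)
    refine h1.congr fun h => ?_
    simp only [Prod.fst_sub, map_sub]
    module
  have h2 := mul_norm_le_of_dissipative (dissipative_of_generator hsg hpq) 1
  have h3 : ((1 : ℝ) : ℂ) • (q - p).1 - (q - p).2 = 0 := by
    simp only [Complex.ofReal_one, one_smul] at hp ⊢
    rw [Prod.fst_sub, Prod.snd_sub, sub_sub_sub_comm, hp, sub_self]
  rw [h3, norm_zero, one_mul] at h2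
  have h4 : (q - p).1 = 0 := norm_le_zero_iff.1 h2
  rw [h4, smul_zero, zero_sub, neg_eq_zero] at h3
  have h5 : q - p = 0 := Prod.ext h4 h3
  rw [sub_eq_zero.1 h5]
  exact hpM

end Abstract

end BeamWave

namespace BeamWave

section Semigroup

variable {E : Type*} [NormedAddCommGroup E] [NormedSpace ℂ E]

/-! ### Properties of strongly continuous semigroups -/

theorem IsC0Semigroup.exists_bound [CompleteSpace E] {T : ℝ → E →L[ℂ] E} (hT : IsC0Semigroup T)
    (z : ℝ) : ∃ C, ∀ t ∈ Icc 0 z, ‖T t‖ ≤ C := by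
  have h := banach_steinhaus (g := fun t : Icc 0 z => T t) (fun f => by
    have hc : ContinuousOn (fun t => T t f) (Icc 0 z) := (hT.cont f).mono Icc_subset_Ici_self
    obtain ⟨C, hC⟩ := isCompact_Icc.exists_bound_of_continuousOn hc
    exact ⟨C, fun t => hC t t.2⟩)
  obtain ⟨C, hC⟩ := h
  exact ⟨C, fun t ht => hC ⟨t, ht⟩⟩

/-- Joint continuity in time and vector: strong continuity together with the uniform bound on `[0,
τ₀ + 1]` from Banach–Steinhaus. -/
theorem IsC0Semigroup.tendsto_apply [CompleteSpace E] {T : ℝ → E →L[ℂ] E} (hT : IsC0Semigroup T)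
    {ι : Type*} {l : Filter ι} {τ : ι → ℝ} {τ₀ : ℝ} (hτ₀ : 0 ≤ τ₀)
    (hτ : Tendsto τ l (𝓝 τ₀))
    (hpos : ∀ᶠ i in l, 0 ≤ τ i) {φ : ι → E} {φ₀ : E} (hφ : Tendsto φ l (𝓝 φ₀)) :
    Tendsto (fun i => T (τ i) (φ i)) l (𝓝 (T τ₀ φ₀)) := by
  obtain ⟨C, hC⟩ := hT.exists_bound (τ₀ + 1)
  have h1 : Tendsto (fun i => T (τ i) φ₀) l (𝓝 (T τ₀ φ₀)) :=
    (hT.cont φ₀ τ₀ hτ₀).tendsto.comp (tendsto_nhdsWithin_iff.2 ⟨hτ, hpos⟩)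
  have h2 : Tendsto (fun i => T (τ i) (φ i - φ₀)) l (𝓝 0) := by
    refine squeeze_zero_norm' (a := fun i => C * ‖φ i - φ₀‖) ?_ ?_
    · filter_upwards [hpos, hτ.eventually_le_const (lt_add_one τ₀)] with i hi hi'
      exact (T (τ i)).le_of_opNorm_le (hC _ ⟨hi, hi'⟩) _
    · simpa using (tendsto_iff_norm_sub_tendsto_zero.1 hφ).const_mul C
  simpa using h1.add h2

theorem tendsto_sub_nhdsGT (s : ℝ) : Tendsto (fun u : ℝ => u - s) (𝓝[>] s) (𝓝[>] 0) := by
  refine tendsto_nhdsWithin_iff.2 ⟨?_, ?_⟩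
  · have : Continuous fun u : ℝ => u - s := by fun_prop
    simpa using (this.tendsto s).mono_left (nhdsWithin_le_nhds (s := Ioi s))
  · filter_upwards [self_mem_nhdsWithin] with u (hu : s < u) using sub_pos.2 hu

theorem IsC0Semigroup.apply_mem_generatorGraph {T : ℝ → E →L[ℂ] E} (hT : IsC0Semigroup T)
    {q : E × E} (hq : q ∈ generatorGraph T) {t : ℝ} (ht : 0 ≤ t) :
    (T t q.1, T t q.2) ∈ generatorGraph T := by
  have h := ((T t).continuous.tendsto _).comp hq
  refine h.congr' ?_
  filter_upwards [self_mem_nhdsWithin] with h (hh : 0 < h)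
  simp only [Function.comp, map_smul, map_sub]
  rw [← mul_apply_eq_comp, ← mul_apply_eq_comp, ← hT.add t h ht hh.le, ← hT.add h t hh.le ht,
    add_comm]

/-- A right derivative is what the definition of the generator provides directly, and it suffices
for the fundamental theorem of calculus for continuous functions. -/
theorem IsC0Semigroup.hasDerivWithinAt {T : ℝ → E →L[ℂ] E} (hT : IsC0Semigroup T)
    {q : E × E} (hq : q ∈ generatorGraph T) {t : ℝ} (ht : 0 ≤ t) :
    HasDerivWithinAt (fun s => T s q.1) (T t q.2) (Ioi t) t := by
  rw [hasDerivWithinAt_iff_tendsto_slope' (by simp)]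
  refine ((hT.apply_mem_generatorGraph hq ht).comp (tendsto_sub_nhdsGT t)).congr' ?_
  filter_upwards [self_mem_nhdsWithin] with u (hu : t < u)
  rw [slope_def_module]
  simp only [Function.comp, Complex.coe_smul]
  rw [← mul_apply_eq_comp, ← hT.add (u - t) t (sub_nonneg.2 hu.le) ht]
  simp

theorem IsC0Semigroup.integral_apply [CompleteSpace E] {T : ℝ → E →L[ℂ] E} (hT : IsC0Semigroup T)
    {q : E × E} (hq : q ∈ generatorGraph T) {t : ℝ} (ht : 0 ≤ t) :
    ∫ s in (0 : ℝ)..t, T s q.2 = T t q.1 - q.1 := by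
  have h := intervalIntegral.integral_eq_sub_of_hasDeriv_right (a := 0) (b := t)
    (f := fun s => T s q.1) (f' := fun s => T s q.2)
    ((hT.cont q.1).mono (by rw [uIcc_of_le ht]; exact Icc_subset_Ici_self))
    (fun s hs => hT.hasDerivWithinAt hq (by rw [min_eq_left ht] at hs; exact hs.1.le))
    (((hT.cont q.2).mono (by rw [uIcc_of_le ht]; exact Icc_subset_Ici_self)).intervalIntegrable)
  rw [h, hT.zero]
  simp

/-- The integrated identity `T t f - f = ∫ T s g` passes to limits of `(f, g)`; differentiating it
at `0` returns membership in the generator. -/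
theorem IsC0Semigroup.isClosed_generatorGraph [CompleteSpace E] {T : ℝ → E →L[ℂ] E}
    (hT : IsC0Semigroup T) : IsClosed (generatorGraph T) := by
  refine isClosed_of_closure_subset fun q hq => ?_
  obtain ⟨u, hu, hlim⟩ := mem_closure_iff_seq_limit.1 hq
  have hint : ∀ t, 0 ≤ t → T t q.1 - q.1 = ∫ s in (0 : ℝ)..t, T s q.2 := by
    intro t ht
    obtain ⟨C, hC⟩ := hT.exists_bound t
    have h1 : Tendsto (fun m => T t (u m).1 - (u m).1) atTop (𝓝 (T t q.1 - q.1)) :=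
      (((T t).continuous.tendsto _).comp ((continuous_fst.tendsto q).comp hlim)).sub
        ((continuous_fst.tendsto q).comp hlim)
    refine tendsto_nhds_unique h1 ?_
    have h2 : ∀ m, T t (u m).1 - (u m).1 = ∫ s in (0 : ℝ)..t, T s (u m).2 := fun m =>
      (hT.integral_apply (hu m) ht).symm
    simp only [h2]
    have hsnd : Tendsto (fun m => (u m).2) atTop (𝓝 q.2) := (continuous_snd.tendsto q).comp hlim
    have hI : ∀ g, IntervalIntegrable (fun s => T s g) volume 0 t := fun g =>
      ((hT.cont g).mono (by rw [uIcc_of_le ht]; exact Icc_subset_Ici_self)).intervalIntegrable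
    rw [tendsto_iff_norm_sub_tendsto_zero]
    refine squeeze_zero (g := fun m => C * ‖(u m).2 - q.2‖ * |t - 0|) (fun _ => norm_nonneg _)
      (fun m => ?_) ?_
    · rw [← intervalIntegral.integral_sub (hI _) (hI _)]
      refine intervalIntegral.norm_integral_le_of_norm_le_const fun s hs => ?_
      rw [uIoc_of_le ht] at hs
      rw [← map_sub]
      exact (T s).le_of_opNorm_le (hC s ⟨hs.1.le, hs.2⟩) _
    · simpa using ((tendsto_iff_norm_sub_tendsto_zero.1 hsnd).const_mul C).mul_const |t - 0|
  have hcont : ContinuousOn (fun s => T s q.2) (Ici 0) := hT.cont q.2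
  have hd : HasDerivWithinAt (fun t => ∫ s in (0 : ℝ)..t, T s q.2) (T 0 q.2) (Ici 0) 0 :=
    intervalIntegral.integral_hasDerivWithinAt_right (t := Ioi 0) (by simp)
      ((hcont.mono Ioi_subset_Ici_self).stronglyMeasurableAtFilter_nhdsWithin measurableSet_Ioi 0)
      ((hcont 0 self_mem_Ici).mono Ioi_subset_Ici_self)
  have hd' := hd.Ioi_of_Ici
  rw [hasDerivWithinAt_iff_tendsto_slope' (by simp), hT.zero] at hd'
  refine hd'.congr' ?_
  filter_upwards [self_mem_nhdsWithin] with t (ht : 0 < t)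
  rw [slope_def_module, ← hint t ht.le]
  simp [← Complex.coe_smul]

/-- Variation of constants, for two semigroups whose generators differ by `b s` at `T s f`. -/
theorem IsC0Semigroup.duhamel [CompleteSpace E] {T T' : ℝ → E →L[ℂ] E} (hT : IsC0Semigroup T)
    (hT' : IsC0Semigroup T') {f : E} {g b : ℝ → E} {z : ℝ} (hz : 0 ≤ z)
    (hg : ∀ s ∈ Icc 0 z, (T s f, g s) ∈ generatorGraph T)
    (hg' : ∀ s ∈ Icc 0 z, (T s f, g s - b s) ∈ generatorGraph T')
    (hb : ContinuousOn b (Icc 0 z)) :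
    T z f = T' z f + ∫ s in (0 : ℝ)..z, T' (z - s) (b s) := by
  have hcont : ∀ φ : ℝ → E, ContinuousOn φ (Icc 0 z) →
      ContinuousOn (fun s => T' (z - s) (φ s)) (Icc 0 z) := by
    intro φ hφ s hs
    refine hT'.tendsto_apply (sub_nonneg.2 hs.2) ?_ ?_ (hφ s hs)
    · have : Continuous fun s : ℝ => z - s := by fun_prop
      exact (this.tendsto s).mono_left nhdsWithin_le_nhds
    · filter_upwards [self_mem_nhdsWithin] with u hu using sub_nonneg.2 hu.2
  have hTf : ContinuousOn (fun s => T s f) (Icc 0 z) := (hT.cont f).mono Icc_subset_Ici_self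
  have h := intervalIntegral.integral_eq_sub_of_hasDeriv_right (a := 0) (b := z)
    (f := fun s => T' (z - s) (T s f)) (f' := fun s => T' (z - s) (b s))
    (by rw [uIcc_of_le hz]; exact hcont _ hTf) ?_
    (ContinuousOn.intervalIntegrable (by rw [uIcc_of_le hz]; exact hcont _ hb))
  · rw [h, sub_self, hT'.zero, sub_zero, hT.zero]
    simp
  intro s hs
  rw [min_eq_left hz, max_eq_right hz] at hs
  have hs' : s ∈ Icc 0 z := ⟨hs.1.le, hs.2.le⟩
  rw [hasDerivWithinAt_iff_tendsto_slope' (by simp)]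
  -- At the vector `T s f` the quotients of `T` and `T'` tend to `g s` and `g s - b s`. Their
  -- difference, carried by `T' (z - u)`, is the slope of `s ↦ T' (z - s) (T s f)`.
  have h1 := ((hg s hs').comp (tendsto_sub_nhdsGT s)).sub
    ((hg' s hs').comp (tendsto_sub_nhdsGT s))
  rw [sub_sub_cancel] at h1
  have h2 := hT'.tendsto_apply (l := 𝓝[>] s) (τ := fun u => z - u) (sub_nonneg.2 hs'.2)
    (by
      have : Continuous fun s : ℝ => z - s := by fun_prop
      exact (this.tendsto s).mono_left nhdsWithin_le_nhds)
    (by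
      filter_upwards [Ioo_mem_nhdsGT hs.2] with u hu using sub_nonneg.2 hu.2.le) h1
  refine h2.congr' ?_
  filter_upwards [Ioo_mem_nhdsGT hs.2] with u hu
  have h3 : T u f = T (u - s) (T s f) := by
    rw [← mul_apply_eq_comp, ← hT.add _ _ (sub_nonneg.2 hu.1.le) hs'.1, sub_add_cancel]
  have h4 : T' (z - s) (T s f) = T' (z - u) (T' (u - s) (T s f)) := by
    rw [← mul_apply_eq_comp (T' (z - u)), ← hT'.add _ _ (sub_nonneg.2 hu.2.le)
      (sub_nonneg.2 hu.1.le), sub_add_sub_cancel]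
  rw [slope_def_module, h3, h4]
  simp only [Function.comp, ← map_sub, ← smul_sub, sub_sub_sub_cancel_right, map_smul]
  rw [Complex.coe_smul]

/-- A contraction semigroup is determined by its generator among all `C₀` semigroups. -/
theorem IsC0Semigroup.eqOn_of_generatorGraph_subset [CompleteSpace E] {T T' : ℝ → E →L[ℂ] E}
    (hT : IsC0Semigroup T) (hT' : IsC0Semigroup T')
    (hdense : Dense (Prod.fst '' generatorGraph T))
    (h : generatorGraph T ⊆ generatorGraph T') : EqOn T' T (Ici 0) := by
  intro z hz
  refine DFunLike.coe_injective ((T' z).continuous.ext_on hdense (T z).continuous ?_)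
  rintro _ ⟨q, hq, rfl⟩
  have h1 : ∀ s ∈ Icc 0 z, (T s q.1, T s q.2) ∈ generatorGraph T := fun s hs =>
    hT.apply_mem_generatorGraph hq hs.1
  have h2 := hT.duhamel hT' (b := fun _ => 0) hz h1 (fun s hs => by
    simpa using h (h1 s hs)) continuousOn_const
  simpa using h2.symm

end Semigroup

end BeamWave

namespace BeamWave

section Chernoff

/-! ### Chernoff's product formula -/

/-- A finite net of the compact set reduces the claim to finitely many vectors. In Chernoff's
argument the compact set is an orbit piece `{T t f : t ∈ [0, z]}`. -/
theorem eventually_forall_norm_sub_lt {E : Type*} [NormedAddCommGroup E] [NormedSpace ℂ E]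
    {ι : Type*} {l : Filter ι} {L : ι → E →L[ℂ] E} {L₀ : E →L[ℂ] E} {C : ℝ}
    (hL : ∀ᶠ i in l, ‖L i‖ ≤ C) (h : ∀ f, Tendsto (fun i => L i f) l (𝓝 (L₀ f))) {K : Set E}
    (hK : IsCompact K) {ε : ℝ} (hε : 0 < ε) : ∀ᶠ i in l, ∀ f ∈ K, ‖L i f - L₀ f‖ < ε := by
  set B : ℝ := |C| + ‖L₀‖ + 1 with hB
  have hBpos : 0 < B := by positivity
  obtain ⟨t, -, htf, ht⟩ := hK.finite_cover_balls (e := ε / (2 * B)) (by positivity)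
  have h1 : ∀ᶠ i in l, ∀ g ∈ t, ‖L i g - L₀ g‖ < ε / 2 :=
    (htf.eventually_all).2 fun g _ => by
      simpa [dist_eq_norm] using Metric.tendsto_nhds.1 (h g) (ε / 2) (by positivity)
  filter_upwards [hL, h1] with i hi hit f hf
  obtain ⟨g, hg, hfg⟩ := mem_iUnion₂.1 (ht hf)
  rw [Metric.mem_ball, dist_eq_norm] at hfg
  have h3 : L i f - L₀ f = (L i g - L₀ g) + (L i (f - g) - L₀ (f - g)) := by
    simp only [map_sub]; abel
  have h2 : ‖L i (f - g) - L₀ (f - g)‖ ≤ (|C| + ‖L₀‖) * ‖f - g‖ := by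
    refine (norm_sub_le _ _).trans ?_
    rw [add_mul]
    gcongr
    · exact ((L i).le_opNorm _).trans (by gcongr; exact hi.trans (le_abs_self C))
    · exact L₀.le_opNorm _
  have h4 : (|C| + ‖L₀‖) * ‖f - g‖ ≤ B * (ε / (2 * B)) := by
    gcongr
    rw [hB]; linarith
  have h5 : B * (ε / (2 * B)) = ε / 2 := by field_simp
  rw [h3]
  calc _ ≤ _ := norm_add_le _ _
    _ < ε := by linarith [hit g hg]

theorem norm_apply_le_norm {E : Type*} [NormedAddCommGroup E] [NormedSpace ℂ E] {L : E →L[ℂ] E}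
    (h : ‖L‖ ≤ 1) (f : E) : ‖L f‖ ≤ ‖f‖ := by
  simpa using L.le_of_opNorm_le h f

variable {H : Type*} [NormedAddCommGroup H] [InnerProductSpace ℂ H]

/-- The difference is `∑ U^(m-1-j) (U a_j - a_(j+1))`, and powers of `U` are contractions. -/
theorem norm_pow_sub_le_of_telescope {U : H →L[ℂ] H} (hU : ‖U‖ ≤ 1) {c : ℝ} {a : ℕ → H} {m : ℕ}
    (h : ∀ j < m, ‖U (a j) - a (j + 1)‖ ≤ c) : ‖(U ^ m) (a 0) - a m‖ ≤ m * c := by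
  induction m with
  | zero => simp
  | succ m ih =>
    have h1 := ih fun j hj => h j (hj.trans (Nat.lt_succ_self m))
    have h2 : (U ^ (m + 1)) (a 0) - a (m + 1) = U ((U ^ m) (a 0) - a m) + (U (a m) - a (m + 1)) := by
      rw [pow_succ', mul_apply_eq_comp, map_sub]; abel
    rw [h2]
    refine (norm_add_le _ _).trans ?_
    have h3 := norm_apply_le_norm hU ((U ^ m) (a 0) - a m)
    rw [Nat.cast_succ]
    linarith [h m (Nat.lt_succ_self m)]

variable [CompleteSpace H]

/-- The resolvent at `1` of the difference quotient `(V - 1) / h` of a contraction `V`. -/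
theorem exists_resolvent_of_contraction {V : H →L[ℂ] H} (hV : ‖V‖ ≤ 1) {h : ℝ} (hh : 0 < h) :
    ∃ Q : H →L[ℂ] H, (∀ f, V (Q f) = Q f + (h : ℂ) • (Q f - f)) ∧
      (∀ f, Q (f - ((h⁻¹ : ℝ) : ℂ) • (V f - f)) = f) ∧ ‖Q‖ ≤ 1 := by
  have hc : (1 + h : ℝ) ≠ 0 := by positivity
  have hc' : ((1 + h : ℝ) : ℂ) ≠ 0 := by exact_mod_cast hc
  have hh' : (h : ℂ) ≠ 0 := by exact_mod_cast hh.ne'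
  -- Since `1 - (V - 1)/h = ((1 + h)/h) (1 - V/(1 + h))`, a Neumann series inverts it; the factor
  -- `h/(1 + h)` in `Q` undoes the scalar.
  have hlt : ‖(((1 + h : ℝ)⁻¹ : ℝ) : ℂ) • V‖ < 1 := by
    rw [norm_smul, Complex.norm_real, Real.norm_of_nonneg (by positivity)]
    calc (1 + h)⁻¹ * ‖V‖ ≤ (1 + h)⁻¹ * 1 := by gcongr
      _ < 1 := by rw [mul_one]; exact inv_lt_one_of_one_lt₀ (by linarith)
  obtain ⟨u, hu⟩ := isUnit_one_sub_of_norm_lt_one hlt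
  have huf : ∀ f, (u : H →L[ℂ] H) f = f - (((1 + h : ℝ)⁻¹ : ℝ) : ℂ) • V f := fun f => by
    rw [hu]; simp
  let Q : H →L[ℂ] H := ((h / (1 + h) : ℝ) : ℂ) • ((u⁻¹ : (H →L[ℂ] H)ˣ) : H →L[ℂ] H)
  have hQ1 : ∀ f, V (Q f) = Q f + (h : ℂ) • (Q f - f) := by
    intro f
    have h1 : (u : H →L[ℂ] H) (((u⁻¹ : (H →L[ℂ] H)ˣ) : H →L[ℂ] H) f) = f := by
      rw [← mul_apply_eq_comp, Units.mul_inv]; simp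
    have h2 : (u : H →L[ℂ] H) (Q f) = ((h / (1 + h) : ℝ) : ℂ) • f := by
      simp only [Q, smul_apply, map_smul, h1]
    rw [huf, sub_eq_iff_eq_add, ← sub_eq_iff_eq_add'] at h2
    have h3 := congrArg (fun w => ((1 + h : ℝ) : ℂ) • w) h2
    simp only [smul_sub, smul_smul, ← Complex.ofReal_mul, mul_inv_cancel₀ hc,
      mul_div_cancel₀ h hc] at h3
    simp only [Complex.ofReal_one, one_smul] at h3
    rw [← h3, Complex.ofReal_add]
    simp only [Complex.ofReal_one]
    module
  have hQ2 : ∀ f, Q (f - ((h⁻¹ : ℝ) : ℂ) • (V f - f)) = f := by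
    intro f
    have h1 : f - ((h⁻¹ : ℝ) : ℂ) • (V f - f) = (((1 + h) / h : ℝ) : ℂ) • (u : H →L[ℂ] H) f := by
      rw [huf]
      push_cast
      rw [smul_sub ((1 + (h : ℂ)) / h), smul_smul]
      have : (1 + (h : ℂ)) / h * (1 + (h : ℂ))⁻¹ = (h : ℂ)⁻¹ := by
        push_cast at hc'
        field_simp
      rw [this]
      have h6 : (1 + (h : ℂ)) / h = (h : ℂ)⁻¹ + 1 := by field_simp
      rw [h6]
      module
    rw [h1, map_smul]
    simp only [Q, smul_apply]
    rw [← mul_apply_eq_comp, Units.inv_mul, smul_smul, ← Complex.ofReal_mul]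
    have : (1 + h) / h * (h / (1 + h)) = 1 := by field_simp
    rw [this]
    simp
  refine ⟨Q, hQ1, hQ2, ContinuousLinearMap.opNorm_le_bound _ zero_le_one fun f => ?_⟩
  have h1 : (1 + h) * ‖Q f‖ ≤ ‖Q f‖ + h * ‖f‖ := by
    have h2 : ((1 + h : ℝ) : ℂ) • Q f = V (Q f) + (h : ℂ) • f := by
      rw [hQ1]; push_cast; module
    have h3 := congrArg norm h2
    rw [norm_smul, Complex.norm_real, Real.norm_of_nonneg (by positivity)] at h3
    rw [h3]
    refine (norm_add_le _ _).trans (add_le_add ?_ ?_)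
    · simpa using V.le_of_opNorm_le hV (Q f)
    · rw [norm_smul, Complex.norm_real, Real.norm_of_nonneg hh.le]
  rw [one_mul]
  nlinarith

/-- **Chernoff's product formula**: if `U` is a family of contractions whose difference quotients
at `0` converge on a set `C` to the generator of `T`, and `1 - generator` maps `C` onto a dense set,
then `U (z / m) ^ m` converges strongly to `T z`. -/
theorem tendsto_pow_of_chernoff {M : Submodule ℂ (H × H)} (hM : IsMDissipative M)
    {T : ℝ → H →L[ℂ] H} (hT : IsContractionSemigroup T) (hTM : generatorGraph T = M)
    {U : ℝ → H →L[ℂ] H} (hU : ∀ h, 0 ≤ h → ‖U h‖ ≤ 1) {C : Set (H × H)} (hCM : C ⊆ M)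
    (hUC : ∀ q ∈ C, Tendsto (fun h : ℝ => ((h⁻¹ : ℝ) : ℂ) • (U h q.1 - q.1)) (𝓝[>] 0) (𝓝 q.2))
    (hC : Dense ((fun q : H × H => q.1 - q.2) '' C)) {z : ℝ} (hz : 0 < z) (f : H) :
    Tendsto (fun m : ℕ => (U (z / m) ^ m) f) atTop (𝓝 (T z f)) := by
  obtain ⟨R, hRM, -⟩ := hM.exists_resolvent one_pos
  simp only [Complex.ofReal_one, one_smul] at hRM
  have hRq : ∀ q ∈ M, R (q.1 - q.2) = q.1 := fun q hq =>
    hM.fst_unique one_pos (hRM (q.1 - q.2)) hq (by simp)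
  have hTq : ∀ t, 0 ≤ t → ∀ q ∈ M, (T t q.1, T t q.2) ∈ M := fun t ht q hq => by
    have := hT.apply_mem_generatorGraph (q := q) (by rw [hTM]; exact hq) ht
    rwa [hTM] at this
  have hTR : ∀ t, 0 ≤ t → ∀ f, R (T t f) = T t (R f) := fun t ht f => by
    have h1 := hTq t ht _ (hRM f)
    have h2 := hRq _ h1
    simpa using h2
  have hTb : ∀ t, 0 ≤ t → ∀ f, ‖T t f‖ ≤ ‖f‖ := fun t ht f =>
    norm_apply_le_norm (hT.contraction t ht) f
  choose! Q hQ1 hQ2 hQb using fun (h : ℝ) (hh : 0 < h) =>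
    exists_resolvent_of_contraction (hU h hh.le) hh
  -- Convergence of the discrete resolvents. On the dense image of `C` the error is `Q h` applied to
  -- the consistency error of the difference quotient.
  have hQR : ∀ f, Tendsto (fun h => Q h f) (𝓝[>] 0) (𝓝 (R f)) := by
    intro f
    refine tendsto_apply_of_dense (C := 1) ?_ hC ?_ f
    · filter_upwards [self_mem_nhdsWithin] with h hh using hQb h hh
    · rintro _ ⟨q, hq, rfl⟩
      simp only
      rw [hRq q (hCM hq), tendsto_iff_norm_sub_tendsto_zero]
      refine squeeze_zero' (Eventually.of_forall fun _ => norm_nonneg _) ?_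
        (tendsto_iff_norm_sub_tendsto_zero.1 (hUC q hq))
      filter_upwards [self_mem_nhdsWithin] with h (hh : 0 < h)
      have h1 : Q h (q.1 - q.2) - q.1 =
          Q h (((h⁻¹ : ℝ) : ℂ) • (U h q.1 - q.1) - q.2) := by
        nth_rewrite 2 [← hQ2 h hh q.1]
        rw [← map_sub]
        congr 1
        abel
      rw [h1]
      exact norm_apply_le_norm (hQb h hh) _
  have hseq : Tendsto (fun m : ℕ => z / m) atTop (𝓝[>] 0) := by
    refine tendsto_nhdsWithin_iff.2 ⟨tendsto_const_div_atTop_nhds_zero_nat z, ?_⟩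
    filter_upwards [eventually_gt_atTop 0] with m hm
    exact div_pos hz (by exact_mod_cast hm)
  have hkey : ∀ f, Tendsto (fun m : ℕ => (U (z / m) ^ m) (Q (z / m) (R f)) - Q (z / m) (T z (R f)))
      atTop (𝓝 0) := by
    intro f
    rw [Metric.tendsto_nhds]
    intro ε hε
    have hK : IsCompact ((fun t => T t f) '' Icc 0 z) :=
      isCompact_Icc.image_of_continuousOn ((hT.cont f).mono Icc_subset_Ici_self)
    have hunif := hseq.eventually (eventually_forall_norm_sub_lt (C := 1)
      (by filter_upwards [self_mem_nhdsWithin] with h hh using hQb h hh) hQR hK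
      (ε := ε / (3 * z)) (by positivity))
    have hgen : ∀ᶠ h in 𝓝[>] (0 : ℝ),
        ‖((h⁻¹ : ℝ) : ℂ) • (T h (R f) - R f) - (R f - f)‖ < ε / (3 * z) := by
      have h1 : (R f, R f - f) ∈ generatorGraph T := by rw [hTM]; exact hRM f
      simpa [dist_eq_norm] using Metric.tendsto_nhds.1 h1 (ε / (3 * z)) (by positivity)
    filter_upwards [hunif, hseq.eventually hgen, eventually_gt_atTop 0] with m hm1 hm2 hm
    have hmpos : (0 : ℝ) < m := by exact_mod_cast hm
    set h : ℝ := z / m with hh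
    have hhpos : 0 < h := div_pos hz hmpos
    -- The comparison path is `a_j = Q h (T (jh) (R f))`. Because `(U h - 1) Q h = h (Q h - 1)`, the
    -- local error is `h (Q h - R)` on the orbit of `f`, plus `h` times the generator error at `R
    -- f`. Each is at most `h ε / (3z)`, and `m h = z`, so the total is `2ε/3`.
    have htel := norm_pow_sub_le_of_telescope (hU h hhpos.le) (m := m)
      (a := fun j => Q h (T (j * h) (R f))) (c := h * (2 * (ε / (3 * z)))) (fun j hj => by
        have hj0 : (0 : ℝ) ≤ j * h := by positivity
        have hjz : (j : ℝ) * h ≤ z := by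
          rw [hh, mul_div_assoc', div_le_iff₀ hmpos, mul_comm]
          gcongr
        have e1 : ((j + 1 : ℕ) : ℝ) * h = j * h + h := by push_cast; ring
        have e2 : U h (Q h (T (j * h) (R f))) - Q h (T (((j + 1 : ℕ) : ℝ) * h) (R f)) =
            (h : ℂ) • (Q h (T (j * h) f) - R (T (j * h) f)) -
              Q h (T (j * h) (T h (R f) - R f - (h : ℂ) • (R f - f))) := by
          rw [hQ1 h hhpos, e1, hT.add _ _ hj0 hhpos.le, mul_apply_eq_comp, hTR _ hj0]
          simp only [map_sub, map_smul]
          module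
        have e3 : ‖T h (R f) - R f - (h : ℂ) • (R f - f)‖ ≤ h * (ε / (3 * z)) := by
          have e4 : T h (R f) - R f - (h : ℂ) • (R f - f) =
              (h : ℂ) • (((h⁻¹ : ℝ) : ℂ) • (T h (R f) - R f) - (R f - f)) := by
            rw [smul_sub (h : ℂ) _ (R f - f), smul_smul, ← Complex.ofReal_mul, mul_inv_cancel₀ hhpos.ne']
            simp
          rw [e4, norm_smul, Complex.norm_real, Real.norm_of_nonneg hhpos.le]
          gcongr
        have e5 : ‖Q h (T (j * h) (T h (R f) - R f - (h : ℂ) • (R f - f)))‖ ≤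
            h * (ε / (3 * z)) := by
          refine le_trans ?_ e3
          exact (norm_apply_le_norm (hQb h hhpos) _).trans (hTb _ hj0 _)
        have e6 : ‖(h : ℂ) • (Q h (T (j * h) f) - R (T (j * h) f))‖ ≤ h * (ε / (3 * z)) := by
          rw [norm_smul, Complex.norm_real, Real.norm_of_nonneg hhpos.le]
          gcongr
          exact (hm1 _ ⟨j * h, ⟨hj0, hjz⟩, rfl⟩).le
        rw [e2]
        refine (norm_sub_le _ _).trans ?_
        linarith)
    have e7 : (m : ℝ) * h = z := by rw [hh]; field_simp
    simp only [Nat.cast_zero, zero_mul, e7, hT.zero, one_apply_eq_self] at htel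
    rw [dist_zero_right]
    refine htel.trans_lt ?_
    rw [← mul_assoc, e7]
    have : z * (2 * (ε / (3 * z))) = 2 / 3 * ε := by field_simp
    rw [this]
    linarith
  have hUm : ∀ m : ℕ, ‖U (z / m) ^ m‖ ≤ 1 := fun m => by
    have hp : ∀ k : ℕ, ‖U (z / m) ^ k‖ ≤ 1 := fun k => by
      induction k with
      | zero => rw [pow_zero]; exact ContinuousLinearMap.norm_id_le
      | succ k ih =>
        rw [pow_succ]
        exact (norm_mul_le _ _).trans (mul_le_one₀ ih (norm_nonneg _) (hU _ (by positivity)))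
    exact hp m
  have hRdense : DenseRange R := by
    refine hM.dense.mono ?_
    rintro _ ⟨q, hq, rfl⟩
    exact ⟨_, hRq q hq⟩
  -- On the dense set of vectors `R (R g)`, the outer `R` may be exchanged for `Q (z / m)` at both
  -- ends at vanishing cost, which reduces the claim to `hkey`.
  refine tendsto_apply_of_dense (Eventually.of_forall hUm)
    (hRdense.comp hRdense R.continuous) ?_ f
  rintro _ ⟨g, rfl⟩
  simp only [Function.comp]
  have h1 : Tendsto (fun m : ℕ => (U (z / m) ^ m) (R (R g) - Q (z / m) (R g))) atTop (𝓝 0) := by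
    refine squeeze_zero_norm (fun m => (ContinuousLinearMap.le_of_opNorm_le _ (hUm m) _)) ?_
    have := (tendsto_const_nhds (x := R (R g))).sub ((hQR (R g)).comp hseq)
    simpa using this.norm
  have h2 := (h1.add (hkey g)).add ((hQR (T z (R g))).comp hseq)
  rw [hTR z hz.le, zero_add, zero_add] at h2
  refine h2.congr fun m => ?_
  simp only [Function.comp, map_sub]
  abel

end Chernoff

end BeamWave

namespace BeamWave

section DenseRange

/-! ### Bounded dissipative perturbations of operators with dense range -/

variable {H : Type*} [NormedAddCommGroup H] [InnerProductSpace ℂ H] [CompleteSpace H]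
variable {D : Type*} [AddCommGroup D] [Module ℂ D]

theorem denseRange_of_orthogonal {L : D →ₗ[ℂ] H} (h : ∀ g : H, (∀ θ, inner ℂ g (L θ) = 0) → g = 0) :
    DenseRange L := by
  have h1 : (LinearMap.range L)ᗮ = ⊥ := by
    rw [eq_bot_iff]
    intro g hg
    rw [Submodule.mem_orthogonal'] at hg
    exact h g fun θ => hg _ ⟨θ, rfl⟩
  have h2 := Submodule.topologicalClosure_eq_top_iff.2 h1
  have h3 := Submodule.dense_iff_topologicalClosure_eq_top.2 h2
  rwa [LinearMap.coe_range] at h3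

/-- If `g` is orthogonal to the range of `L - B`, then `⟨g, L θ⟩ = ⟨g, B θ⟩` is at most `q ‖g‖ ‖L
θ‖`. By density of the range of `L` this extends to all vectors, and at `g` itself it reads `‖g‖² ≤
q ‖g‖²`. -/
theorem denseRange_sub_of_small {L B : D →ₗ[ℂ] H} (hL : DenseRange L) {q : ℝ} (hq : q < 1)
    (hB : ∀ θ, ‖B θ‖ ≤ q * ‖L θ‖) : DenseRange (L - B) := by
  refine denseRange_of_orthogonal fun g hg => ?_
  have h1 : ∀ h : H, ‖inner ℂ g h‖ ≤ q * ‖g‖ * ‖h‖ := by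
    intro h
    refine hL.induction_on (p := fun h => ‖inner ℂ g h‖ ≤ q * ‖g‖ * ‖h‖) h ?_ ?_
    · exact isClosed_le (by fun_prop) (by fun_prop)
    · intro θ
      have h2 := hg θ
      rw [LinearMap.sub_apply, inner_sub_right, sub_eq_zero] at h2
      rw [h2]
      calc _ ≤ ‖g‖ * ‖B θ‖ := norm_inner_le_norm _ _
        _ ≤ ‖g‖ * (q * ‖L θ‖) := by gcongr; exact hB θ
        _ = _ := by ring
  have h2 := h1 g
  rw [inner_self_eq_norm_sq_to_K] at h2
  simp only [Complex.coe_algebraMap, norm_pow, Complex.norm_real, norm_norm] at h2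
  by_contra hne
  have h3 : 0 < ‖g‖ := norm_pos_iff.2 hne
  nlinarith [mul_pos h3 h3]

/-- Method of continuity: `B` is added in `N` equal steps. The bound `r ‖J θ‖ ≤ ‖(r J - A - (j/N) B
J) θ‖` holds at every stage by dissipativity, so each step is small with the same ratio `‖B‖ / (N r)
< 1`. -/
theorem denseRange_sub_of_dissipative {J A : D →ₗ[ℂ] H} (hA : ∀ θ, (inner ℂ (J θ) (A θ)).re ≤ 0)
    {r : ℝ} (hr : 0 < r) (hd : DenseRange ((r : ℂ) • J - A)) {B : H →L[ℂ] H}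
    (hB : ∀ f, (inner ℂ f (B f)).re ≤ 0) :
    DenseRange ((r : ℂ) • J - A - (B : H →ₗ[ℂ] H) ∘ₗ J) := by
  obtain ⟨N, hN⟩ := exists_nat_gt (‖B‖ / r)
  have hNpos : (0 : ℝ) < N := lt_of_le_of_lt (by positivity) hN
  rw [div_lt_iff₀ hr] at hN
  have key : ∀ j : ℕ, DenseRange ((r : ℂ) • J - A -
      ((j : ℂ) / N) • ((B : H →ₗ[ℂ] H) ∘ₗ J)) := by
    intro j
    induction j with
    | zero => simpa using hd
    | succ j ih =>
      have h1 := denseRange_sub_of_small (B := ((1 : ℂ) / N) • ((B : H →ₗ[ℂ] H) ∘ₗ J)) ih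
        (q := ‖B‖ / (N * r)) (by rw [div_lt_one (by positivity)]; exact hN) fun θ => by
          have h2 : (inner ℂ (J θ) (A θ + ((j : ℂ) / N) • B (J θ))).re ≤ 0 := by
            have h3 : ((j : ℂ) / N) = ((j / N : ℝ) : ℂ) := by push_cast; rfl
            rw [inner_add_right, inner_smul_right, h3, Complex.add_re, Complex.re_ofReal_mul]
            have := mul_nonpos_of_nonneg_of_nonpos (a := (j / N : ℝ)) (by positivity) (hB (J θ))
            linarith [hA θ]
          have h4 := mul_norm_le_of_dissipative h2 r
          simp only [LinearMap.smul_apply, LinearMap.sub_apply, LinearMap.comp_apply,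
            ContinuousLinearMap.coe_coe]
          rw [← sub_sub] at h4
          rw [norm_smul]
          have h5 : ‖(1 : ℂ) / N‖ = 1 / N := by simp
          rw [h5]
          calc 1 / (N : ℝ) * ‖B (J θ)‖ ≤ 1 / N * (‖B‖ * ‖J θ‖) := by
                gcongr; exact B.le_opNorm _
            _ = ‖B‖ / (N * r) * (r * ‖J θ‖) := by field_simp
            _ ≤ _ := by gcongr
      have h6 : (r : ℂ) • J - A - (((j + 1 : ℕ) : ℂ) / N) • ((B : H →ₗ[ℂ] H) ∘ₗ J) =
          (r : ℂ) • J - A - ((j : ℂ) / N) • ((B : H →ₗ[ℂ] H) ∘ₗ J) -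
            ((1 : ℂ) / N) • ((B : H →ₗ[ℂ] H) ∘ₗ J) := by
        rw [sub_sub _ (((j : ℂ) / N) • _), ← add_smul, Nat.cast_succ, add_div]
      rw [h6]
      exact h1
  have h := key N
  rwa [div_self (by exact_mod_cast hNpos.ne'), one_smul] at h

end DenseRange

/-! ### Multiplication operators on `L²` -/

section Multiplication

variable {α : Type*} [MeasurableSpace α] {μ : Measure α}

theorem exists_mulCLM {V : α → ℂ} (hV : AEStronglyMeasurable V μ) {C : ℝ} (hC : ∀ x, ‖V x‖ ≤ C) :
    ∃ B : Lp ℂ 2 μ →L[ℂ] Lp ℂ 2 μ, (∀ f, B f =ᵐ[μ] fun x => V x * f x) ∧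
      ∀ f, ‖B f‖ ≤ C * ‖f‖ := by
  have hmem : ∀ f : Lp ℂ 2 μ, MemLp (fun x => V x * f x) 2 μ := fun f =>
    (Lp.memLp f).of_le_mul (c := C) (hV.mul (Lp.aestronglyMeasurable f)) (ae_of_all _ fun x => by
      rw [norm_mul]; gcongr; exact hC x)
  have hb : ∀ f : Lp ℂ 2 μ, ‖(hmem f).toLp‖ ≤ C * ‖f‖ := fun f => by
    refine Lp.norm_le_mul_norm_of_ae_le_mul ?_
    filter_upwards [(hmem f).coeFn_toLp] with x hx
    rw [hx, norm_mul]; gcongr; exact hC x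
  let B : Lp ℂ 2 μ →ₗ[ℂ] Lp ℂ 2 μ :=
    { toFun := fun f => (hmem f).toLp
      map_add' := fun f g => by
        ext1
        filter_upwards [(hmem (f + g)).coeFn_toLp, (hmem f).coeFn_toLp, (hmem g).coeFn_toLp,
          Lp.coeFn_add f g, Lp.coeFn_add (hmem f).toLp (hmem g).toLp] with x h1 h2 h3 h4 h5
        rw [h1, h5, Pi.add_apply, h2, h3, h4, Pi.add_apply, mul_add]
      map_smul' := fun c f => by
        ext1
        filter_upwards [(hmem (c • f)).coeFn_toLp, (hmem f).coeFn_toLp,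
          Lp.coeFn_smul c f, Lp.coeFn_smul c (hmem f).toLp] with x h1 h2 h4 h5
        rw [RingHom.id_apply, h1, h5, Pi.smul_apply, h2, h4, Pi.smul_apply, smul_eq_mul,
          smul_eq_mul, mul_left_comm] }
  exact ⟨B.mkContinuous C hb, fun f => (hmem f).coeFn_toLp, hb⟩

theorem re_inner_mul_nonpos {V : α → ℂ} (hV : ∀ x, (V x).re ≤ 0) {f g : Lp ℂ 2 μ}
    (h : g =ᵐ[μ] fun x => V x * f x) : (inner ℂ f g).re ≤ 0 := by
  rw [L2.inner_def, ← RCLike.re_eq_complex_re, ← integral_re (L2.integrable_inner f g)]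
  refine integral_nonpos_of_ae ?_
  filter_upwards [h] with x hx
  rw [hx, RCLike.inner_apply, mul_assoc, RCLike.re_eq_complex_re, Complex.mul_conj, mul_comm,
    Complex.re_ofReal_mul]
  exact mul_nonpos_of_nonneg_of_nonpos (Complex.normSq_nonneg _) (hV x)

end Multiplication

section Schwartz

variable {X : Type*} [NormedAddCommGroup X] [InnerProductSpace ℝ X]

/-! ### Schwartz functions in `L²` -/

/-- The pointwise product of Schwartz functions. -/
noncomputable def mulSchwartz (f g : 𝓢(X, ℂ)) : 𝓢(X, ℂ) :=
  SchwartzMap.pairing (ContinuousLinearMap.mul ℂ ℂ) f g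

theorem mulSchwartz_apply (f g : 𝓢(X, ℂ)) (x : X) : mulSchwartz f g x = f x * g x := rfl

theorem lineDeriv_mulSchwartz (f g : 𝓢(X, ℂ)) (v : X) :
    ∂_{v} (mulSchwartz f g) = mulSchwartz (∂_{v} f) g + mulSchwartz f (∂_{v} g) := by
  ext x
  have h1 : (mulSchwartz f g : X → ℂ) = fun x => f x * g x := rfl
  simp only [add_apply, mulSchwartz_apply, SchwartzMap.lineDerivOp_apply_eq_fderiv]
  rw [h1, fderiv_fun_mul (f.hasFDerivAt x).differentiableAt (g.hasFDerivAt x).differentiableAt]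
  simp
  ring

variable [FiniteDimensional ℝ X]

theorem laplacian_mulSchwartz (f g : 𝓢(X, ℂ)) (x : X) :
    (Δ (mulSchwartz f g)) x = f x * (Δ g) x +
      2 * (∑ i, (∂_{stdOrthonormalBasis ℝ X i} f) x * (∂_{stdOrthonormalBasis ℝ X i} g) x) +
      (Δ f) x * g x := by
  simp only [SchwartzMap.laplacian_eq_sum (stdOrthonormalBasis ℝ X), sum_apply,
    lineDeriv_mulSchwartz, LineDeriv.lineDerivOp_add, add_apply, mulSchwartz_apply,
    Finset.mul_sum, Finset.sum_mul, ← Finset.sum_add_distrib]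
  exact Finset.sum_congr rfl fun i _ => by ring

variable [MeasurableSpace X] [BorelSpace X]

theorem inner_lineDeriv (f g : 𝓢(X, ℂ)) (v : X) :
    inner ℂ (f.toLp 2 (volume : Measure X)) ((∂_{v} g).toLp 2) =
      -inner ℂ ((∂_{v} f).toLp 2 (volume : Measure X)) (g.toLp 2) := by
  rw [SchwartzMap.inner_toL2_toL2_eq f (∂_{v} g) volume,
    SchwartzMap.inner_toL2_toL2_eq (∂_{v} f) g volume]
  have h := SchwartzMap.integral_bilinear_lineDerivOp_right_eq_neg_left (μ := volume) f g
    ((ContinuousLinearMap.mul ℝ ℂ).comp (Complex.conjCLE : ℂ →L[ℝ] ℂ)) v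
  simpa [RCLike.inner_apply, mul_comm] using h

theorem inner_laplacian (f : 𝓢(X, ℂ)) :
    inner ℂ (f.toLp 2 (volume : Measure X)) ((Δ f).toLp 2) =
      -((∑ i, ‖(∂_{stdOrthonormalBasis ℝ X i} f).toLp 2 (volume : Measure X)‖ ^ 2 : ℝ) : ℂ) := by
  have h1 : (Δ f).toLp 2 (volume : Measure X) = ∑ i,
      (∂_{stdOrthonormalBasis ℝ X i} (∂_{stdOrthonormalBasis ℝ X i} f)).toLp 2 := by
    rw [SchwartzMap.laplacian_eq_sum (stdOrthonormalBasis ℝ X) f]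
    exact map_sum (SchwartzMap.toLpCLM ℂ ℂ 2 (volume : Measure X)) _ _
  rw [h1, inner_sum]
  simp only [inner_lineDeriv, inner_self_eq_norm_sq_to_K]
  simp

theorem fourier_laplacian_apply (f : 𝓢(X, ℂ)) (ξ : X) :
    (𝓕 (Δ f)) ξ = -(((2 * Real.pi) ^ 2 * ‖ξ‖ ^ 2 : ℝ) : ℂ) * (𝓕 f) ξ := by
  rw [SchwartzMap.laplacian_eq_fourierMultiplierCLM, SchwartzMap.fourierMultiplierCLM_apply,
    ← FourierTransform.fourierInv_smul, FourierTransform.fourier_fourierInv_eq, smul_apply,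
    SchwartzMap.smulLeftCLM_apply_apply (by fun_prop)]
  simp
  ring

variable (X) in
/-- Schwartz functions as elements of `L²`. -/
noncomputable def schwartzToL2 : 𝓢(X, ℂ) →ₗ[ℂ] Lp ℂ 2 (volume : Measure X) where
  toFun θ := θ.toLp 2
  map_add' _ _ := rfl
  map_smul' _ _ := rfl

theorem schwartzToL2_apply (θ : 𝓢(X, ℂ)) :
    schwartzToL2 X θ = θ.toLp 2 (volume : Measure X) := rfl

variable (X) in
/-- The operator `i a Δ` on Schwartz functions, with values in `L²`. -/
noncomputable def schwartzKinetic (a : ℝ) : 𝓢(X, ℂ) →ₗ[ℂ] Lp ℂ 2 (volume : Measure X) :=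
  schwartzToL2 X ∘ₗ ((Complex.I * a) •
    (LineDeriv.laplacianCLM ℂ X 𝓢(X, ℂ) : 𝓢(X, ℂ) →L[ℂ] 𝓢(X, ℂ)).toLinearMap)

theorem schwartzKinetic_apply (a : ℝ) (θ : 𝓢(X, ℂ)) :
    schwartzKinetic X a θ = (Complex.I * a) • (Δ θ).toLp 2 (volume : Measure X) := by
  simp only [schwartzKinetic, LinearMap.comp_apply, LinearMap.smul_apply, map_smul,
    ContinuousLinearMap.coe_coe, SchwartzMap.laplacianCLM_eq]
  rfl

/-- The value is purely imaginary: its vanishing real part gives dissipativity, and its imaginary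
part is the Dirichlet energy that later controls the gradient. -/
theorem inner_schwartzKinetic (a : ℝ) (θ : 𝓢(X, ℂ)) :
    inner ℂ (schwartzToL2 X θ) (schwartzKinetic X a θ) = -(Complex.I * ((a *
      ∑ i, ‖schwartzToL2 X (∂_{stdOrthonormalBasis ℝ X i} θ)‖ ^ 2 : ℝ) : ℂ)) := by
  have h := inner_laplacian θ
  rw [schwartzKinetic_apply, inner_smul_right, schwartzToL2_apply, h]
  simp only [schwartzToL2_apply]
  push_cast
  ring

theorem eq_zero_of_forall_inner_eq_zero {g : Lp ℂ 2 (volume : Measure X)} {m : X → ℂ}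
    (hm : Continuous m) (hm0 : ∀ x, m x ≠ 0)
    (h : ∀ φ : 𝓢(X, ℂ), HasCompactSupport φ → ∫ x, inner ℂ (g x) (m x * φ x) = 0) : g = 0 := by
  have hloc : LocallyIntegrable (fun x => m x * (starRingEnd ℂ) (g x)) (volume : Measure X) := by
    refine LocallyIntegrable.continuous_mul hm ?_
    have h1 := (Lp.memLp g).locallyIntegrable (by norm_num)
    intro x
    obtain ⟨s, hs, hi⟩ := h1 x
    exact ⟨s, hs, (Complex.conjCLE : ℂ →L[ℝ] ℂ).integrable_comp hi⟩
  have h2 := ae_eq_zero_of_integral_contDiff_smul_eq_zero hloc fun φ hφ hφc => by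
    have hc : HasCompactSupport fun x => (φ x : ℂ) := hφc.comp_left (g := Complex.ofReal) rfl
    have h3 := h (hc.toSchwartzMap (Complex.ofRealCLM.contDiff.comp hφ)) hc
    rw [← h3]
    refine integral_congr_ae (ae_of_all _ fun x => ?_)
    change _ = inner ℂ (g x) (m x * (φ x : ℂ))
    simp only [RCLike.inner_apply, Complex.real_smul]
    ring
  refine Lp.ext ?_
  filter_upwards [h2, Lp.coeFn_zero ℂ 2 (volume : Measure X)] with x hx hx0
  rw [hx0]
  simpa [hm0 x] using hx

/-- `r - i a Δ` maps the Schwartz space onto a dense subspace of `L²`. -/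
theorem denseRange_kinetic (a : ℝ) {r : ℝ} (hr : 0 < r) :
    DenseRange ((r : ℂ) • schwartzToL2 X - schwartzKinetic X a) := by
  refine denseRange_of_orthogonal fun g hg => ?_
  -- The Fourier symbol of `r - i a Δ`; its real part is `r`, so it has no zeros.
  let m : X → ℂ := fun ξ => r + Complex.I * a * (((2 * Real.pi) ^ 2 * ‖ξ‖ ^ 2 : ℝ) : ℂ)
  have hm0 : ∀ ξ, m ξ ≠ 0 := fun ξ h0 => by
    have := congrArg Complex.re h0
    simp only [m, Complex.add_re, Complex.ofReal_re, mul_assoc, Complex.I_mul_re,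
      ← Complex.ofReal_mul, Complex.ofReal_im, neg_zero, add_zero, Complex.zero_re] at this
    exact hr.ne' this
  have hG : 𝓕 g = 0 := by
    refine eq_zero_of_forall_inner_eq_zero (m := m) (by fun_prop) hm0 fun φ _ => ?_
    let θ : 𝓢(X, ℂ) := 𝓕⁻ φ
    let ψ : 𝓢(X, ℂ) := (r : ℂ) • θ + (-(Complex.I * a)) • Δ θ
    have h1 : ((r : ℂ) • schwartzToL2 X - schwartzKinetic X a) θ = ψ.toLp 2 volume := by
      rw [LinearMap.sub_apply, LinearMap.smul_apply, schwartzKinetic_apply, sub_eq_add_neg,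
        ← neg_smul]
      rfl
    have h2 := hg θ
    rw [h1, ← Lp.inner_fourier_eq, SchwartzMap.toLp_fourier_eq, L2.inner_def] at h2
    rw [← h2]
    refine integral_congr_ae ?_
    filter_upwards [(𝓕 ψ).coeFn_toLp 2 volume] with ξ hξ
    rw [hξ]
    congr 1
    have h3 : 𝓕 ψ = (r : ℂ) • φ + (-(Complex.I * a)) • 𝓕 (Δ θ) := by
      simp only [ψ, FourierTransform.fourier_add, FourierTransform.fourier_smul, θ,
        FourierTransform.fourier_fourierInv_eq]
    rw [h3]
    simp only [_root_.add_apply, smul_apply, fourier_laplacian_apply, smul_eq_mul, m, θ,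
      FourierTransform.fourier_fourierInv_eq]
    ring
  have := congrArg (fun f => 𝓕⁻ f) hG
  simpa using this

end Schwartz

end BeamWave

namespace BeamWave

section Cutoff

variable {X : Type*} [NormedAddCommGroup X] [InnerProductSpace ℝ X] [FiniteDimensional ℝ X]

/-! ### Cutoff functions -/

/-- `χ` is a smooth cutoff, equal to `1` on the ball of radius `R`, supported in that of radius
`2 R`, with derivatives bounded by `C / R`. -/
structure IsCutoff (C R : ℝ) (χ : 𝓢(X, ℂ)) : Prop where
  compact : HasCompactSupport χ
  real : ∀ x, ∃ t : ℝ, 0 ≤ t ∧ t ≤ 1 ∧ χ x = t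
  eq_one : ∀ x, ‖x‖ ≤ R → χ x = 1
  support : ∀ x, χ x ≠ 0 → ‖x‖ ≤ 2 * R
  deriv : ∀ i x, ‖(∂_{stdOrthonormalBasis ℝ X i} χ) x‖ ≤ C / R
  laplacian : ∀ x, ‖(Δ χ) x‖ ≤ C / R

theorem IsCutoff.norm_le {C R : ℝ} {χ : 𝓢(X, ℂ)} (h : IsCutoff C R χ) (x : X) : ‖χ x‖ ≤ 1 := by
  obtain ⟨t, h0, h1, ht⟩ := h.real x
  rwa [ht, Complex.norm_real, Real.norm_of_nonneg h0]

variable (X) in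
-- Dilations of one bump, so `C` does not depend on `R`. The Laplacian scales like `R⁻²`, which `1 ≤
-- R` weakens to `R⁻¹`.
theorem exists_isCutoff : ∃ C : ℝ, 0 ≤ C ∧ ∀ R : ℝ, 1 ≤ R → ∃ χ : 𝓢(X, ℂ), IsCutoff C R χ := by
  let b : ContDiffBump (0 : X) := ⟨1, 2, one_pos, one_lt_two⟩
  have hcs : HasCompactSupport fun x => (b x : ℂ) :=
    b.hasCompactSupport.comp_left (g := Complex.ofReal) rfl
  let φ : 𝓢(X, ℂ) := hcs.toSchwartzMap (Complex.ofRealCLM.contDiff.comp b.contDiff)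
  have hφ : ∀ x, φ x = (b x : ℂ) := fun _ => rfl
  have hbd : ∀ ψ : 𝓢(X, ℂ), ∃ C : ℝ, 0 ≤ C ∧ ∀ x, ‖ψ x‖ ≤ C := fun ψ => by
    obtain ⟨C, hC, h⟩ := ψ.decay 0 0
    exact ⟨C, hC.le, fun x => by simpa using h x⟩
  choose c hc0 hc using fun i => hbd (∂_{stdOrthonormalBasis ℝ X i} φ)
  obtain ⟨c', hc'0, hc'⟩ := hbd (Δ φ)
  refine ⟨c' + ∑ i, c i, add_nonneg hc'0 (Finset.sum_nonneg fun i _ => hc0 i), fun R hR => ?_⟩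
  have hR0 : 0 < R := by linarith
  let e : X ≃L[ℝ] X := (LinearEquiv.smulOfNeZero ℝ X R⁻¹ (by positivity)).toContinuousLinearEquiv
  have he : ∀ x, e x = R⁻¹ • x := fun _ => rfl
  let χ : 𝓢(X, ℂ) := SchwartzMap.compCLMOfContinuousLinearEquiv ℂ e φ
  have hχ : ∀ x, χ x = (b (R⁻¹ • x) : ℂ) := fun _ => rfl
  have hd : ∀ (ψ : 𝓢(X, ℂ)) (v : X), ∂_{v} (SchwartzMap.compCLMOfContinuousLinearEquiv ℂ e ψ) =
      R⁻¹ • SchwartzMap.compCLMOfContinuousLinearEquiv ℂ e (∂_{v} ψ) := fun ψ v => by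
    rw [SchwartzMap.lineDerivOp_compCLMOfContinuousLinearEquiv, he,
      LineDeriv.lineDerivOp_left_smul]
    rfl
  have hnorm : ∀ x : X, ‖R⁻¹ • x‖ = R⁻¹ * ‖x‖ := fun x => by
    rw [norm_smul, Real.norm_of_nonneg (by positivity)]
  refine ⟨χ, hcs.comp_homeomorph e.toHomeomorph, fun x => ⟨_, b.nonneg, b.le_one, hχ x⟩,
    fun x hx => ?_, fun x hx => ?_, fun i x => ?_, fun x => ?_⟩
  · rw [hχ, b.one_of_mem_closedBall, Complex.ofReal_one]
    rw [mem_closedBall_zero_iff, hnorm]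
    exact (inv_mul_le_iff₀ hR0).2 (by change ‖x‖ ≤ R * 1; linarith)
  · by_contra hlt
    refine hx ?_
    rw [hχ, b.zero_of_le_dist, Complex.ofReal_zero]
    rw [dist_zero_right, hnorm, le_inv_mul_iff₀ hR0]
    change R * 2 ≤ _
    linarith
  · rw [hd, smul_apply, norm_smul, Real.norm_of_nonneg (by positivity), div_eq_inv_mul]
    gcongr
    refine (hc i (e x)).trans ?_
    have := Finset.single_le_sum (fun i _ => hc0 i) (Finset.mem_univ i)
    linarith
  · have h1 : (Δ χ) x = (R⁻¹ * R⁻¹ : ℝ) • (Δ φ) (e x) := by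
      simp only [SchwartzMap.laplacian_eq_sum (stdOrthonormalBasis ℝ X), sum_apply,
        Finset.smul_sum]
      refine Finset.sum_congr rfl fun i _ => ?_
      rw [hd, LineDeriv.lineDerivOp_smul, hd, smul_smul]
      rfl
    rw [h1, norm_smul, Real.norm_of_nonneg (by positivity), div_eq_inv_mul]
    have h2 : R⁻¹ ≤ 1 := inv_le_one_of_one_le₀ hR
    have h3 := hc' (e x)
    have h4 : 0 ≤ ∑ i, c i := Finset.sum_nonneg fun i _ => hc0 i
    have h5 : 0 < R⁻¹ := by positivity
    calc R⁻¹ * R⁻¹ * ‖(Δ φ) (e x)‖ ≤ R⁻¹ * 1 * (c' + ∑ i, c i) := by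
          gcongr; linarith
      _ = _ := by ring

variable [MeasurableSpace X] [BorelSpace X]

theorem norm_mulSchwartz_le {C : ℝ} {f : 𝓢(X, ℂ)} (hf : ∀ x, ‖f x‖ ≤ C) (g : 𝓢(X, ℂ)) :
    ‖schwartzToL2 X (mulSchwartz f g)‖ ≤ C * ‖schwartzToL2 X g‖ := by
  refine Lp.norm_le_mul_norm_of_ae_le_mul ?_
  filter_upwards [(mulSchwartz f g).coeFn_toLp 2 volume, g.coeFn_toLp 2 volume] with x h1 h2
  rw [schwartzToL2_apply, schwartzToL2_apply, h1, h2, mulSchwartz_apply, norm_mul]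
  gcongr
  exact hf x

theorem im_inner_mul_eq_zero {α : Type*} [MeasurableSpace α] {μ : Measure α} {V : α → ℂ}
    (hV : ∀ x, (V x).im = 0) {f g : Lp ℂ 2 μ}
    (h : g =ᵐ[μ] fun x => V x * f x) : (inner ℂ f g).im = 0 := by
  rw [L2.inner_def, ← RCLike.im_eq_complex_im, ← integral_im (L2.integrable_inner f g)]
  refine integral_eq_zero_of_ae ?_
  filter_upwards [h] with x hx
  rw [hx, RCLike.inner_apply, mul_assoc, RCLike.im_eq_complex_im, Complex.mul_conj, mul_comm,
    Complex.im_ofReal_mul, hV]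
  simp

theorem exists_schwartz_near (f : Lp ℂ 2 (volume : Measure X)) {ε : ℝ} (hε : 0 < ε) :
    ∃ φ : 𝓢(X, ℂ), HasCompactSupport φ ∧ ‖schwartzToL2 X φ - f‖ < ε := by
  obtain ⟨f', hf', φ, h1, h2, h3⟩ := Metric.dense_iff.1
    (Lp.dense_hasCompactSupport_contDiff (μ := (volume : Measure X)) (F := ℂ) (p := 2)
      (by norm_num)) f ε hε
  refine ⟨h2.toSchwartzMap h3, h2, ?_⟩
  rw [Metric.mem_ball, dist_eq_norm] at hf'
  have : schwartzToL2 X (h2.toSchwartzMap h3) = f' := by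
    refine Lp.ext ?_
    filter_upwards [(h2.toSchwartzMap h3).coeFn_toLp 2 volume, h1] with x h4 h5
    rw [schwartzToL2_apply, h4, h5]
    rfl
  rwa [this]

/-- Density of the range of `r - (i a Δ + V)` on test functions: `V` is a continuous, real,
non-positive potential. -/
theorem exists_test_near {a r : ℝ} (ha : 0 ≤ a) (hr : 0 < r) {V : X → ℂ} (hV : Continuous V)
    (hVim : ∀ x, (V x).im = 0) (hVre : ∀ x, (V x).re ≤ 0) (f : Lp ℂ 2 (volume : Measure X))
    {ε : ℝ} (hε : 0 < ε) :
    ∃ w : 𝓢(X, ℂ), HasCompactSupport w ∧ ∃ G : Lp ℂ 2 (volume : Measure X),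
      (G =ᵐ[volume] fun x => r * w x - (Complex.I * a * (Δ w) x + V x * w x)) ∧ ‖G - f‖ < ε := by
  obtain ⟨φ, hφc, hφ⟩ := exists_schwartz_near f (half_pos hε)
  obtain ⟨C, hC0, hC⟩ := exists_isCutoff X
  set f₀ := schwartzToL2 X φ with hf₀
  set K : ℝ := ‖f₀‖ + 1 with hK
  have hKpos : 0 < K := by positivity
  -- `P` will bound `a ‖∂_i θ‖`, whose square is at most `P - 1`. The constant `Q` collects the
  -- commutator terms: `2 P` for each gradient direction and `a K / r` for the Laplacian of the
  -- cutoff.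
  set P : ℝ := a * (K / r) * K + 1 with hP
  have hP1 : 1 ≤ P := by
    have : 0 ≤ a * (K / r) * K := by positivity
    linarith
  set Q : ℝ := 2 * (Module.finrank ℝ X * P) + a * (K / r) with hQ
  have hQ0 : 0 ≤ Q := by positivity
  obtain ⟨ρ, hρ⟩ := hφc.isCompact.isBounded.exists_norm_le
  -- `R` is fixed before `θ` is known; this is possible because `K`, `P` and `Q` do not involve the
  -- truncated potential.
  obtain ⟨R, hR⟩ := exists_gt (max (max 1 ρ) (4 * C * Q / ε))
  have hR1 : 1 ≤ R := (le_max_left _ _).trans ((le_max_left _ _).trans hR.le)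
  have hRρ : ρ ≤ R := (le_max_right _ _).trans ((le_max_left _ _).trans hR.le)
  have hRC : C / R * Q < ε / 4 := by
    have h1 := (le_max_right (max 1 ρ) (4 * C * Q / ε)).trans_lt hR
    rw [div_lt_iff₀ hε] at h1
    rw [div_mul_eq_mul_div, div_lt_iff₀ (by linarith)]
    linarith
  obtain ⟨χ, hχ⟩ := hC R hR1
  -- `χ'` equals `1` on the ball of radius `2R`, which contains the support of `χ`. So `χ' V` is
  -- bounded and agrees with `V` wherever `χ` does not vanish.
  obtain ⟨χ', hχ'⟩ := hC (2 * R) (by linarith)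
  -- the truncated potential
  have hV'c : Continuous fun x => χ' x * V x := χ'.continuous.mul hV
  obtain ⟨C', hC'⟩ := (hχ'.compact.mul_right (f' := V)).exists_bound_of_continuous hV'c
  have hV're : ∀ x, (χ' x * V x).re ≤ 0 := fun x => by
    obtain ⟨t, h0, -, ht⟩ := hχ'.real x
    rw [ht, Complex.re_ofReal_mul]
    exact mul_nonpos_of_nonneg_of_nonpos h0 (hVre x)
  have hV'im : ∀ x, (χ' x * V x).im = 0 := fun x => by
    obtain ⟨t, h0, -, ht⟩ := hχ'.real x
    rw [ht, Complex.im_ofReal_mul, hVim, mul_zero]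
  obtain ⟨B, hB, -⟩ := exists_mulCLM (μ := (volume : Measure X)) hV'c.aestronglyMeasurable hC'
  obtain ⟨Bχ, hBχ, hBχn⟩ := exists_mulCLM (μ := (volume : Measure X))
    χ.continuous.aestronglyMeasurable hχ.norm_le
  have hdense := denseRange_sub_of_dissipative (J := schwartzToL2 X) (A := schwartzKinetic X a)
    (fun θ => by rw [inner_schwartzKinetic, Complex.neg_re, Complex.I_mul_re]; simp [-Complex.ofReal_sum, -Complex.ofReal_mul])
    hr (denseRange_kinetic a hr) (fun g => re_inner_mul_nonpos hV're (hB g))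
  -- The radius `1` in the minimum keeps `‖F‖` below `K`; `ε / 4` is the share of the final error.
  obtain ⟨_, hF, θ, rfl⟩ := Metric.dense_iff.1 hdense f₀ (min 1 (ε / 4)) (by positivity)
  rw [Metric.mem_ball, dist_eq_norm] at hF
  set F := ((r : ℂ) • schwartzToL2 X - schwartzKinetic X a -
    (B : Lp ℂ 2 (volume : Measure X) →ₗ[ℂ] Lp ℂ 2 (volume : Measure X)) ∘ₗ schwartzToL2 X) θ
    with hFdef
  have hFeq : F = (r : ℂ) • schwartzToL2 X θ - (schwartzKinetic X a θ + B (schwartzToL2 X θ)) := by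
    rw [hFdef, ← sub_sub]; rfl
  have hFK : ‖F‖ ≤ K := by
    have h1 := hF.trans_le (min_le_left _ _)
    have h2 := norm_add_le (F - f₀) f₀
    rw [sub_add_cancel] at h2
    linarith
  set S : ℝ := ∑ i, ‖schwartzToL2 X (∂_{stdOrthonormalBasis ℝ X i} θ)‖ ^ 2 with hS
  have hAθ : inner ℂ (schwartzToL2 X θ) (schwartzKinetic X a θ) = -(Complex.I * ((a * S : ℝ) : ℂ)) :=
    inner_schwartzKinetic a θ
  have hθ : ‖schwartzToL2 X θ‖ ≤ K / r := by
    rw [le_div_iff₀ hr, mul_comm]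
    refine le_trans ?_ hFK
    rw [hFeq]
    refine mul_norm_le_of_dissipative ?_ r
    rw [inner_add_right, hAθ, Complex.add_re, Complex.neg_re, Complex.I_mul_re, Complex.ofReal_im]
    simpa using re_inner_mul_nonpos hV're (hB (schwartzToL2 X θ))
  -- Imaginary part of `⟨θ, F⟩`: the `r` term and the real potential drop out, leaving the energy `a
  -- S`, whatever the truncation.
  have hgrad : a * S ≤ K / r * K := by
    have h1 : (inner ℂ (schwartzToL2 X θ) F).im = a * S := by
      rw [hFeq, inner_sub_right, inner_add_right, hAθ, inner_smul_right,
        inner_self_eq_norm_sq_to_K, Complex.sub_im, Complex.add_im,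
        im_inner_mul_eq_zero hV'im (hB (schwartzToL2 X θ)), Complex.neg_im, Complex.I_mul_im,
        Complex.ofReal_re, Complex.im_ofReal_mul]
      simp [← Complex.ofReal_pow]
    rw [← h1]
    calc _ ≤ ‖inner ℂ (schwartzToL2 X θ) F‖ := Complex.im_le_norm _
      _ ≤ _ := norm_inner_le_norm _ _
      _ ≤ _ := by gcongr
  have hgradi : ∀ i, a * ‖schwartzToL2 X (∂_{stdOrthonormalBasis ℝ X i} θ)‖ ≤ P := by
    intro i
    set y := ‖schwartzToL2 X (∂_{stdOrthonormalBasis ℝ X i} θ)‖ with hy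
    have h1 : y ^ 2 ≤ S := Finset.single_le_sum (f := fun i =>
      ‖schwartzToL2 X (∂_{stdOrthonormalBasis ℝ X i} θ)‖ ^ 2) (fun i _ => by positivity)
      (Finset.mem_univ i)
    have h2 : (a * y) ^ 2 ≤ P - 1 := by
      calc (a * y) ^ 2 = a * (a * y ^ 2) := by ring
        _ ≤ a * (a * S) := by gcongr
        _ ≤ a * (K / r * K) := by gcongr
        _ = P - 1 := by rw [hP]; ring
    nlinarith
  -- `E` is the commutator `Δ(χ θ) - χ Δθ`, so applying `r - i a Δ - V` to `w = χ θ` gives `χ F - i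
  -- a E`.
  let E₀ := mulSchwartz (Δ χ) θ
  let E₁ := fun i => mulSchwartz (∂_{stdOrthonormalBasis ℝ X i} χ) (∂_{stdOrthonormalBasis ℝ X i} θ)
  let E : 𝓢(X, ℂ) := (2 : ℂ) • (∑ i, E₁ i) + E₀
  have hE : a * ‖schwartzToL2 X E‖ ≤ C / R * Q := by
    have h1 : ‖schwartzToL2 X E‖ ≤ 2 * ∑ i, ‖schwartzToL2 X (E₁ i)‖ + ‖schwartzToL2 X E₀‖ := by
      simp only [E, map_add, map_smul, map_sum]
      refine (norm_add_le _ _).trans ?_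
      rw [norm_smul, Complex.norm_ofNat]
      gcongr
      exact norm_sum_le _ _
    have h2 : ∀ i, a * ‖schwartzToL2 X (E₁ i)‖ ≤ C / R * P := fun i =>
      calc _ ≤ a * (C / R * ‖schwartzToL2 X (∂_{stdOrthonormalBasis ℝ X i} θ)‖) := by
            gcongr; exact norm_mulSchwartz_le (hχ.deriv i) _
        _ = C / R * (a * ‖schwartzToL2 X (∂_{stdOrthonormalBasis ℝ X i} θ)‖) := by ring
        _ ≤ _ := by gcongr; exact hgradi i
    have h3 : ‖schwartzToL2 X E₀‖ ≤ C / R * (K / r) :=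
      (norm_mulSchwartz_le hχ.laplacian _).trans (by gcongr)
    have h4 : ∑ i, a * ‖schwartzToL2 X (E₁ i)‖ ≤ Module.finrank ℝ X * (C / R * P) := by
      refine (Finset.sum_le_sum fun i _ => h2 i).trans ?_
      simp
    calc _ ≤ a * (2 * ∑ i, ‖schwartzToL2 X (E₁ i)‖ + ‖schwartzToL2 X E₀‖) := by gcongr
      _ = 2 * ∑ i, a * ‖schwartzToL2 X (E₁ i)‖ + a * ‖schwartzToL2 X E₀‖ := by
        rw [← Finset.mul_sum]; ring
      _ ≤ 2 * (Module.finrank ℝ X * (C / R * P)) + a * (C / R * (K / r)) := by gcongr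
      _ = _ := by rw [hQ]; ring
  refine ⟨mulSchwartz χ θ, hχ.compact.mul_right, Bχ F - (Complex.I * a) • schwartzToL2 X E, ?_, ?_⟩
  · filter_upwards [Lp.coeFn_sub (Bχ F) ((Complex.I * a) • schwartzToL2 X E), hBχ F,
      Lp.coeFn_smul (Complex.I * a : ℂ) (schwartzToL2 X E), E.coeFn_toLp 2 volume,
      hB (schwartzToL2 X θ), θ.coeFn_toLp 2 volume, (Δ θ).coeFn_toLp 2 volume,
      Lp.coeFn_sub ((r : ℂ) • schwartzToL2 X θ) (schwartzKinetic X a θ + B (schwartzToL2 X θ)),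
      Lp.coeFn_add (schwartzKinetic X a θ) (B (schwartzToL2 X θ)),
      Lp.coeFn_smul (r : ℂ) (schwartzToL2 X θ),
      Lp.coeFn_smul (Complex.I * a : ℂ) ((Δ θ).toLp 2 (volume : Measure X))]
      with x h1 h2 h3 h4 h5 h6 h7 h8 h9 h10 h11
    rw [h1, Pi.sub_apply, h2, h3, Pi.smul_apply, schwartzToL2_apply, h4, hFeq, h8, Pi.sub_apply,
      h10, Pi.smul_apply, h9, Pi.add_apply, h5, schwartzKinetic_apply, h11, Pi.smul_apply,
      h7, schwartzToL2_apply, h6, laplacian_mulSchwartz, mulSchwartz_apply]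
    have hx : χ x * χ' x = χ x := by
      rcases eq_or_ne (χ x) 0 with h0 | h0
      · rw [h0, zero_mul]
      · rw [hχ'.eq_one x (hχ.support x h0), mul_one]
    have hEx : E x = 2 * (∑ i, (∂_{stdOrthonormalBasis ℝ X i} χ) x *
        (∂_{stdOrthonormalBasis ℝ X i} θ) x) + (Δ χ) x * θ x := by
      simp only [E, E₁, E₀, add_apply, smul_apply, sum_apply, mulSchwartz_apply, smul_eq_mul]
    rw [hEx]
    simp only [smul_eq_mul]
    linear_combination (-(V x * θ x)) * hx
  · have h1 : Bχ f₀ = f₀ := by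
      refine Lp.ext ?_
      filter_upwards [hBχ f₀, φ.coeFn_toLp 2 volume] with x h1 h2
      rw [h1, hf₀, schwartzToL2_apply, h2]
      rcases eq_or_ne (φ x) 0 with h0 | h0
      · rw [h0, mul_zero]
      · rw [hχ.eq_one x ((hρ x (subset_tsupport _ h0)).trans hRρ), one_mul]
    have h2 : Bχ F - (Complex.I * a) • schwartzToL2 X E - f =
        (Bχ (F - f₀) - (Complex.I * a) • schwartzToL2 X E) + (f₀ - f) := by
      rw [map_sub, h1]; abel
    rw [h2]
    have h3 : ‖Bχ (F - f₀)‖ ≤ ‖F - f₀‖ := by simpa using hBχn (F - f₀)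
    have h4 : ‖(Complex.I * a) • schwartzToL2 X E‖ = a * ‖schwartzToL2 X E‖ := by
      rw [norm_smul, norm_mul, Complex.norm_I, Complex.norm_real, Real.norm_of_nonneg ha, one_mul]
    have h5 := norm_add_le (Bχ (F - f₀) - (Complex.I * a) • schwartzToL2 X E) (f₀ - f)
    have h6 := norm_sub_le (Bχ (F - f₀)) ((Complex.I * a) • schwartzToL2 X E)
    have h7 := hF.trans_le (min_le_right _ _)
    linarith

end Cutoff

end BeamWave

namespace BeamWave

section WeakGraph

/-! ### The bilinear pairing of `L²` -/

section Pairing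

variable {α : Type*} [MeasurableSpace α] {μ : Measure α}

theorem integrable_mul_of_memLp (f : Lp ℂ 2 μ) {h : α → ℂ} (hh : MemLp h 2 μ) :
    Integrable (fun x => f x * h x) μ :=
  MemLp.integrable_mul (Lp.memLp f) hh

/-- The equations are tested with the bilinear pairing, for which `i a Δ + V` is its own transpose.
Conjugating one argument makes the Hilbert space tools available for it. -/
theorem inner_star_eq_integral_mul (f : Lp ℂ 2 μ) {h : α → ℂ} (hh : MemLp h 2 μ) :
    inner ℂ (star hh.toLp) f = ∫ x, f x * h x ∂μ := by
  rw [L2.inner_def]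
  refine integral_congr_ae ?_
  filter_upwards [Lp.coeFn_star hh.toLp, hh.coeFn_toLp] with x h1 h2
  rw [h1, RCLike.inner_apply, Pi.star_apply, h2]
  simp

theorem continuous_integral_mul {h : α → ℂ} (hh : MemLp h 2 μ) :
    Continuous fun f : Lp ℂ 2 μ => ∫ x, f x * h x ∂μ := by
  simp only [← inner_star_eq_integral_mul _ hh]
  fun_prop

theorem integral_add_mul (f g : Lp ℂ 2 μ) {h : α → ℂ} (hh : MemLp h 2 μ) :
    ∫ x, (f + g) x * h x ∂μ = (∫ x, f x * h x ∂μ) + ∫ x, g x * h x ∂μ := by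
  simp only [← inner_star_eq_integral_mul _ hh, inner_add_right]

theorem integral_sub_mul (f g : Lp ℂ 2 μ) {h : α → ℂ} (hh : MemLp h 2 μ) :
    ∫ x, (f - g) x * h x ∂μ = (∫ x, f x * h x ∂μ) - ∫ x, g x * h x ∂μ := by
  simp only [← inner_star_eq_integral_mul _ hh, inner_sub_right]

theorem integral_smul_mul (c : ℂ) (f : Lp ℂ 2 μ) {h : α → ℂ} (hh : MemLp h 2 μ) :
    ∫ x, (c • f) x * h x ∂μ = c * ∫ x, f x * h x ∂μ := by
  simp only [← inner_star_eq_integral_mul _ hh, inner_smul_right]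

end Pairing

variable {X : Type*} [NormedAddCommGroup X] [InnerProductSpace ℝ X] [FiniteDimensional ℝ X]

/-! ### The operator `i a Δ + V` on test functions and its weak extension -/

/-- `i a Δ φ + V φ`. -/
noncomputable def testOp (a : ℝ) (V : X → ℂ) (φ : 𝓢(X, ℂ)) (x : X) : ℂ :=
  Complex.I * a * (Δ φ) x + V x * φ x

theorem testOp_sub (a : ℝ) (V : X → ℂ) (φ ψ : 𝓢(X, ℂ)) (x : X) :
    testOp a V (φ - ψ) x = testOp a V φ x - testOp a V ψ x := by
  have : Δ (φ - ψ) = Δ φ - Δ ψ := by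
    simp only [← SchwartzMap.laplacianCLM_eq', map_sub]
  simp only [testOp, this, _root_.sub_apply]
  ring

variable [MeasurableSpace X] [BorelSpace X]

theorem memLp_mul_schwartz {V : X → ℂ} (hV : Continuous V) {φ : 𝓢(X, ℂ)}
    (hφ : HasCompactSupport φ) : MemLp (fun x => V x * φ x) 2 (volume : Measure X) :=
  (hV.mul φ.continuous).memLp_of_hasCompactSupport hφ.mul_left

theorem memLp_testOp (a : ℝ) {V : X → ℂ} (hV : Continuous V) {φ : 𝓢(X, ℂ)}
    (hφ : HasCompactSupport φ) : MemLp (testOp a V φ) 2 (volume : Measure X) :=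
  (((Δ φ).memLp 2 volume).const_mul (Complex.I * a)).add (memLp_mul_schwartz hV hφ)

/-- The graph of `i a Δ + V` on `L²` in the sense of distributions. -/
def weakGraph (a : ℝ) (V : X → ℂ) (hV : Continuous V) :
    Submodule ℂ (Lp ℂ 2 (volume : Measure X) × Lp ℂ 2 (volume : Measure X)) where
  carrier := {q | ∀ φ : 𝓢(X, ℂ), HasCompactSupport φ →
    ∫ x, q.2 x * φ x = ∫ x, q.1 x * testOp a V φ x}
  add_mem' {p q} hp hq φ hφ := by
    rw [Prod.snd_add, Prod.fst_add, integral_add_mul _ _ (φ.memLp 2 volume),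
      integral_add_mul _ _ (memLp_testOp a hV hφ), hp φ hφ, hq φ hφ]
  zero_mem' φ hφ := by
    have h1 := integral_smul_mul 0 (0 : Lp ℂ 2 (volume : Measure X)) (φ.memLp 2 volume)
    have h2 := integral_smul_mul 0 (0 : Lp ℂ 2 (volume : Measure X)) (memLp_testOp a hV hφ)
    rw [smul_zero, zero_mul] at h1 h2
    rw [Prod.snd_zero, Prod.fst_zero, h1, h2]
  smul_mem' c q hq φ hφ := by
    rw [Prod.smul_snd, Prod.smul_fst, integral_smul_mul _ _ (φ.memLp 2 volume),
      integral_smul_mul _ _ (memLp_testOp a hV hφ), hq φ hφ]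

/-- The graph of `i a Δ + V` on compactly supported smooth functions. -/
def testGraph (a : ℝ) (V : X → ℂ) :
    Set (Lp ℂ 2 (volume : Measure X) × Lp ℂ 2 (volume : Measure X)) :=
  {q | ∃ φ : 𝓢(X, ℂ), HasCompactSupport φ ∧ q.1 = schwartzToL2 X φ ∧ q.2 =ᵐ[volume] testOp a V φ}

variable {a : ℝ} {V : X → ℂ}

theorem isClosed_weakGraph (hV : Continuous V) :
    IsClosed (SetLike.coe (weakGraph a V hV)) := by
  have : (weakGraph a V hV : Set (Lp ℂ 2 (volume : Measure X) × Lp ℂ 2 volume)) =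
      ⋂ (φ : 𝓢(X, ℂ)) (_ : HasCompactSupport φ),
        {q | ∫ x, q.2 x * φ x = ∫ x, q.1 x * testOp a V φ x} := by
    ext q
    simp only [mem_iInter]
    rfl
  rw [this]
  refine isClosed_iInter fun φ => isClosed_iInter fun hφ => isClosed_eq ?_ ?_
  · exact (continuous_integral_mul (φ.memLp 2 volume)).comp continuous_snd
  · exact (continuous_integral_mul (memLp_testOp a hV hφ)).comp continuous_fst

/-- Integration by parts: without conjugation, the factor `i` does not spoil the symmetry of `i a Δ
+ V`. -/
theorem testGraph_subset_weakGraph (hV : Continuous V) :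
    testGraph a V ⊆ (weakGraph a V hV : Set (Lp ℂ 2 (volume : Measure X) × Lp ℂ 2 volume)) := by
  rintro q ⟨φ, hφ, h1, h2⟩ ψ hψ
  have e1 : ∫ x, q.2 x * ψ x = ∫ x, (Complex.I * a * ((Δ φ) x * ψ x) + V x * φ x * ψ x) := by
    refine integral_congr_ae ?_
    filter_upwards [h2] with x hx
    rw [hx, testOp]; ring
  have e2 : ∫ x, q.1 x * testOp a V ψ x =
      ∫ x, (Complex.I * a * (φ x * (Δ ψ) x) + V x * φ x * ψ x) := by
    refine integral_congr_ae ?_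
    filter_upwards [φ.coeFn_toLp 2 volume] with x hx
    rw [h1, schwartzToL2_apply, hx, testOp]; ring
  have i3 : Integrable (fun x => V x * φ x * ψ x) (volume : Measure X) :=
    MemLp.integrable_mul (memLp_mul_schwartz hV hφ) (ψ.memLp 2 volume)
  have i1 : Integrable (fun x => Complex.I * a * ((Δ φ) x * ψ x)) (volume : Measure X) :=
    (MemLp.integrable_mul ((Δ φ).memLp 2 volume) (ψ.memLp 2 volume)).const_mul _
  have i2 : Integrable (fun x => Complex.I * a * (φ x * (Δ ψ) x)) (volume : Measure X) :=
    (MemLp.integrable_mul (φ.memLp 2 volume) ((Δ ψ).memLp 2 volume)).const_mul _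
  rw [e1, e2, integral_add i1 i3, integral_add i2 i3, integral_const_mul, integral_const_mul,
    SchwartzMap.integral_mul_laplacian_right_eq_left]

theorem sub_mem_testGraph {p q : Lp ℂ 2 (volume : Measure X) × Lp ℂ 2 (volume : Measure X)}
    (hp : p ∈ testGraph a V) (hq : q ∈ testGraph a V) : p - q ∈ testGraph a V := by
  obtain ⟨φ, hφ, h1, h2⟩ := hp
  obtain ⟨ψ, hψ, h3, h4⟩ := hq
  refine ⟨φ - ψ, hφ.sub hψ, ?_, ?_⟩
  · rw [Prod.fst_sub, h1, h3, map_sub]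
  · filter_upwards [h2, h4, Lp.coeFn_sub p.2 q.2] with x h5 h6 h7
    rw [Prod.snd_sub, h7, Pi.sub_apply, h5, h6, testOp_sub]

theorem dissipative_testGraph (hV : Continuous V) (hVre : ∀ x, (V x).re ≤ 0)
    {q : Lp ℂ 2 (volume : Measure X) × Lp ℂ 2 (volume : Measure X)} (hq : q ∈ testGraph a V) :
    (inner ℂ q.1 q.2).re ≤ 0 := by
  obtain ⟨φ, hφ, h1, h2⟩ := hq
  have hm := memLp_mul_schwartz hV hφ
  have e : q.2 = schwartzKinetic X a φ + hm.toLp := by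
    refine Lp.ext ?_
    filter_upwards [h2, Lp.coeFn_add (schwartzKinetic X a φ) hm.toLp, hm.coeFn_toLp,
      (Δ φ).coeFn_toLp 2 volume,
      Lp.coeFn_smul (Complex.I * a : ℂ) ((Δ φ).toLp 2 (volume : Measure X))] with x h3 h4 h5 h6 h7
    rw [h3, h4, Pi.add_apply, h5, schwartzKinetic_apply, h7, Pi.smul_apply, h6, testOp, smul_eq_mul]
  rw [e, h1, inner_add_right, inner_schwartzKinetic, Complex.add_re, Complex.neg_re,
    Complex.I_mul_re, Complex.ofReal_im, neg_zero, neg_zero, zero_add]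
  refine re_inner_mul_nonpos hVre ?_
  filter_upwards [hm.coeFn_toLp, φ.coeFn_toLp 2 volume] with x h3 h4
  rw [h3, schwartzToL2_apply, h4]

theorem dissipative_closure_testGraph (hV : Continuous V) (hVre : ∀ x, (V x).re ≤ 0)
    {q : Lp ℂ 2 (volume : Measure X) × Lp ℂ 2 (volume : Measure X)}
    (hq : q ∈ closure (testGraph a V)) : (inner ℂ q.1 q.2).re ≤ 0 := by
  have hc : IsClosed {q : Lp ℂ 2 (volume : Measure X) × Lp ℂ 2 (volume : Measure X) |
      (inner ℂ q.1 q.2).re ≤ 0} :=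
    isClosed_le (Complex.continuous_re.comp (continuous_fst.inner continuous_snd)) continuous_const
  exact closure_minimal (fun p hp => dissipative_testGraph hV hVre hp) hc hq

theorem exists_testGraph_near (ha : 0 ≤ a) (hV : Continuous V) (hVim : ∀ x, (V x).im = 0)
    (hVre : ∀ x, (V x).re ≤ 0) {r : ℝ} (hr : 0 < r) (f : Lp ℂ 2 (volume : Measure X)) {ε : ℝ}
    (hε : 0 < ε) : ∃ q ∈ testGraph a V, ‖(r : ℂ) • q.1 - q.2 - f‖ < ε := by
  obtain ⟨w, hw, G, hG, hGf⟩ := exists_test_near ha hr hV hVim hVre f hε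
  have hm := memLp_testOp a hV hw
  refine ⟨(schwartzToL2 X w, hm.toLp), ⟨w, hw, rfl, hm.coeFn_toLp⟩, ?_⟩
  have : (r : ℂ) • schwartzToL2 X w - hm.toLp = G := by
    refine Lp.ext ?_
    filter_upwards [hG, Lp.coeFn_sub ((r : ℂ) • schwartzToL2 X w) hm.toLp, hm.coeFn_toLp,
      Lp.coeFn_smul (r : ℂ) (schwartzToL2 X w), w.coeFn_toLp 2 volume] with x h1 h2 h3 h4 h5
    rw [h1, h2, Pi.sub_apply, h3, h4, Pi.smul_apply, schwartzToL2_apply, h5, testOp, smul_eq_mul]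
  rwa [this]

/-- The hypothesis says that `star w` is orthogonal to `r - (i a Δ + V)` applied to test functions.
That range is dense, and an element closer to `star w` than `‖star w‖` already contradicts `w ≠ 0`.
-/
theorem eq_zero_of_mem_weakGraph (ha : 0 ≤ a) (hV : Continuous V) (hVim : ∀ x, (V x).im = 0)
    (hVre : ∀ x, (V x).re ≤ 0) {r : ℝ} (hr : 0 < r) {w : Lp ℂ 2 (volume : Measure X)}
    (hw : (w, (r : ℂ) • w) ∈ weakGraph a V hV) : w = 0 := by
  by_contra hne
  have hpos : 0 < ‖star w‖ := norm_pos_iff.2 fun h0 => hne <| Lp.ext <| by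
    filter_upwards [Lp.coeFn_star w, Lp.coeFn_zero ℂ 2 (volume : Measure X)] with x h1 h2
    rw [h0, h2, Pi.star_apply] at h1
    rw [h2]
    simpa using h1.symm
  obtain ⟨q, ⟨φ, hφ, h1, h2⟩, hq⟩ := exists_testGraph_near ha hV hVim hVre hr (star w) hpos
  have h3 := hw φ hφ
  simp only at h3
  rw [integral_smul_mul _ _ (φ.memLp 2 volume)] at h3
  have hsw : ∀ g : Lp ℂ 2 (volume : Measure X), inner ℂ (star w) g = ∫ x, w x * g x := fun g => by
    rw [L2.inner_def]
    refine integral_congr_ae ?_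
    filter_upwards [Lp.coeFn_star w] with x hx
    rw [hx, RCLike.inner_apply, Pi.star_apply]
    simp [mul_comm]
  have h4 : inner ℂ (star w) ((r : ℂ) • q.1 - q.2) = 0 := by
    rw [inner_sub_right, inner_smul_right, hsw, hsw, sub_eq_zero]
    have e1 : ∫ x, w x * q.1 x = ∫ x, w x * φ x := by
      refine integral_congr_ae ?_
      filter_upwards [φ.coeFn_toLp 2 volume] with x hx
      rw [h1, schwartzToL2_apply, hx]
    have e2 : ∫ x, w x * q.2 x = ∫ x, w x * testOp a V φ x := by
      refine integral_congr_ae ?_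
      filter_upwards [h2] with x hx
      rw [hx]
    rw [e1, e2, h3]
  have h5 : inner ℂ (star w) (star w - ((r : ℂ) • q.1 - q.2)) = ((‖star w‖ ^ 2 : ℝ) : ℂ) := by
    rw [inner_sub_right, h4, sub_zero, inner_self_eq_norm_sq_to_K]
    simp
  have h6 := norm_inner_le_norm (𝕜 := ℂ) (star w) (star w - ((r : ℂ) • q.1 - q.2))
  rw [h5, Complex.norm_real, Real.norm_of_nonneg (by positivity), norm_sub_rev] at h6
  nlinarith

/-- Approximate solutions are Cauchy by the dissipative lower bound, so the dense range becomes the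
whole space once the graph is closed. -/
theorem exists_closure_testGraph (ha : 0 ≤ a) (hV : Continuous V) (hVim : ∀ x, (V x).im = 0)
    (hVre : ∀ x, (V x).re ≤ 0) {r : ℝ} (hr : 0 < r) (h : Lp ℂ 2 (volume : Measure X)) :
    ∃ q ∈ closure (testGraph a V), (r : ℂ) • q.1 - q.2 = h := by
  choose q hq hqn using fun m : ℕ => exists_testGraph_near ha hV hVim hVre hr h
    (ε := 1 / ((m : ℝ) + 1)) (by positivity)
  have hlim : Tendsto (fun m => (r : ℂ) • (q m).1 - (q m).2) atTop (𝓝 h) := by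
    rw [tendsto_iff_norm_sub_tendsto_zero]
    exact squeeze_zero (fun _ => norm_nonneg _) (fun m => (hqn m).le)
      tendsto_one_div_add_atTop_nhds_zero_nat
  have hcau : CauchySeq fun m => (q m).1 := by
    have h1 := hlim.cauchySeq
    rw [Metric.cauchySeq_iff] at h1 ⊢
    intro ε hε
    obtain ⟨N, hN⟩ := h1 (r * ε) (by positivity)
    refine ⟨N, fun m hm l hl => ?_⟩
    have h2 := hN m hm l hl
    have h3 := mul_norm_le_of_dissipative
      (dissipative_testGraph hV hVre (sub_mem_testGraph (hq m) (hq l))) r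
    rw [dist_eq_norm] at h2 ⊢
    rw [Prod.fst_sub, Prod.snd_sub, smul_sub, sub_sub_sub_comm] at h3
    exact lt_of_mul_lt_mul_left (h3.trans_lt h2) hr.le
  obtain ⟨u, hu⟩ := cauchySeq_tendsto_of_complete hcau
  have hu2 : Tendsto (fun m => (q m).2) atTop (𝓝 ((r : ℂ) • u - h)) := by
    have := (hu.const_smul (r : ℂ)).sub hlim
    simpa using this
  refine ⟨(u, (r : ℂ) • u - h), ?_, by simp⟩
  exact mem_closure_of_tendsto (hu.prodMk_nhds hu2) (Eventually.of_forall hq)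

/-- An element of the weak graph is compared with an element of the closure having the same image
under `1 - A`. Their difference is a weak eigenvector for the eigenvalue `1`, hence zero. -/
theorem weakGraph_eq_closure (ha : 0 ≤ a) (hV : Continuous V) (hVim : ∀ x, (V x).im = 0)
    (hVre : ∀ x, (V x).re ≤ 0) :
    (weakGraph a V hV : Set (Lp ℂ 2 (volume : Measure X) × Lp ℂ 2 volume)) =
      closure (testGraph a V) := by
  have hsub : closure (testGraph a V) ⊆
      (weakGraph a V hV : Set (Lp ℂ 2 (volume : Measure X) × Lp ℂ 2 volume)) :=
    closure_minimal (testGraph_subset_weakGraph hV) (isClosed_weakGraph hV)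
  refine Subset.antisymm (fun q hq => ?_) hsub
  obtain ⟨p, hp, hpq⟩ := exists_closure_testGraph ha hV hVim hVre one_pos (q.1 - q.2)
  simp only [Complex.ofReal_one, one_smul] at hpq
  have h1 := (weakGraph a V hV).sub_mem hq (hsub hp)
  have h2 : (q - p).2 = (q - p).1 := by
    rw [Prod.fst_sub, Prod.snd_sub]
    rw [← sub_eq_zero] at hpq ⊢
    rw [← hpq]; abel
  have h3 : (q - p).1 = 0 := eq_zero_of_mem_weakGraph ha hV hVim hVre one_pos (by
    have e : ((q - p).1, (q - p).1) = q - p := Prod.ext rfl h2.symm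
    rwa [Complex.ofReal_one, one_smul, e])
  have h4 : q - p = 0 := Prod.ext h3 (h2.trans h3)
  rw [sub_eq_zero.1 h4]
  exact hp

/-- Dissipativity is not visible in the distributional definition; it is inherited from test
functions through the closure. -/
theorem isMDissipative_weakGraph (ha : 0 ≤ a) (hV : Continuous V) (hVim : ∀ x, (V x).im = 0)
    (hVre : ∀ x, (V x).re ≤ 0) :
    IsMDissipative (weakGraph a V hV : Submodule ℂ (Lp ℂ 2 (volume : Measure X) × _)) := by
  have heq := weakGraph_eq_closure ha hV hVim hVre
  have hmem : ∀ q, q ∈ weakGraph a V hV ↔ q ∈ closure (testGraph a V) := fun q => by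
    rw [← heq]; rfl
  refine ⟨fun q hq => dissipative_closure_testGraph hV hVre ((hmem q).1 hq), fun r hr h => ?_, ?_⟩
  · obtain ⟨q, hq, h1⟩ := exists_closure_testGraph ha hV hVim hVre hr h
    exact ⟨q, (hmem q).2 hq, h1⟩
  · rw [Metric.dense_iff]
    intro f ε hε
    obtain ⟨φ, hφ, h⟩ := exists_schwartz_near f hε
    have hm := memLp_testOp a hV hφ
    refine ⟨schwartzToL2 X φ, by rwa [Metric.mem_ball, dist_eq_norm],
      (schwartzToL2 X φ, hm.toLp), testGraph_subset_weakGraph hV ⟨φ, hφ, rfl, hm.coeFn_toLp⟩, rfl⟩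

end WeakGraph

end BeamWave

namespace BeamWave

section Evolution

variable {E : Type*} [NormedAddCommGroup E] [NormedSpace ℂ E]

/-! ### Evolution equations -/

theorem continuous_integral_apply {E' : Type*} [NormedAddCommGroup E'] [NormedSpace ℂ E']
    {U : ℝ → E →L[ℂ] E'} {C z : ℝ} (hz : 0 ≤ z)
    (hU : ∀ s ∈ Icc 0 z, ‖U s‖ ≤ C) (hc : ∀ f, ContinuousOn (fun s => U s f) (Icc 0 z)) :
    Continuous fun f => ∫ s in (0 : ℝ)..z, U s f := by
  refine (LipschitzWith.of_dist_le' (K := C * |z - 0|) fun f g => ?_).continuous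
  have hI : ∀ f, IntervalIntegrable (fun s => U s f) volume 0 z := fun f =>
    ContinuousOn.intervalIntegrable (by rw [uIcc_of_le hz]; exact hc f)
  rw [dist_eq_norm, dist_eq_norm, ← intervalIntegral.integral_sub (hI f) (hI g), mul_right_comm]
  refine intervalIntegral.norm_integral_le_of_norm_le_const fun s hs => ?_
  rw [uIoc_of_le hz] at hs
  rw [← map_sub]
  exact (U s).le_of_opNorm_le (hU s ⟨hs.1.le, hs.2⟩) _

theorem IsC0Semigroup.continuousOn_sub_apply [CompleteSpace E] {T : ℝ → E →L[ℂ] E}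
    (hT : IsC0Semigroup T) {z : ℝ} {φ : ℝ → E} (hφ : ContinuousOn φ (Icc 0 z)) :
    ContinuousOn (fun s => T (z - s) (φ s)) (Icc 0 z) := fun s hs => by
  refine hT.tendsto_apply (sub_nonneg.2 hs.2) ?_ ?_ (hφ s hs)
  · have : Continuous fun s : ℝ => z - s := by fun_prop
    exact (this.tendsto s).mono_left nhdsWithin_le_nhds
  · filter_upwards [self_mem_nhdsWithin] with u hu using sub_nonneg.2 hu.2

theorem tendsto_functional_apply {ι : Type*} {l : Filter ι} {Φ : ι → E →L[ℂ] ℂ} {Φ₀ : E →L[ℂ] ℂ}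
    {C : ℝ} (hC : ∀ᶠ i in l, ‖Φ i‖ ≤ C) (hΦ : ∀ f, Tendsto (fun i => Φ i f) l (𝓝 (Φ₀ f)))
    {ψ : ι → E} {ψ₀ : E} (hψ : Tendsto ψ l (𝓝 ψ₀)) :
    Tendsto (fun i => Φ i (ψ i)) l (𝓝 (Φ₀ ψ₀)) := by
  have h : Tendsto (fun i => Φ i (ψ i - ψ₀)) l (𝓝 0) := by
    refine squeeze_zero_norm' (a := fun i => C * ‖ψ i - ψ₀‖) ?_ ?_
    · filter_upwards [hC] with i hi using (Φ i).le_of_opNorm_le hi _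
    · simpa using (tendsto_iff_norm_sub_tendsto_zero.1 hψ).const_mul C
  simpa using h.add (hΦ ψ₀)

/-- Functionals `Φ z` that solve the equation dual to that of the semigroup `T` are
`Φ z = Φ 0 ∘ T z`. -/
theorem functional_eq_of_weak [CompleteSpace E] {T : ℝ → E →L[ℂ] E}
    (hT : IsC0Semigroup T) (hdense : Dense (Prod.fst '' generatorGraph T)) {Z C : ℝ}
    {Φ : ℝ → E →L[ℂ] ℂ} (hΦ : ∀ f, ContinuousOn (fun s => Φ s f) (Icc 0 Z))
    (hC : ∀ s ∈ Icc 0 Z, ‖Φ s‖ ≤ C)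
    (heq : ∀ q ∈ generatorGraph T, ∀ z ∈ Icc 0 Z,
      Φ z q.1 - Φ 0 q.1 = ∫ s in (0 : ℝ)..z, Φ s q.2) {z : ℝ} (hz : z ∈ Icc 0 Z) (f : E) :
    Φ z f = Φ 0 (T z f) := by
  have key : (Φ z : E → ℂ) = (Φ 0 ∘L T z : E →L[ℂ] ℂ) := by
    refine (Φ z).continuous.ext_on hdense (Φ 0 ∘L T z).continuous ?_
    rintro _ ⟨q, hq, rfl⟩
    have hcontT : ContinuousOn (fun s => T (z - s) q.1) (Icc 0 z) :=
      hT.continuousOn_sub_apply continuousOn_const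
    have hsub : Icc 0 z ⊆ Icc 0 Z := Icc_subset_Icc_right hz.2
    -- The function `s ↦ Φ s (T (z - s) q.1)` is constant: its right derivative is the one from `Φ`,
    -- given by the dual equation at the generator element over `T (z - s) q.1`, minus the one from
    -- `T`, and these cancel.
    have h := intervalIntegral.integral_eq_sub_of_hasDeriv_right (a := 0) (b := z)
      (f := fun s => Φ s (T (z - s) q.1)) (f' := fun _ => 0) ?_ ?_ (by simp)
    · simp only [intervalIntegral.integral_zero, sub_self, sub_zero, hT.zero,
        one_apply_eq_self] at h
      rw [ContinuousLinearMap.comp_apply]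
      exact sub_eq_zero.1 h.symm
    · rw [uIcc_of_le hz.1]
      intro s hs
      refine tendsto_functional_apply (C := C) ?_ (fun f => ((hΦ f).mono hsub) s hs) (hcontT s hs)
      filter_upwards [self_mem_nhdsWithin] with u hu using hC u (hsub hu)
    · intro s hs
      rw [min_eq_left hz.1, max_eq_right hz.1] at hs
      have hsz : 0 ≤ z - s := sub_nonneg.2 hs.2.le
      have hIcc : Icc 0 Z ∈ 𝓝 s := Icc_mem_nhds hs.1 (hs.2.trans_le hz.2)
      have hp := hT.apply_mem_generatorGraph hq hsz
      have hΦs : ∀ f, Tendsto (fun u => Φ u f) (𝓝[>] s) (𝓝 (Φ s f)) := fun f =>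
        (((hΦ f).continuousAt hIcc).tendsto).mono_left nhdsWithin_le_nhds
      have h1 : HasDerivWithinAt (fun u => Φ u (T (z - s) q.1)) (Φ s (T (z - s) q.2))
          (Ioi s) s := by
        have h2 : HasDerivAt (fun u => ∫ r in (0 : ℝ)..u, Φ r (T (z - s) q.2))
            (Φ s (T (z - s) q.2)) s := by
          refine intervalIntegral.integral_hasDerivAt_right ?_ ?_ ((hΦ _).continuousAt hIcc)
          · refine ContinuousOn.intervalIntegrable ((hΦ _).mono ?_)
            rw [uIcc_of_le hs.1.le]
            exact Icc_subset_Icc_right (hs.2.le.trans hz.2)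
          · exact ((hΦ _).mono Ioo_subset_Icc_self).stronglyMeasurableAtFilter isOpen_Ioo s
              ⟨hs.1, hs.2.trans_le hz.2⟩
        refine ((h2.add_const (Φ 0 (T (z - s) q.1))).congr_of_eventuallyEq ?_).hasDerivWithinAt
        filter_upwards [hIcc] with u hu
        have := heq _ hp u hu
        simp only at this
        rw [← this, sub_add_cancel]
      rw [hasDerivWithinAt_iff_tendsto_slope' (by simp)] at h1 ⊢
      have h3 : Tendsto (fun u => T (z - u) ((((u - s)⁻¹ : ℝ) : ℂ) • (T (u - s) q.1 - q.1)))
          (𝓝[>] s) (𝓝 (T (z - s) q.2)) := by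
        refine hT.tendsto_apply hsz ?_ ?_ (Tendsto.comp hq (tendsto_sub_nhdsGT s))
        · have : Continuous fun s : ℝ => z - s := by fun_prop
          exact (this.tendsto s).mono_left nhdsWithin_le_nhds
        · filter_upwards [Ioo_mem_nhdsGT hs.2] with u hu using sub_nonneg.2 hu.2.le
      have h4 := tendsto_functional_apply (C := C) (l := 𝓝[>] s) (Φ := Φ) (Φ₀ := Φ s) (by
        filter_upwards [nhdsWithin_le_nhds hIcc] with u hu using hC u hu) hΦs h3
      have h5 := h1.sub h4
      rw [sub_self] at h5
      refine h5.congr' ?_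
      filter_upwards [Ioo_mem_nhdsGT hs.2] with u hu
      have h6 : T (z - s) q.1 = T (z - u) (T (u - s) q.1) := by
        rw [← mul_apply_eq_comp (T (z - u)), ← hT.add _ _ (sub_nonneg.2 hu.2.le)
          (sub_nonneg.2 hu.1.le), sub_add_sub_cancel]
      rw [slope_def_module, slope_def_module, map_smul, map_smul, map_sub (T (z - u)), ← h6,
        map_sub, Complex.coe_smul, ← smul_sub]
      congr 1
      abel
  exact congrFun key f

/-- Variation of constants for a bounded perturbation. -/
theorem semigroup_eq_add_integral [CompleteSpace E] {S T : ℝ → E →L[ℂ] E} {B : E →L[ℂ] E}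
    (hS : IsContractionSemigroup S) (hT : IsContractionSemigroup T)
    (hdense : Dense (Prod.fst '' generatorGraph T))
    (hB : ∀ q ∈ generatorGraph T, (q.1, q.2 - B q.1) ∈ generatorGraph S) {z : ℝ} (hz : 0 ≤ z)
    (f : E) : T z f = S z f + ∫ s in (0 : ℝ)..z, S (z - s) (B (T s f)) := by
  have hBT : ∀ f, ContinuousOn (fun s => B (T s f)) (Icc 0 z) := fun f =>
    B.continuous.comp_continuousOn ((hT.cont f).mono Icc_subset_Ici_self)
  have hc : Continuous fun f => ∫ s in (0 : ℝ)..z, S (z - s) (B (T s f)) := by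
    refine continuous_integral_apply (U := fun s => S (z - s) ∘L B ∘L T s) (C := ‖B‖) hz
      (fun s hs => ?_) fun f => hS.continuousOn_sub_apply (hBT f)
    refine ContinuousLinearMap.opNorm_le_bound _ (norm_nonneg _) fun f => ?_
    refine (norm_apply_le_norm (hS.contraction _ (sub_nonneg.2 hs.2)) _).trans ?_
    refine (B.le_opNorm _).trans ?_
    gcongr
    exact norm_apply_le_norm (hT.contraction _ hs.1) _
  have key := Continuous.ext_on hdense (T z).continuous ((S z).continuous.add hc) ?_
  · exact congrFun key f
  rintro _ ⟨q, hq, rfl⟩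
  refine hT.duhamel hS.toIsC0Semigroup hz (g := fun s => T s q.2)
    (fun s hs => hT.apply_mem_generatorGraph hq hs.1)
    (fun s hs => hB _ (hT.apply_mem_generatorGraph hq hs.1)) (hBT q.1)

/-- Gronwall: a continuous solution of the homogeneous Volterra inequality vanishes. -/
theorem eq_zero_of_norm_le_integral {G : Type*} [NormedAddCommGroup G] {D : ℝ → G} {Z b : ℝ} (hZ : 0 ≤ Z) (hb : 0 ≤ b)
    (hD : ContinuousOn D (Icc 0 Z))
    (h : ∀ z ∈ Icc 0 Z, ‖D z‖ ≤ b * ∫ s in (0 : ℝ)..z, ‖D s‖) : ∀ z ∈ Icc 0 Z, D z = 0 := by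
  -- Extending `‖D‖` by constants beyond `[0, Z]` makes its primitive differentiable everywhere.
  -- Gronwall is applied to that primitive, which starts at `0`.
  let d : ℝ → ℝ := IccExtend hZ (fun s : Icc 0 Z => ‖D s‖)
  have hd : Continuous d := Continuous.Icc_extend' (hD.norm.domRestrict)
  have hdeq : ∀ s ∈ Icc 0 Z, d s = ‖D s‖ := fun s hs => IccExtend_of_mem hZ _ hs
  let φ : ℝ → ℝ := fun z => ∫ s in (0 : ℝ)..z, d s
  have hφ' : ∀ z, HasDerivAt φ (d z) z := fun z =>
    intervalIntegral.integral_hasDerivAt_right (hd.intervalIntegrable _ _)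
      hd.stronglyMeasurable.stronglyMeasurableAtFilter hd.continuousAt
  have hφeq : ∀ z ∈ Icc 0 Z, φ z = ∫ s in (0 : ℝ)..z, ‖D s‖ := fun z hz => by
    refine intervalIntegral.integral_congr fun s hs => ?_
    rw [uIcc_of_le hz.1] at hs
    exact hdeq s ⟨hs.1, hs.2.trans hz.2⟩
  have hg := norm_le_gronwallBound_of_norm_deriv_right_le (f := φ) (f' := d) (δ := 0) (K := b)
    (ε := 0) (a := 0) (b := Z) (fun z _ => (hφ' z).continuousAt.continuousWithinAt)
    (fun z _ => (hφ' z).hasDerivWithinAt) (by simp [φ]) (fun z hz => by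
      have hz' : z ∈ Icc 0 Z := ⟨hz.1, hz.2.le⟩
      have h1 := h z hz'
      rw [← hφeq z hz'] at h1
      rw [hdeq z hz', norm_norm, add_zero]
      exact h1.trans (by gcongr; exact Real.le_norm_self _))
  intro z hz
  have h1 := hg z hz
  rw [gronwallBound_ε0_δ0] at h1
  have h2 : φ z = 0 := norm_le_zero_iff.1 h1
  have h3 := h z hz
  rw [← hφeq z hz, h2, mul_zero] at h3
  exact norm_le_zero_iff.1 h3

end Evolution

section Solutions

variable {n : ℕ}

/-- Once every solution is an orbit of a contraction semigroup, stability holds with Lipschitz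
constant `1`. -/
theorem wellPosed_of_eqOn {T : ℝ → L2 n →L[ℂ] L2 n} (hT : IsContractionSemigroup T)
    {Sol : Set ℝ → L2 n → (ℝ → L2 n) → Prop} (hex : ∀ F₀, Sol (Ici 0) F₀ fun z => T z F₀)
    (huniq : ∀ Z, 0 < Z → ∀ F₀ F, Sol (Icc 0 Z) F₀ F → EqOn F (fun z => T z F₀) (Icc 0 Z)) :
    WellPosed Sol where
  exist F₀ := ⟨_, hT.cont F₀, hex F₀⟩
  unique Z hZ F₀ F G hF hG := (huniq Z hZ F₀ F hF).trans (huniq Z hZ F₀ G hG).symm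
  stable Z hZ := ⟨1, fun F₀ G₀ F G hF hG z hz => by
    rw [huniq Z hZ F₀ F hF hz, huniq Z hZ G₀ G hG hz]
    simp only
    rw [← map_sub, one_mul]
    exact norm_apply_le_norm (hT.contraction z hz.1) _⟩

/-! ### Mild solutions -/

section Mild

variable {S T : ℝ → L2 n →L[ℂ] L2 n} {B : L2 n →L[ℂ] L2 n}

theorem IsMildSolution.congr {Z : ℝ} {F₀ : L2 n} {F G : ℝ → L2 n}
    (hF : IsMildSolution S B (Icc 0 Z) F₀ F) (h : EqOn G F (Icc 0 Z)) :
    IsMildSolution S B (Icc 0 Z) F₀ G where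
  cont := hF.cont.congr h
  eqn z hz := by
    rw [h hz, hF.eqn z hz]
    congr 1
    refine intervalIntegral.integral_congr fun s hs => ?_
    rw [uIcc_of_le hz.1] at hs
    exact congrArg (fun f => S (z - s) (B f)) (h ⟨hs.1, hs.2.trans hz.2⟩).symm

theorem IsMildSolution.mono {I J : Set ℝ} {F₀ : L2 n} {F : ℝ → L2 n}
    (hF : IsMildSolution S B I F₀ F) (h : J ⊆ I) : IsMildSolution S B J F₀ F where
  cont := hF.cont.mono h
  eqn z hz := hF.eqn z (h hz)

theorem isMildSolution_semigroup (hS : IsContractionSemigroup S) (hT : IsContractionSemigroup T)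
    (hdense : Dense (Prod.fst '' generatorGraph T))
    (hB : ∀ q ∈ generatorGraph T, (q.1, q.2 - B q.1) ∈ generatorGraph S) (F₀ : L2 n) :
    IsMildSolution S B (Ici 0) F₀ fun z => T z F₀ where
  cont := hT.cont F₀
  eqn z hz := by
    exact semigroup_eq_add_integral hS hT hdense hB hz F₀

theorem IsMildSolution.eqOn (hS : IsContractionSemigroup S) {Z : ℝ} (hZ : 0 ≤ Z) {F₀ : L2 n}
    {F G : ℝ → L2 n} (hF : IsMildSolution S B (Icc 0 Z) F₀ F)
    (hG : IsMildSolution S B (Icc 0 Z) F₀ G) : EqOn F G (Icc 0 Z) := by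
  have h := eq_zero_of_norm_le_integral (D := fun s => F s - G s) hZ (norm_nonneg B)
    (hF.cont.sub hG.cont) fun z hz => by
      have hsub : Icc 0 z ⊆ Icc 0 Z := Icc_subset_Icc_right hz.2
      have hI : ∀ F : ℝ → L2 n, ContinuousOn F (Icc 0 Z) →
          IntervalIntegrable (fun s => S (z - s) (B (F s))) volume 0 z := fun F hF => by
        refine ContinuousOn.intervalIntegrable ?_
        rw [uIcc_of_le hz.1]
        exact hS.continuousOn_sub_apply (B.continuous.comp_continuousOn (hF.mono hsub))
      have hD : ContinuousOn (fun s => ‖F s - G s‖) (Icc 0 z) :=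
        ((hF.cont.sub hG.cont).mono hsub).norm
      rw [hF.eqn z hz, hG.eqn z hz, add_sub_add_left_eq_sub,
        ← intervalIntegral.integral_sub (hI F hF.cont) (hI G hG.cont),
        ← intervalIntegral.integral_const_mul]
      refine intervalIntegral.norm_integral_le_of_norm_le hz.1 (ae_of_all _ fun s hs => ?_) ?_
      · rw [← map_sub, ← map_sub]
        exact (norm_apply_le_norm (hS.contraction _ (sub_nonneg.2 hs.2)) _).trans (B.le_opNorm _)
      · refine ContinuousOn.intervalIntegrable ?_
        rw [uIcc_of_le hz.1]
        exact continuousOn_const.mul hD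
  exact fun z hz => sub_eq_zero.1 (h z hz)

end Mild

end Solutions

end BeamWave

namespace BeamWave

section Graphs

variable {X : Type*} [NormedAddCommGroup X] [InnerProductSpace ℝ X] [FiniteDimensional ℝ X]
  [MeasurableSpace X] [BorelSpace X] {a : ℝ} {V : X → ℂ}

/-! ### Sums of kinetic and potential parts -/

theorem integral_mul_testOp (hV : Continuous V) {φ : 𝓢(X, ℂ)} (hφ : HasCompactSupport φ)
    (f : Lp ℂ 2 (volume : Measure X)) :
    ∫ x, f x * testOp a V φ x =
      (∫ x, f x * testOp a (fun _ => 0) φ x) + ∫ x, f x * testOp 0 V φ x := by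
  rw [← integral_add (integrable_mul_of_memLp f (memLp_testOp a continuous_const hφ))
    (integrable_mul_of_memLp f (memLp_testOp 0 hV hφ))]
  congr 1 with x
  simp only [testOp, Complex.ofReal_zero]
  ring

theorem sumGraph_subset_weakGraph (hV : Continuous V) :
    sumGraph (SetLike.coe (weakGraph a (fun _ : X => 0) continuous_const))
      (SetLike.coe (weakGraph 0 V hV)) ⊆ SetLike.coe (weakGraph a V hV) := by
  rintro q ⟨g₁, g₂, h1, h2, h3⟩ φ hφ
  rw [h3, integral_add_mul _ _ (φ.memLp 2 volume), integral_mul_testOp hV hφ, ← h1 φ hφ, ← h2 φ hφ]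

theorem testGraph_subset_sumGraph (hV : Continuous V) :
    testGraph a V ⊆ sumGraph (SetLike.coe (weakGraph a (fun _ : X => 0) continuous_const))
      (SetLike.coe (weakGraph 0 V hV)) := by
  rintro q ⟨φ, hφ, h1, h2⟩
  have m1 : MemLp (testOp a (fun _ => 0) φ) 2 (volume : Measure X) :=
    memLp_testOp a continuous_const hφ
  have m2 := memLp_testOp 0 hV hφ
  refine ⟨m1.toLp, m2.toLp, testGraph_subset_weakGraph _ ⟨φ, hφ, h1, m1.coeFn_toLp⟩,
    testGraph_subset_weakGraph _ ⟨φ, hφ, h1, m2.coeFn_toLp⟩, ?_⟩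
  refine Lp.ext ?_
  filter_upwards [h2, m1.coeFn_toLp, m2.coeFn_toLp, Lp.coeFn_add m1.toLp m2.toLp] with x h3 h4 h5 h6
  rw [h3, h6, Pi.add_apply, h4, h5]
  simp only [testOp, Complex.ofReal_zero]
  ring

/-- The sum lies between the graph on test functions and the closed weak graph, which is the closure
of the former. -/
theorem closure_sumGraph (ha : 0 ≤ a) (hV : Continuous V) (hVim : ∀ x, (V x).im = 0)
    (hVre : ∀ x, (V x).re ≤ 0) :
    closure (sumGraph (SetLike.coe (weakGraph a (fun _ : X => 0) continuous_const))
      (SetLike.coe (weakGraph 0 V hV))) = SetLike.coe (weakGraph a V hV) := by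
  refine Subset.antisymm (closure_minimal (sumGraph_subset_weakGraph hV) (isClosed_weakGraph hV)) ?_
  rw [weakGraph_eq_closure ha hV hVim hVre]
  exact closure_mono (testGraph_subset_sumGraph hV)

/-- With `a = 0` the distributional operator is plain multiplication with maximal domain, by the
fundamental lemma of the calculus of variations. Hence `C₂` is covered by the same theory as `C₁`
and the sum. -/
theorem mem_weakGraph_zero_iff (hV : Continuous V)
    {q : Lp ℂ 2 (volume : Measure X) × Lp ℂ 2 (volume : Measure X)} :
    q ∈ weakGraph 0 V hV ↔ ∀ᵐ x, q.2 x = V x * q.1 x := by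
  have hcomm : ∀ (φ : X → ℂ) x, q.1 x * (V x * φ x) = V x * q.1 x * φ x := fun φ x => by ring
  constructor
  · intro h
    have l2 : LocallyIntegrable q.2 (volume : Measure X) :=
      (Lp.memLp q.2).locallyIntegrable (by norm_num)
    have l1 : LocallyIntegrable (fun x => V x * q.1 x) (volume : Measure X) := by
      have := (((Lp.memLp q.1).locallyIntegrable (by norm_num)).locallyIntegrableOn
        univ).continuousOn_mul hV.continuousOn isOpen_univ.isLocallyClosed
      rwa [locallyIntegrableOn_univ] at this
    refine ae_eq_of_integral_contDiff_smul_eq l2 l1 fun g hg hgc => ?_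
    have hgc' : HasCompactSupport fun x => (g x : ℂ) := hgc.comp_left Complex.ofReal_zero
    have := h (hgc'.toSchwartzMap (Complex.ofRealCLM.contDiff.comp hg)) hgc'
    simp only [testOp, Complex.ofReal_zero, mul_zero, zero_mul, zero_add] at this
    calc ∫ x, g x • q.2 x = ∫ x, q.2 x * (g x : ℂ) := by
          congr 1 with x; rw [Complex.real_smul, mul_comm]
      _ = ∫ x, q.1 x * (V x * (g x : ℂ)) := this
      _ = ∫ x, g x • (V x * q.1 x) := by
          congr 1 with x; rw [Complex.real_smul, mul_comm (g x : ℂ)]; ring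
  · intro h φ hφ
    refine integral_congr_ae ?_
    filter_upwards [h] with x hx
    simp only [testOp, Complex.ofReal_zero, mul_zero, zero_mul, zero_add]
    rw [hx, hcomm]

theorem sub_mem_weakGraph (hV : Continuous V) {q : Lp ℂ 2 (volume : Measure X) × Lp ℂ 2 volume}
    (hq : q ∈ weakGraph a V hV) {g : Lp ℂ 2 (volume : Measure X)}
    (hg : (q.1, g) ∈ weakGraph 0 V hV) :
    (q.1, q.2 - g) ∈ weakGraph a (fun _ : X => 0) continuous_const := fun φ hφ => by
  simp only
  rw [integral_sub_mul _ _ (φ.memLp 2 volume), hq φ hφ, integral_mul_testOp hV hφ, ← hg φ hφ,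
    add_sub_cancel_right]

theorem dense_sub_testGraph (ha : 0 ≤ a) (hV : Continuous V) (hVim : ∀ x, (V x).im = 0)
    (hVre : ∀ x, (V x).re ≤ 0) :
    Dense ((fun q : Lp ℂ 2 (volume : Measure X) × Lp ℂ 2 (volume : Measure X) => q.1 - q.2) ''
      testGraph a V) := by
  rw [Metric.dense_iff]
  intro f ε hε
  obtain ⟨q, hq, h⟩ := exists_testGraph_near ha hV hVim hVre one_pos f hε
  rw [Complex.ofReal_one, one_smul, ← dist_eq_norm] at h
  exact ⟨_, h, q, hq, rfl⟩

end Graphs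

/-! ### The product formula -/

/-- Chernoff's formula for `U h = S₁ h S₂ h`: its difference quotient is `S₁ h` applied to that of
`S₂`, plus that of `S₁`, which tends to the sum of the generators on `C`. -/
theorem tendsto_trotter {H : Type*} [NormedAddCommGroup H] [InnerProductSpace ℂ H] [CompleteSpace H]
    {S₁ S₂ T : ℝ → H →L[ℂ] H} (h₁ : IsContractionSemigroup S₁) (h₂ : IsContractionSemigroup S₂)
    (hT : IsContractionSemigroup T) {M : Submodule ℂ (H × H)} (hM : IsMDissipative M)
    (hTM : generatorGraph T = M) {C : Set (H × H)}
    (hC : C ⊆ sumGraph (generatorGraph S₁) (generatorGraph S₂)) (hCM : C ⊆ M)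
    (hdense : Dense ((fun q => q.1 - q.2) '' C)) {z : ℝ} (hz : 0 ≤ z) (f : H) :
    Tendsto (fun m : ℕ => ((S₁ (z / m) * S₂ (z / m)) ^ m) f) atTop (𝓝 (T z f)) := by
  rcases hz.eq_or_lt with rfl | hz
  · simp [h₁.zero, h₂.zero, hT.zero]
  refine tendsto_pow_of_chernoff (U := fun h => S₁ h * S₂ h) hM hT hTM (fun h hh => ?_) hCM ?_
    hdense hz f
  · exact (norm_mul_le _ _).trans (mul_le_one₀ (h₁.contraction h hh) (norm_nonneg _)
      (h₂.contraction h hh))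
  · intro q hq
    obtain ⟨g₁, g₂, hg₁, hg₂, he⟩ := hC hq
    have hid : Tendsto (fun h : ℝ => h) (𝓝[>] 0) (𝓝 0) := nhdsWithin_le_nhds
    have h3 := h₁.tendsto_apply le_rfl hid (eventually_nhdsWithin_of_forall fun h hh => le_of_lt hh)
      hg₂
    have h4 := h3.add hg₁
    rw [h₁.zero, one_apply_eq_self, add_comm, ← he] at h4
    refine h4.congr fun h => ?_
    simp only [map_smul, map_sub, mul_apply_eq_comp]
    rw [← smul_add]
    congr 1
    abel

end BeamWave

namespace BeamWave

/-! ### Weak solutions -/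

section Pairing

variable {α : Type*} [MeasurableSpace α] {μ : Measure α}

theorem inner_star_comm (f g : Lp ℂ 2 μ) : inner ℂ (star f) g = inner ℂ (star g) f := by
  rw [L2.inner_def, L2.inner_def]
  refine integral_congr_ae ?_
  filter_upwards [Lp.coeFn_star f, Lp.coeFn_star g] with x h1 h2
  rw [h1, h2, RCLike.inner_apply, RCLike.inner_apply, Pi.star_apply, Pi.star_apply]
  simp [mul_comm]

end Pairing

variable {n : ℕ} {k : ℝ} {V : Config n → ℂ}

theorem IsTest.exists_schwartz {θ : Config n → ℂ} (hθ : IsTest θ) :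
    ∃ φ : 𝓢(Config n, ℂ), HasCompactSupport φ ∧ ⇑φ = θ :=
  ⟨hθ.2.toSchwartzMap hθ.1, hθ.2, rfl⟩

theorem isTest_schwartz {φ : 𝓢(Config n, ℂ)} (hφ : HasCompactSupport φ) : IsTest φ :=
  ⟨φ.smooth _, hφ⟩

theorem testOp_eq_kineticTest (k : ℝ) (V : Config n → ℂ) (φ : 𝓢(Config n, ℂ)) (x : Config n) :
    testOp (1 / (2 * k)) V φ x = kineticTest k φ x + V x * φ x := by
  rw [testOp, kineticTest, SchwartzMap.laplacian_apply]
  push_cast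
  ring

theorem kineticGraph_eq_weakGraph (n : ℕ) (k : ℝ) :
    kineticGraph n k = SetLike.coe
      (weakGraph (1 / (2 * k)) (fun _ : Config n => (0 : ℂ)) continuous_const) := by
  ext q
  constructor
  · intro h φ hφ
    rw [h φ (isTest_schwartz hφ)]
    congr 1 with x
    rw [testOp_eq_kineticTest, zero_mul, add_zero]
  · intro h θ hθ
    obtain ⟨φ, hφ, rfl⟩ := hθ.exists_schwartz
    rw [h φ hφ]
    congr 1 with x
    rw [testOp_eq_kineticTest, zero_mul, add_zero]

theorem multGraph_eq_weakGraph (hV : Continuous V) :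
    multGraph V = SetLike.coe (weakGraph 0 V hV) :=
  ext fun _ => (mem_weakGraph_zero_iff hV).symm

theorem IsWeakSolution.mono {I J : Set ℝ} {F₀ : L2 n} {F : ℝ → L2 n}
    (hF : IsWeakSolution k V I F₀ F) (h : J ⊆ I) : IsWeakSolution k V J F₀ F where
  weakCont g := (hF.weakCont g).mono h
  init := hF.init
  eqn θ hθ z hz := hF.eqn θ hθ z (h hz)

theorem IsWeakSolution.congr {Z : ℝ} (hZ : 0 < Z) {F₀ : L2 n} {F G : ℝ → L2 n}
    (hF : IsWeakSolution k V (Icc 0 Z) F₀ F) (h : EqOn G F (Icc 0 Z)) :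
    IsWeakSolution k V (Icc 0 Z) F₀ G where
  weakCont g := (hF.weakCont g).congr fun s hs => by
    simp only
    rw [h hs]
  init := by rw [h (left_mem_Icc.2 hZ.le), hF.init]
  eqn θ hθ z hz := by
    rw [h hz, hF.eqn θ hθ z hz]
    refine intervalIntegral.integral_congr fun s hs => ?_
    rw [uIcc_of_le hz.1] at hs
    exact congrArg (fun f : L2 n => ∫ x, f x * (kineticTest k θ x + V x * θ x))
      (h ⟨hs.1, hs.2.trans hz.2⟩).symm

variable {T : ℝ → L2 n →L[ℂ] L2 n}

/-- For data in the domain this is the integrated generator identity tested against `φ`. Both sides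
are continuous in `F₀`, so density gives the general case. -/
theorem isWeakSolution_semigroup (hV : Continuous V) (hT : IsContractionSemigroup T)
    (hdense : Dense (Prod.fst '' generatorGraph T))
    (hTM : generatorGraph T = SetLike.coe (weakGraph (1 / (2 * k)) V hV)) (F₀ : L2 n) :
    IsWeakSolution k V (Ici 0) F₀ fun z => T z F₀ where
  weakCont g := continuousOn_const.inner (hT.cont F₀)
  init := by rw [hT.zero, one_apply_eq_self]
  eqn θ hθ z hz := by
    obtain ⟨φ, hφ, rfl⟩ := hθ.exists_schwartz
    have hm := memLp_testOp (1 / (2 * k)) hV hφ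
    have hφm := φ.memLp 2 (volume : Measure (Config n))
    simp only [← testOp_eq_kineticTest, ← inner_star_eq_integral_mul _ hm]
    simp only [← inner_star_eq_integral_mul _ hφm]
    have hc : Continuous fun f => ∫ s in (0 : ℝ)..z, inner ℂ (star hm.toLp) (T s f) := by
      refine continuous_integral_apply (U := fun s => innerSL ℂ (star hm.toLp) ∘L T s)
        (C := ‖innerSL ℂ (star hm.toLp)‖) hz (fun s hs => ?_) fun f =>
          continuousOn_const.inner ((hT.cont f).mono Icc_subset_Ici_self)
      refine (ContinuousLinearMap.opNorm_comp_le _ _).trans ?_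
      exact mul_le_of_le_one_right (norm_nonneg _) (hT.contraction s hs.1)
    have key := Continuous.ext_on hdense
      (f := fun f => inner ℂ (star hφm.toLp) (T z f) - inner ℂ (star hφm.toLp) f)
      (by fun_prop) hc ?_
    · exact congrFun key F₀
    rintro _ ⟨q, hq, rfl⟩
    have hI : IntervalIntegrable (fun s => T s q.2) volume 0 z := by
      refine ContinuousOn.intervalIntegrable ((hT.cont q.2).mono ?_)
      rw [uIcc_of_le hz]
      exact Icc_subset_Ici_self
    simp only
    rw [← inner_sub_right, ← hT.integral_apply hq hz]
    have := (innerSL ℂ (star hφm.toLp)).intervalIntegral_comp_comm hI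
    simp only [innerSL_apply_apply] at this
    refine this.symm.trans ?_
    refine intervalIntegral.integral_congr fun s hs => ?_
    rw [uIcc_of_le hz] at hs
    have hp := hT.apply_mem_generatorGraph hq hs.1
    rw [hTM] at hp
    rw [inner_star_eq_integral_mul, inner_star_eq_integral_mul]
    exact hp φ hφ

/-- The functionals `Φ s f = ∫ F_s f` solve the dual equation. The weak formulation gives this on
test functions only; it extends to the whole generator because they form a core. -/
theorem IsWeakSolution.inner_star_eq (hk : 0 ≤ 1 / (2 * k)) (hV : Continuous V)
    (hVim : ∀ x, (V x).im = 0) (hVre : ∀ x, (V x).re ≤ 0) (hT : IsContractionSemigroup T)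
    (hdense : Dense (Prod.fst '' generatorGraph T))
    (hTM : generatorGraph T = SetLike.coe (weakGraph (1 / (2 * k)) V hV)) {Z : ℝ}
    {F₀ : L2 n} {F : ℝ → L2 n} (hF : IsWeakSolution k V (Icc 0 Z) F₀ F) {z : ℝ} (hz : z ∈ Icc 0 Z)
    (f : L2 n) : inner ℂ (star (F z)) f = inner ℂ (star F₀) (T z f) := by
  let Φ : ℝ → L2 n →L[ℂ] ℂ := fun s => innerSL ℂ (star (F s))
  have hΦ : ∀ g, ContinuousOn (fun s => Φ s g) (Icc 0 Z) := fun g =>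
    (hF.weakCont (star g)).congr fun s _ => inner_star_comm (F s) g
  obtain ⟨C, hC⟩ : ∃ C, ∀ s : Icc 0 Z, ‖Φ s‖ ≤ C := by
    -- Weak continuity bounds each `Φ s g` on the compact interval, hence the norms `‖Φ s‖`
    -- uniformly.
    refine banach_steinhaus fun g => ?_
    obtain ⟨C, hC⟩ := isCompact_Icc.exists_bound_of_continuousOn (hΦ g)
    exact ⟨C, fun s => hC s s.2⟩
  have hC' : ∀ s ∈ Icc 0 Z, ‖Φ s‖ ≤ C := fun s hs => hC ⟨s, hs⟩
  have h := functional_eq_of_weak hT.toIsC0Semigroup hdense hΦ hC' (fun q hq z hz => ?_) hz f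
  · simp only [Φ, innerSL_apply_apply, hF.init] at h
    exact h
  rw [hTM, weakGraph_eq_closure hk hV hVim hVre] at hq
  have hsub : Icc 0 z ⊆ Icc 0 Z := Icc_subset_Icc_right hz.2
  have hclosed : IsClosed {q : L2 n × L2 n |
      Φ z q.1 - Φ 0 q.1 = ∫ s in (0 : ℝ)..z, Φ s q.2} := by
    refine isClosed_eq (by fun_prop) ?_
    exact (continuous_integral_apply hz.1 (fun s hs => hC' s (hsub hs))
      fun f => (hΦ f).mono hsub).comp continuous_snd
  refine closure_minimal ?_ hclosed hq
  rintro p ⟨φ, hφ, h1, h2⟩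
  have hm := memLp_testOp (1 / (2 * k)) hV hφ
  have hφm := φ.memLp 2 (volume : Measure (Config n))
  have h3 : p.1 = hφm.toLp := h1
  have h4 : p.2 = hm.toLp := Lp.ext (h2.trans hm.coeFn_toLp.symm)
  have h5 := hF.eqn φ (isTest_schwartz hφ) z hz
  simp only [← testOp_eq_kineticTest, ← inner_star_eq_integral_mul _ hm] at h5
  simp only [← inner_star_eq_integral_mul _ hφm] at h5
  simp only [mem_ofPred_eq, Φ, innerSL_apply_apply, hF.init, h3, h4]
  rw [inner_star_comm (F z), inner_star_comm F₀, h5]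
  exact intervalIntegral.integral_congr fun s _ => inner_star_comm _ _

/-- Both `F` and the orbit of `F₀` are weak solutions, so both have the pairings just computed; the
transpose of `T` is never needed. -/
theorem IsWeakSolution.eqOn (hk : 0 ≤ 1 / (2 * k)) (hV : Continuous V)
    (hVim : ∀ x, (V x).im = 0) (hVre : ∀ x, (V x).re ≤ 0) (hT : IsContractionSemigroup T)
    (hdense : Dense (Prod.fst '' generatorGraph T))
    (hTM : generatorGraph T = SetLike.coe (weakGraph (1 / (2 * k)) V hV)) {Z : ℝ}
    {F₀ : L2 n} {F : ℝ → L2 n} (hF : IsWeakSolution k V (Icc 0 Z) F₀ F) :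
    EqOn F (fun z => T z F₀) (Icc 0 Z) := fun z hz => by
  have hG := (isWeakSolution_semigroup hV hT hdense hTM F₀).mono (J := Icc 0 Z) Icc_subset_Ici_self
  refine star_injective (ext_inner_right ℂ fun f => ?_)
  rw [hF.inner_star_eq hk hV hVim hVre hT hdense hTM hz,
    hG.inner_star_eq hk hV hVim hVre hT hdense hTM hz]

end BeamWave

namespace BeamWave

/-! ### The moment equation for a continuous, real and non-positive potential -/

variable {n : ℕ} {k : ℝ} {V : Config n → ℂ}

theorem IsMDissipative.exists_semigroup_dense {H : Type*} [NormedAddCommGroup H]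
    [InnerProductSpace ℂ H] [CompleteSpace H] {M : Submodule ℂ (H × H)} (hM : IsMDissipative M) :
    ∃ T : ℝ → H →L[ℂ] H, IsContractionSemigroup T ∧ generatorGraph T = M ∧
      Dense (Prod.fst '' generatorGraph T) := by
  obtain ⟨T, hT, hTM⟩ := hM.exists_semigroup
  exact ⟨T, hT, hTM, hTM ▸ hM.dense⟩

theorem exists_semigroup_kinetic (n : ℕ) (hk : 0 ≤ 1 / (2 * k)) :
    ∃ S : ℝ → L2 n →L[ℂ] L2 n, IsContractionSemigroup S ∧ generatorGraph S = kineticGraph n k := by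
  rw [kineticGraph_eq_weakGraph]
  exact (isMDissipative_weakGraph hk continuous_const (fun _ => rfl) fun _ => le_rfl).exists_semigroup

theorem wellPosed_isWeakSolution (hk : 0 ≤ 1 / (2 * k)) (hV : Continuous V)
    (hVim : ∀ x, (V x).im = 0) (hVre : ∀ x, (V x).re ≤ 0) :
    WellPosed (IsWeakSolution (n := n) k V) := by
  obtain ⟨T, hT, hTM, hd⟩ := (isMDissipative_weakGraph hk hV hVim hVre).exists_semigroup_dense
  exact wellPosed_of_eqOn hT (isWeakSolution_semigroup hV hT hd hTM)
    fun Z _ F₀ F hF => hF.eqOn hk hV hVim hVre hT hd hTM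

theorem bounded_potential (hk : 0 ≤ 1 / (2 * k)) (hV : Continuous V)
    (hVim : ∀ x, (V x).im = 0) (hVre : ∀ x, (V x).re ≤ 0) {C : ℝ} (hVC : ∀ x, ‖V x‖ ≤ C) :
    ∃ (S₁ : ℝ → L2 n →L[ℂ] L2 n) (B : L2 n →L[ℂ] L2 n),
      IsContractionSemigroup S₁ ∧ generatorGraph S₁ = kineticGraph n k ∧
      (∀ f : L2 n, (f, B f) ∈ multGraph V) ∧
      WellPosed (IsMildSolution S₁ B) ∧
      (∀ Z : ℝ, 0 < Z → ∀ (F₀ : L2 n) (F : ℝ → L2 n),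
        IsMildSolution S₁ B (Icc 0 Z) F₀ F ↔ IsWeakSolution k V (Icc 0 Z) F₀ F) := by
  obtain ⟨S, hS, hSk⟩ := exists_semigroup_kinetic n hk
  obtain ⟨B, hB, -⟩ := exists_mulCLM (μ := (volume : Measure (Config n)))
    hV.aestronglyMeasurable hVC
  have hBV : ∀ f : L2 n, (f, B f) ∈ multGraph V := hB
  obtain ⟨T, hT, hTM, hd⟩ := (isMDissipative_weakGraph hk hV hVim hVre).exists_semigroup_dense
  -- Multiplication by `V` is everywhere defined here, so the domain of the full operator lies in
  -- that of `C₁`. This is what Duhamel's formula needs.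
  have hBS : ∀ q ∈ generatorGraph T, (q.1, q.2 - B q.1) ∈ generatorGraph S := fun q hq => by
    rw [hSk, kineticGraph_eq_weakGraph]
    rw [hTM] at hq
    exact sub_mem_weakGraph hV hq ((mem_weakGraph_zero_iff hV).2 (hB q.1))
  have hmild := isMildSolution_semigroup hS hT hd hBS
  have hweak := isWeakSolution_semigroup hV hT hd hTM
  have hmild' : ∀ Z, 0 < Z → ∀ F₀ F, IsMildSolution S B (Icc 0 Z) F₀ F →
      EqOn F (fun z => T z F₀) (Icc 0 Z) := fun Z hZ F₀ F hF =>
    hF.eqOn hS hZ.le ((hmild F₀).mono Icc_subset_Ici_self)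
  refine ⟨S, B, hS, hSk, hBV, wellPosed_of_eqOn hT hmild hmild', fun Z hZ F₀ F => ⟨fun hF => ?_,
    fun hF => ?_⟩⟩
  · exact ((hweak F₀).mono Icc_subset_Ici_self).congr hZ (hmild' Z hZ F₀ F hF)
  · exact ((hmild F₀).mono Icc_subset_Ici_self).congr (hF.eqOn hk hV hVim hVre hT hd hTM)

theorem nonpositive_potential (hk : 0 ≤ 1 / (2 * k)) (hV : Continuous V)
    (hVim : ∀ x, (V x).im = 0) (hVre : ∀ x, (V x).re ≤ 0) :
    ∃ S₁ S₂ T : ℝ → L2 n →L[ℂ] L2 n,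
      IsContractionSemigroup S₁ ∧ generatorGraph S₁ = kineticGraph n k ∧
      IsContractionSemigroup S₂ ∧ generatorGraph S₂ = multGraph V ∧
      IsContractionSemigroup T ∧
      generatorGraph T = closure (sumGraph (kineticGraph n k) (multGraph V)) ∧
      (∀ z : ℝ, 0 ≤ z → ∀ F : L2 n,
        Tendsto (fun m : ℕ => ((S₁ (z / m) * S₂ (z / m)) ^ m) F) atTop (𝓝 (T z F))) ∧
      (∀ T' : ℝ → L2 n →L[ℂ] L2 n, IsC0Semigroup T' →
        sumGraph (kineticGraph n k) (multGraph V) ⊆ generatorGraph T' → EqOn T' T (Ici 0)) ∧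
      ∀ F₀ : L2 n, IsWeakSolution k V (Ici 0) F₀ (fun z => T z F₀) := by
  obtain ⟨S, hS, hSk⟩ := exists_semigroup_kinetic n hk
  obtain ⟨S₂, hS₂, hS₂M⟩ := (isMDissipative_weakGraph le_rfl hV hVim hVre).exists_semigroup
  have hM := isMDissipative_weakGraph hk hV hVim hVre
  obtain ⟨T, hT, hTM, hd⟩ := hM.exists_semigroup_dense
  have hcl : closure (sumGraph (kineticGraph n k) (multGraph V)) =
      SetLike.coe (weakGraph (1 / (2 * k)) V hV) := by
    rw [kineticGraph_eq_weakGraph, multGraph_eq_weakGraph hV]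
    exact closure_sumGraph hk hV hVim hVre
  refine ⟨S, S₂, T, hS, hSk, hS₂, by rw [hS₂M, multGraph_eq_weakGraph hV], hT, by rw [hcl, hTM],
    fun z hz F => ?_, fun T' hT' hsub => ?_, isWeakSolution_semigroup hV hT hd hTM⟩
  · refine tendsto_trotter hS hS₂ hT hM hTM (C := testGraph (1 / (2 * k)) V) ?_
      (testGraph_subset_weakGraph hV) (dense_sub_testGraph hk hV hVim hVre) hz F
    rw [hSk, hS₂M, kineticGraph_eq_weakGraph]
    exact testGraph_subset_sumGraph hV
  · refine hT.eqOn_of_generatorGraph_subset hT' hd ?_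
    -- The generator of `T'` is closed, so containing the sum it contains the closure, which is the
    -- generator of `T`.
    rw [hTM, ← hcl]
    exact closure_minimal hsub hT'.isClosed_generatorGraph

end BeamWave

namespace BeamWave

/-! ### The two covariances -/

theorem integral_sum_sum {α ι : Type*} [MeasurableSpace α] {μ : Measure α} [Fintype ι]
    {G : Type*} [NormedAddCommGroup G] [NormedSpace ℝ G]
    {f : ι → ι → α → G} (hf : ∀ j l, Integrable (f j l) μ) :
    ∑ j, ∑ l, ∫ a, f j l a ∂μ = ∫ a, ∑ j, ∑ l, f j l a ∂μ := by
  rw [integral_finsetSum _ fun j _ => integrable_finsetSum _ fun l _ => hf j l]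
  exact Finset.sum_congr rfl fun j _ => (integral_finsetSum _ fun l _ => hf j l).symm

theorem continuous_potential {n : ℕ} (k : ℝ) {Γ : Plane → Plane → ℂ}
    (hΓ : Continuous (Function.uncurry Γ)) : Continuous (potential (n := n) k Γ) := by
  refine continuous_const.mul (continuous_finsetSum _ fun j _ => continuous_finsetSum _ fun l _ => ?_)
  have : Continuous fun x : Config n => (x j, x l) := by fun_prop
  exact hΓ.comp this

theorem norm_potential_le {n : ℕ} (k : ℝ) {Γ : Plane → Plane → ℂ} {C : ℝ}
    (hΓ : ∀ x y, ‖Γ x y‖ ≤ C) (x : Config n) : ‖potential k Γ x‖ ≤ k ^ 2 * (n * (n * C)) := by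
  rw [potential, norm_mul, norm_neg, norm_pow, Complex.norm_real, Real.norm_eq_abs, sq_abs]
  gcongr
  refine (norm_sum_le_of_le _ fun j _ => norm_sum_le_of_le _ fun l _ => hΓ (x j) (x l)).trans ?_
  simp

namespace IsSpectralDensity

variable {H η K : ℝ} {Φ : ℝ → Plane → ℝ}

theorem measurable_apply (hΦ : IsSpectralDensity H η K Φ) (ξ : ℝ) : Measurable (Φ ξ) :=
  hΦ.measurable.comp measurable_prodMk_left

theorem bound_zero (hΦ : IsSpectralDensity H η K Φ) {p : Plane} (hp : p ≠ 0) :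
    Φ 0 p ≤ |K| * (η ^ 2 + ‖p‖ ^ 2) ^ (-H - 3 / 2) := by
  have h := hΦ.bound 0 p (by simpa using hp)
  rw [zero_pow two_ne_zero, zero_add] at h
  exact h.trans (by gcongr; exact le_abs_self K)

/-! ### The homogeneous covariance -/

/-- Comparison with `(1 + ‖p‖²)^(-H - 3/2)`, integrable in the plane since `2 < 2H + 3`; the outer
scale enters through `η² + ‖p‖² ≥ min(1, η²) (1 + ‖p‖²)`. -/
theorem integrable_apply (hΦ : IsSpectralDensity H η K Φ) (hη : 0 < η) (hH : 0 < H) :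
    Integrable (Φ 0) := by
  have hdim : (Module.finrank ℝ Plane : ℝ) < 2 * H + 3 := by
    rw [finrank_euclideanSpace_fin]; push_cast; linarith
  have h1 := (integrable_rpow_neg_one_add_norm_sq (μ := (volume : Measure Plane)) hdim).const_mul
    (|K| * (min 1 (η ^ 2)) ^ (-H - 3 / 2))
  refine h1.mono' (hΦ.measurable_apply 0).aestronglyMeasurable ?_
  filter_upwards [compl_mem_ae_iff.2 (measure_singleton (0 : Plane))] with p hp
  rw [Real.norm_of_nonneg (hΦ.nonneg 0 p)]
  refine (hΦ.bound_zero hp).trans ?_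
  have hm : 0 < min 1 (η ^ 2) := lt_min one_pos (by positivity)
  rw [show -(2 * H + 3) / 2 = -H - 3 / 2 by ring, mul_assoc,
    ← Real.mul_rpow hm.le (by positivity)]
  gcongr ?_ * ?_
  refine Real.rpow_le_rpow_of_nonpos (by positivity) ?_ (by linarith)
  rw [mul_add, mul_one]
  gcongr
  · exact min_le_right _ _
  · exact mul_le_of_le_one_left (by positivity) (min_le_left _ _)

theorem norm_covKernel_le (hΦ : IsSpectralDensity H η K Φ) (x y p : Plane) :
    ‖covKernel Φ x y p‖ ≤ Φ 0 p := by
  rw [covKernel, norm_mul, Real.norm_of_nonneg (hΦ.nonneg 0 p)]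
  exact mul_le_of_le_one_left (hΦ.nonneg 0 p) (Real.abs_cos_le_one _)

theorem aestronglyMeasurable_covKernel (hΦ : IsSpectralDensity H η K Φ) (x y : Plane) :
    AEStronglyMeasurable (covKernel Φ x y) :=
  (Continuous.aestronglyMeasurable (by fun_prop)).mul
    (hΦ.measurable_apply 0).aestronglyMeasurable

theorem integrable_covKernel (hΦ : IsSpectralDensity H η K Φ) (hη : 0 < η) (hH : 0 < H)
    (x y : Plane) : Integrable (covKernel Φ x y) :=
  (hΦ.integrable_apply hη hH).mono' (hΦ.aestronglyMeasurable_covKernel x y)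
    (ae_of_all _ (hΦ.norm_covKernel_le x y))

theorem continuous_cov (hΦ : IsSpectralDensity H η K Φ) (hη : 0 < η) (hH : 0 < H) :
    Continuous (Function.uncurry (cov Φ)) := by
  refine Complex.continuous_ofReal.comp (continuous_const.mul ?_)
  refine continuous_of_dominated (bound := Φ 0)
    (fun z => hΦ.aestronglyMeasurable_covKernel z.1 z.2)
    (fun z => ae_of_all _ (hΦ.norm_covKernel_le z.1 z.2)) (hΦ.integrable_apply hη hH)
    (ae_of_all _ fun p => ?_)
  unfold covKernel
  fun_prop

theorem norm_cov_le (hΦ : IsSpectralDensity H η K Φ) (hη : 0 < η) (hH : 0 < H) (x y : Plane) :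
    ‖cov Φ x y‖ ≤ Real.pi * ∫ p, Φ 0 p := by
  rw [cov, Complex.norm_real, norm_mul, Real.norm_of_nonneg Real.pi_pos.le]
  gcongr
  exact norm_integral_le_of_norm_le (hΦ.integrable_apply hη hH)
    (ae_of_all _ (hΦ.norm_covKernel_le x y))

/-- The addition formula for the cosine makes the double sum equal to `|∑ exp(i x_j·p)|²`, which
exhibits the sign. -/
theorem potential_cov (hΦ : IsSpectralDensity H η K Φ) (hη : 0 < η) (hH : 0 < H) {n : ℕ} (k : ℝ)
    (x : Config n) :
    potential k (cov Φ) x = ((-(k ^ 2 * (Real.pi * ∫ p : Plane,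
      ((∑ j, Real.cos (inner ℝ (x j) p)) ^ 2 + (∑ j, Real.sin (inner ℝ (x j) p)) ^ 2) * Φ 0 p)) :
        ℝ) : ℂ) := by
  have h : ∀ p : Plane, ((∑ j, Real.cos (inner ℝ (x j) p)) ^ 2 +
      (∑ j, Real.sin (inner ℝ (x j) p)) ^ 2) * Φ 0 p =
      ∑ j, ∑ l, covKernel Φ (x j) (x l) p := fun p => by
    rw [sq, sq, Finset.sum_mul_sum, Finset.sum_mul_sum, ← Finset.sum_add_distrib, Finset.sum_mul]
    refine Finset.sum_congr rfl fun j _ => ?_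
    rw [← Finset.sum_add_distrib, Finset.sum_mul]
    refine Finset.sum_congr rfl fun l _ => ?_
    rw [covKernel, inner_sub_left, Real.cos_sub]
  simp only [h]
  rw [← integral_sum_sum fun j l => hΦ.integrable_covKernel hη hH (x j) (x l), Finset.mul_sum]
  simp only [Finset.mul_sum Finset.univ _ Real.pi]
  simp only [potential, cov]
  push_cast
  ring

theorem potential_cov_nonpos (hΦ : IsSpectralDensity H η K Φ) (hη : 0 < η) (hH : 0 < H) {n : ℕ}
    (k : ℝ) (x : Config n) :
    (potential k (cov Φ) x).im = 0 ∧ (potential k (cov Φ) x).re ≤ 0 := by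
  rw [hΦ.potential_cov hη hH]
  refine ⟨Complex.ofReal_im _, ?_⟩
  rw [Complex.ofReal_re, neg_nonpos]
  refine mul_nonneg (sq_nonneg k) (mul_nonneg Real.pi_pos.le (integral_nonneg fun p => ?_))
  exact mul_nonneg (by positivity) (hΦ.nonneg 0 p)

/-! ### The covariance of the increments -/

/-- In polar coordinates the bound is `y^(-2H)` near `0`, integrable because `H < 1/2`, and `y^(-2H
- 2)` at infinity. -/
theorem integrable_min_sq_mul (hΦ : IsSpectralDensity H 0 K Φ) (hH : 0 < H) (hH' : H < 1 / 2) :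
    Integrable fun p : Plane => (min 1 ‖p‖) ^ 2 * Φ 0 p := by
  have h1 : Integrable fun p : Plane => (min 1 ‖p‖) ^ 2 * ‖p‖ ^ (-2 * H - 3) := by
    refine (integrable_fun_norm_addHaar (volume : Measure Plane)
      (f := fun y => (min 1 y) ^ 2 * y ^ (-2 * H - 3))).2 ?_
    rw [finrank_euclideanSpace_fin, ← Ioc_union_Ioi_eq_Ioi zero_le_one]
    refine IntegrableOn.union ?_ ?_
    · have h2 : IntegrableOn (fun y : ℝ => y ^ (-2 * H)) (Ioc 0 1) :=
        (intervalIntegrable_iff_integrableOn_Ioc_of_le zero_le_one).1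
          (intervalIntegral.intervalIntegrable_rpow' (by linarith))
      refine h2.congr_fun (fun y hy => ?_) measurableSet_Ioc
      have h3 : y ^ (-2 * H) = y ^ (-2 * H - 3) * y ^ (3 : ℝ) := by
        rw [← Real.rpow_add hy.1]; congr 1; ring
      simp only [smul_eq_mul, min_eq_right hy.2]
      rw [h3, show (3 : ℝ) = (3 : ℕ) by norm_num, Real.rpow_natCast]
      norm_num
      ring
    · have h2 : IntegrableOn (fun y : ℝ => y ^ (-2 * H - 2)) (Ioi 1) :=
        integrableOn_Ioi_rpow_of_lt (by linarith) one_pos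
      refine h2.congr_fun (fun y hy => ?_) measurableSet_Ioi
      have hy' : 1 < y := hy
      have h3 : y ^ (-2 * H - 2) = y ^ (-2 * H - 3) * y ^ (1 : ℝ) := by
        rw [← Real.rpow_add (one_pos.trans hy')]; congr 1; ring
      simp only [smul_eq_mul, min_eq_left hy'.le]
      rw [h3, Real.rpow_one]
      norm_num
      ring
  refine (h1.const_mul |K|).mono' ?_ (ae_of_all _ fun p => ?_)
  · exact ((Continuous.measurable (by fun_prop)).mul (hΦ.measurable_apply 0)).aestronglyMeasurable
  · rw [Real.norm_of_nonneg (mul_nonneg (by positivity) (hΦ.nonneg 0 p))]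
    rcases eq_or_ne p 0 with rfl | hp
    · simp
    · have h2 := hΦ.bound_zero hp
      rw [zero_pow two_ne_zero, zero_add, ← Real.rpow_natCast, ← Real.rpow_mul (norm_nonneg p),
        show ((2 : ℕ) : ℝ) * (-H - 3 / 2) = -2 * H - 3 by push_cast; ring] at h2
      rw [mul_left_comm]
      gcongr

/-- Combines the bounds `2` and `‖x‖ ‖p‖`. Two such factors supply the `(min 1 ‖p‖)²` that tames the
spectral singularity. -/
theorem norm_exp_inner_sub_one_le (x p : Plane) :
    ‖Complex.exp (Complex.I * (inner ℝ x p : ℝ)) - 1‖ ≤ (2 + ‖x‖) * min 1 ‖p‖ := by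
  rcases le_total 1 ‖p‖ with h | h
  · rw [min_eq_left h, mul_one]
    refine (norm_sub_le _ _).trans ?_
    rw [Complex.norm_exp_I_mul_ofReal, norm_one]
    linarith [norm_nonneg x]
  · rw [min_eq_right h]
    refine (Real.norm_exp_I_mul_ofReal_sub_one_le).trans ?_
    refine (norm_inner_le_norm x p).trans ?_
    gcongr
    linarith

theorem exp_neg_inner_sub_one (y p : Plane) :
    Complex.exp (-Complex.I * (inner ℝ y p : ℝ)) - 1 =
      starRingEnd ℂ (Complex.exp (Complex.I * (inner ℝ y p : ℝ)) - 1) := by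
  rw [map_sub, map_one, ← Complex.exp_conj, map_mul, Complex.conj_I, Complex.conj_ofReal]

theorem norm_structCovKernel_le (hΦ : IsSpectralDensity H 0 K Φ) (x y p : Plane) :
    ‖structCovKernel Φ x y p‖ ≤ (2 + ‖x‖) * (2 + ‖y‖) * ((min 1 ‖p‖) ^ 2 * Φ 0 p) := by
  rw [structCovKernel, exp_neg_inner_sub_one, norm_mul, norm_mul, RCLike.norm_conj,
    Complex.norm_real, Real.norm_of_nonneg (hΦ.nonneg 0 p)]
  calc _ ≤ ((2 + ‖x‖) * min 1 ‖p‖) * ((2 + ‖y‖) * min 1 ‖p‖) * Φ 0 p := by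
        have := hΦ.nonneg 0 p
        gcongr
        · exact norm_exp_inner_sub_one_le x p
        · exact norm_exp_inner_sub_one_le y p
    _ = _ := by ring

theorem aestronglyMeasurable_structCovKernel (hΦ : IsSpectralDensity H 0 K Φ) (x y : Plane) :
    AEStronglyMeasurable (structCovKernel Φ x y) :=
  (Continuous.aestronglyMeasurable (by fun_prop)).mul
    (Complex.measurable_ofReal.comp (hΦ.measurable_apply 0)).aestronglyMeasurable

theorem integrable_structCovKernel (hΦ : IsSpectralDensity H 0 K Φ) (hH : 0 < H) (hH' : H < 1 / 2)
    (x y : Plane) : Integrable (structCovKernel Φ x y) :=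
  ((hΦ.integrable_min_sq_mul hH hH').const_mul _).mono'
    (hΦ.aestronglyMeasurable_structCovKernel x y) (ae_of_all _ (hΦ.norm_structCovKernel_le x y))

theorem continuous_structCov (hΦ : IsSpectralDensity H 0 K Φ) (hH : 0 < H) (hH' : H < 1 / 2) :
    Continuous (Function.uncurry (structCov Φ)) := by
  refine continuous_const.mul (continuous_iff_continuousAt.2 fun z₀ => ?_)
  have hc : Continuous fun z : Plane × Plane => (2 + ‖z.1‖) * (2 + ‖z.2‖) := by fun_prop
  refine continuousAt_of_dominated (bound := fun p =>
      ((2 + ‖z₀.1‖) * (2 + ‖z₀.2‖) + 1) * ((min 1 ‖p‖) ^ 2 * Φ 0 p))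
    (.of_forall fun z => hΦ.aestronglyMeasurable_structCovKernel z.1 z.2) ?_
    ((hΦ.integrable_min_sq_mul hH hH').const_mul _) (ae_of_all _ fun p => ?_)
  · filter_upwards [hc.continuousAt.eventually_lt_const (lt_add_one _)] with z hz
    refine ae_of_all _ fun p => (hΦ.norm_structCovKernel_le z.1 z.2 p).trans ?_
    exact mul_le_mul_of_nonneg_right hz.le (mul_nonneg (by positivity) (hΦ.nonneg 0 p))
  · refine Continuous.continuousAt ?_
    unfold structCovKernel
    fun_prop

/-- The second factor of the kernel is the conjugate of the first with `y` in place of `x`, so the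
double sum is a squared modulus. -/
theorem potential_structCov (hΦ : IsSpectralDensity H 0 K Φ) (hH : 0 < H) (hH' : H < 1 / 2) {n : ℕ}
    (k : ℝ) (x : Config n) :
    potential k (structCov Φ) x = ((-(k ^ 2 * (Real.pi * ∫ p : Plane,
      Complex.normSq (∑ j, (Complex.exp (Complex.I * (inner ℝ (x j) p : ℝ)) - 1)) * Φ 0 p)) :
        ℝ) : ℂ) := by
  have h : ∀ p : Plane, (((Complex.normSq (∑ j, (Complex.exp (Complex.I * (inner ℝ (x j) p : ℝ)) -
      1)) * Φ 0 p : ℝ)) : ℂ) = ∑ j, ∑ l, structCovKernel Φ (x j) (x l) p := fun p => by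
    rw [Complex.ofReal_mul, Complex.normSq_eq_conj_mul_self, mul_comm (starRingEnd ℂ _), map_sum,
      Finset.sum_mul_sum, Finset.sum_mul]
    refine Finset.sum_congr rfl fun j _ => ?_
    rw [Finset.sum_mul]
    refine Finset.sum_congr rfl fun l _ => ?_
    rw [structCovKernel, exp_neg_inner_sub_one]
  rw [Complex.ofReal_neg, Complex.ofReal_mul, Complex.ofReal_mul, ← integral_complex_ofReal]
  simp only [h]
  rw [← integral_sum_sum fun j l => hΦ.integrable_structCovKernel hH hH' (x j) (x l),
    Finset.mul_sum]
  simp only [Finset.mul_sum Finset.univ _ (Real.pi : ℂ)]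
  simp only [potential, structCov]
  push_cast
  ring

theorem potential_structCov_nonpos (hΦ : IsSpectralDensity H 0 K Φ) (hH : 0 < H) (hH' : H < 1 / 2)
    {n : ℕ} (k : ℝ) (x : Config n) :
    (potential k (structCov Φ) x).im = 0 ∧ (potential k (structCov Φ) x).re ≤ 0 := by
  rw [hΦ.potential_structCov hH hH']
  refine ⟨Complex.ofReal_im _, ?_⟩
  rw [Complex.ofReal_re, neg_nonpos]
  refine mul_nonneg (sq_nonneg k) (mul_nonneg Real.pi_pos.le (integral_nonneg fun p => ?_))
  exact mul_nonneg (Complex.normSq_nonneg _) (hΦ.nonneg 0 p)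

end IsSpectralDensity

end BeamWave

namespace BeamWave

/-! ### Correlations of random fields -/

theorem lintegral_fin_prod {E : Type*} [MeasureSpace E] [SigmaFinite (volume : Measure E)]
    {g : E → ENNReal} (hg : Measurable g) (n : ℕ) :
    ∫⁻ y : Fin n → E, ∏ i, g (y i) = (∫⁻ x, g x) ^ n := by
  induction n with
  | zero =>
    rw [volume_pi, Measure.pi_of_empty]
    simp
  | succ n ih =>
    have hm : Measurable fun y : Fin n → E => ∏ i, g (y i) :=
      Finset.measurable_prod _ fun i _ => hg.comp (measurable_pi_apply i)
    calc ∫⁻ y : Fin (n + 1) → E, ∏ i, g (y i)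
        = ∫⁻ y : E × (Fin n → E), g y.1 * ∏ i, g (y.2 i) := by
          refine (((measurePreserving_piFinSuccAbove (fun _ => (volume : Measure E))
            0).symm).lintegral_comp_emb (MeasurableEquiv.measurableEmbedding _)
              (fun y => ∏ i, g (y i))).symm.trans (lintegral_congr fun y => ?_)
          simp [Fin.prod_univ_succ, MeasurableEquiv.piFinSuccAbove_symm_apply]
      _ = (∫⁻ x, g x) ^ (n + 1) := by
          rw [Measure.volume_eq_prod, lintegral_prod_mul hg.aemeasurable hm.aemeasurable, ih, pow_succ']

/-- Uniqueness of Haar measure. Only finiteness of an integral is at stake later, so the value of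
`c` is irrelevant. -/
theorem exists_volume_piLp_eq_smul (ι E : Type*) [Fintype ι] [NormedAddCommGroup E]
    [InnerProductSpace ℝ E] [FiniteDimensional ℝ E] [MeasurableSpace E] [BorelSpace E] :
    ∃ c : NNReal, (volume : Measure (PiLp 2 fun _ : ι => E)) =
      c • (volume : Measure (ι → E)).map (WithLp.toLp 2) := by
  have h : ((volume : Measure (ι → E)).map
      (WithLp.toLp 2 : _ → PiLp 2 fun _ : ι => E)).IsAddHaarMeasure :=
    (PiLp.continuousLinearEquiv 2 ℝ fun _ : ι => E).symm.isAddHaarMeasure_map _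
  exact ⟨_, Measure.isAddLeftInvariant_eq_smul _ _⟩

/-- A weighted Cauchy–Schwarz inequality. -/
theorem sq_lintegral_le {Ω : Type*} [MeasurableSpace Ω] {P : Measure Ω} {g w : Ω → ENNReal}
    (hg : Measurable g) (hw : Measurable w) (hw0 : ∀ ω, w ω ≠ 0) (hwt : ∀ᵐ ω ∂P, w ω ≠ ⊤) :
    (∫⁻ ω, g ω ∂P) ^ 2 ≤ (∫⁻ ω, w ω ∂P) * ∫⁻ ω, g ω ^ 2 * (w ω)⁻¹ ∂P := by
  have h1 := ENNReal.lintegral_mul_le_Lp_mul_Lq P Real.HolderConjugate.two_two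
    (f := fun ω => w ω ^ (1 / 2 : ℝ)) (g := fun ω => g ω * (w ω)⁻¹ ^ (1 / 2 : ℝ))
    (hw.pow_const _).aemeasurable (hg.mul (hw.inv.pow_const _)).aemeasurable
  have h2 : ∫⁻ ω, g ω ∂P = ∫⁻ ω, ((fun ω => w ω ^ (1 / 2 : ℝ)) *
      fun ω => g ω * (w ω)⁻¹ ^ (1 / 2 : ℝ)) ω ∂P := by
    refine lintegral_congr_ae ?_
    filter_upwards [hwt] with ω hω
    rw [Pi.mul_apply, mul_left_comm, ← ENNReal.mul_rpow_of_nonneg _ _ (by norm_num),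
      ENNReal.mul_inv_cancel (hw0 ω) hω, ENNReal.one_rpow, mul_one]
  have h3 : ∀ a : ENNReal, (a ^ (1 / 2 : ℝ)) ^ 2 = a := fun a => by
    rw [← ENNReal.rpow_natCast, ← ENNReal.rpow_mul]; norm_num
  rw [← h2] at h1
  refine (pow_le_pow_left₀ zero_le h1 2).trans_eq ?_
  rw [mul_pow, h3, h3]
  simp only [ENNReal.rpow_two, mul_pow, h3]

theorem measurable_prod_field {Ω : Type*} [MeasurableSpace Ω] {Ψ₀ : Ω → Plane → ℂ}
    (hΨ : Measurable (Function.uncurry Ψ₀)) (n : ℕ) :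
    Measurable fun z : Config n × Ω => ∏ j : Fin n, Ψ₀ z.2 (z.1 j) := by
  refine Finset.measurable_prod _ fun j _ => ?_
  have : Measurable fun z : Config n × Ω => (z.2, z.1 j) := by fun_prop
  exact hΨ.comp this

/-- With `u = ‖Ψ₀‖^n`, the squared product integrates over `x` to a multiple of `u²`, whereas only
`E u` is finite. Cauchy–Schwarz with the weight `u + 1` replaces `u²` by `u² / (u + 1) ≤ u + 1`. -/
theorem memLp_initialCorrelation {Ω : Type*} [MeasurableSpace Ω] (P : Measure Ω)
    [IsProbabilityMeasure P] {Ψ₀ : Ω → Plane → ℂ} (hΨ : Measurable (Function.uncurry Ψ₀)) (n : ℕ)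
    (hint : ∫⁻ ω, (eLpNorm (Ψ₀ ω) 2 volume) ^ n ∂P < ⊤) :
    MemLp (initialCorrelation P Ψ₀ n) 2 volume := by
  have hf := measurable_prod_field hΨ n
  refine ⟨(hf.stronglyMeasurable.integral_prod_right).aestronglyMeasurable, ?_⟩
  rw [eLpNorm_lt_top_iff_lintegral_rpow_enorm_lt_top (by norm_num) (by norm_num)]
  simp only [ENNReal.toReal_ofNat, ENNReal.rpow_two]
  let a : Ω → ENNReal := fun ω => ∫⁻ y, ‖Ψ₀ ω y‖ₑ ^ 2
  have ha : Measurable a := ((hΨ.enorm.pow_const 2).lintegral_prod_right')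
  have hN : ∀ ω, eLpNorm (Ψ₀ ω) 2 volume = a ω ^ (1 / 2 : ℝ) := fun ω => by
    rw [eLpNorm_eq_lintegral_rpow_enorm_toReal (by norm_num) (by norm_num)]
    simp [a]
  let u : Ω → ENNReal := fun ω => (eLpNorm (Ψ₀ ω) 2 volume) ^ n
  have hu : Measurable u := by
    simp only [u, hN]
    exact (ha.pow_const _).pow_const _
  have hu2 : ∀ ω, a ω ^ n = u ω ^ 2 := fun ω => by
    simp only [u, hN]
    rw [← pow_mul, mul_comm n, pow_mul, ← ENNReal.rpow_two, ← ENNReal.rpow_mul]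
    norm_num
  -- Adding `1` keeps the weight away from zero, where its inverse would be infinite, and preserves
  -- integrability because `P` is a probability measure.
  let w : Ω → ENNReal := fun ω => u ω + 1
  have hw : Measurable w := hu.add_const 1
  have hwint : ∫⁻ ω, w ω ∂P < ⊤ := by
    rw [lintegral_add_right _ measurable_const, lintegral_one, measure_univ]
    exact ENNReal.add_lt_top.2 ⟨hint, ENNReal.one_lt_top⟩
  have hw0 : ∀ ω, w ω ≠ 0 := fun ω => by simp [w]
  have hwt : ∀ᵐ ω ∂P, w ω ≠ ⊤ := (ae_lt_top hw hwint.ne).mono fun _ h => h.ne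
  obtain ⟨c, hc⟩ := exists_volume_piLp_eq_smul (Fin n) Plane
  have hpt : ∀ x : Config n, ‖initialCorrelation P Ψ₀ n x‖ₑ ^ 2 ≤
      (∫⁻ ω, w ω ∂P) * ∫⁻ ω, ‖∏ j, Ψ₀ ω (x j)‖ₑ ^ 2 * (w ω)⁻¹ ∂P := fun x =>
    (pow_le_pow_left₀ zero_le (enorm_integral_le_lintegral_enorm _) 2).trans
      (sq_lintegral_le (hf.comp measurable_prodMk_left).enorm hw hw0 hwt)
  have hjoint : Measurable fun z : Config n × Ω => ‖∏ j, Ψ₀ z.2 (z.1 j)‖ₑ ^ 2 * (w z.2)⁻¹ :=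
    (hf.enorm.pow_const 2).mul (hw.comp measurable_snd).inv
  have hfω : ∀ ω, Measurable fun x : Config n => ‖∏ j, Ψ₀ ω (x j)‖ₑ ^ 2 := fun ω =>
    (hf.comp measurable_prodMk_right).enorm.pow_const 2
  have hx : ∀ ω, ∫⁻ x : Config n, ‖∏ j, Ψ₀ ω (x j)‖ₑ ^ 2 = c * u ω ^ 2 := fun ω => by
    have hm : Measurable fun y => ‖Ψ₀ ω y‖ₑ ^ 2 := (hΨ.comp measurable_prodMk_left).enorm.pow_const 2
    rw [hc, lintegral_smul_measure, lintegral_map (hfω ω) (WithLp.measurable_toLp 2 _), ← hu2,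
      ← lintegral_fin_prod hm]
    simp only [enorm_eq_nnnorm, nnnorm_prod, ENNReal.ofNNReal_finsetProd, Finset.prod_pow, ENNReal.smul_def, smul_eq_mul]
  refine (lintegral_mono hpt).trans_lt ?_
  rw [lintegral_const_mul _ hjoint.lintegral_prod_right', lintegral_lintegral_swap
    hjoint.aemeasurable]
  refine ENNReal.mul_lt_top hwint ?_
  calc ∫⁻ ω, ∫⁻ x : Config n, ‖∏ j, Ψ₀ ω (x j)‖ₑ ^ 2 * (w ω)⁻¹ ∂volume ∂P
      ≤ ∫⁻ ω, c * w ω ∂P := by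
        refine lintegral_mono fun ω => ?_
        rw [lintegral_mul_const _ (hfω ω), hx, sq,
          mul_assoc, mul_assoc]
        gcongr
        refine (mul_le_mul' (self_le_add_right (u ω) 1)
          (mul_le_mul_left (self_le_add_right (u ω) 1) _)).trans ?_
        exact mul_le_of_le_one_right zero_le (ENNReal.mul_inv_le_one _)
    _ < ⊤ := by
        rw [lintegral_const_mul _ hw]
        exact ENNReal.mul_lt_top ENNReal.coe_lt_top hwint

end BeamWave
-- The theorem for the two covariances
theorem mainTheorem2 (n : ℕ) (k : ℝ) (hk : 0 < k) :
    -- the initial data lie in `L²(ℝ^{2n})`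
    (∀ (Ω : Type*) [MeasurableSpace Ω] (P : Measure Ω) [IsProbabilityMeasure P]
        (Ψ₀ : Ω → Plane → ℂ), Measurable (Function.uncurry Ψ₀) →
        ∫⁻ ω, (eLpNorm (Ψ₀ ω) 2 volume) ^ n ∂P < ⊤ →
        MemLp (initialCorrelation P Ψ₀ n) 2 volume) ∧
    -- the bounded covariance
    (∀ (H η K : ℝ) (Φ : ℝ → Plane → ℝ), H ∈ Ioo 0 1 → 0 < η → IsSpectralDensity H η K Φ →
      (∀ x y, Integrable (covKernel Φ x y)) ∧
      (∃ M : ℝ, ∀ x : Config n, ‖potential k (cov Φ) x‖ ≤ M) ∧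
      ∃ (S₁ : ℝ → L2 n →L[ℂ] L2 n) (B : L2 n →L[ℂ] L2 n),
        IsContractionSemigroup S₁ ∧ generatorGraph S₁ = kineticGraph n k ∧
        (∀ f : L2 n, (f, B f) ∈ multGraph (potential k (cov Φ))) ∧
        WellPosed (IsMildSolution S₁ B) ∧
        (∀ Z : ℝ, 0 < Z → ∀ (F₀ : L2 n) (F : ℝ → L2 n),
          IsMildSolution S₁ B (Icc 0 Z) F₀ F ↔
            IsWeakSolution k (potential k (cov Φ)) (Icc 0 Z) F₀ F) ∧
        WellPosed (IsWeakSolution (n := n) k (potential k (cov Φ)))) ∧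
    -- the structure-function covariance
    (∀ (H K : ℝ) (Φ : ℝ → Plane → ℝ), H ∈ Ioo 0 (1 / 2) → IsSpectralDensity H 0 K Φ →
      (∀ x y, Integrable (structCovKernel Φ x y)) ∧
      (∀ x : Config n, (potential k (structCov Φ) x).im = 0 ∧
        (potential k (structCov Φ) x).re ≤ 0) ∧
      ∃ S₁ S₂ T : ℝ → L2 n →L[ℂ] L2 n,
        IsContractionSemigroup S₁ ∧ generatorGraph S₁ = kineticGraph n k ∧
        IsContractionSemigroup S₂ ∧
        generatorGraph S₂ = multGraph (potential k (structCov Φ)) ∧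
        IsContractionSemigroup T ∧
        generatorGraph T =
          closure (sumGraph (kineticGraph n k) (multGraph (potential k (structCov Φ)))) ∧
        (∀ z : ℝ, 0 ≤ z → ∀ F : L2 n,
          Tendsto (fun m : ℕ => ((S₁ (z / m) * S₂ (z / m)) ^ m) F) atTop (𝓝 (T z F))) ∧
        (∀ T' : ℝ → L2 n →L[ℂ] L2 n, IsC0Semigroup T' →
          sumGraph (kineticGraph n k) (multGraph (potential k (structCov Φ))) ⊆
            generatorGraph T' →
          EqOn T' T (Ici 0)) ∧
        (∀ F₀ : L2 n, IsWeakSolution k (potential k (structCov Φ)) (Ici 0) F₀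
          (fun z => T z F₀)) ∧
        WellPosed (IsWeakSolution (n := n) k (potential k (structCov Φ)))) := by
  have ha : 0 ≤ 1 / (2 * k) := by positivity
  refine ⟨fun Ω _ P _ Ψ₀ hΨ hint => memLp_initialCorrelation P hΨ n hint,
    fun H η K Φ hH hη hΦ => ?_, fun H K Φ hH hΦ => ?_⟩
  · have hV := continuous_potential (n := n) k (hΦ.continuous_cov hη hH.1)
    have hVn := hΦ.potential_cov_nonpos hη hH.1 (n := n) k
    have hVC := norm_potential_le (n := n) k (hΦ.norm_cov_le hη hH.1)
    obtain ⟨S₁, B, h1, h2, h3, h4, h5⟩ := bounded_potential ha hV (fun x => (hVn x).1)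
      (fun x => (hVn x).2) hVC
    exact ⟨hΦ.integrable_covKernel hη hH.1, ⟨_, hVC⟩, S₁, B, h1, h2, h3, h4, h5,
      wellPosed_isWeakSolution ha hV (fun x => (hVn x).1) fun x => (hVn x).2⟩
  · have hV := continuous_potential (n := n) k (hΦ.continuous_structCov hH.1 hH.2)
    have hVn := hΦ.potential_structCov_nonpos hH.1 hH.2 (n := n) k
    obtain ⟨S₁, S₂, T, h1, h2, h3, h4, h5, h6, h7, h8, h9⟩ := nonpositive_potential ha hV
      (fun x => (hVn x).1) (fun x => (hVn x).2)
    exact ⟨hΦ.integrable_structCovKernel hH.1 hH.2, hVn, S₁, S₂, T, h1, h2, h3, h4, h5, h6, h7,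
      h8, h9, wellPosed_isWeakSolution ha hV (fun x => (hVn x).1) fun x => (hVn x).2⟩
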